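/- **Setting.** Let $\Gamma_L=\mathbb Z^2/L\mathbb Z^2$ with $L\in 4\mathbb N$, $L\ge 4$, unit vectors $e_1,e_2$, and bonds $(x,\mu)$ joining $x$ and $x+e_\mu$, $\mu=1,2$. On the total space $\mathcal F_L\otimes\bigotimes_{(x,\mu)}\mathbb C^2$ ($\mathcal F_L$ the fermionic Fock space over $\ell^2(\Gamma_L)$) let $a_x^\pm$ be the fermionic creation/annihilation operators, $n_x=a^+_xa^-_x$, $N=\sum_x n_x$, $X_{x,\mu},Z_{x,\mu}$ the first and third Pauli matrices on the bonds, $Q_x=X_{x,1}X_{x,2}X_{x-e_1,1}X_{x-e_2,2}(-1)^{n_x}$, and, for $t>0$, $$H=-\sum_{\Lambda}\prod_{(x,\mu)\in\partial\Lambda}Z_{x,\mu}-t\sum_{x}\sum_{\mu=1,2}\big(a^+_xZ_{x,\mu}a^-_{x+e_\mu}+\mathrm{h.c.}\big),$$ the first sum being over the elementary plaquettes. The physical space is $\mathcal H^{\rm phys}_L=\{\psi: Q_x\psi=\psi\ \forall x\}$. For $\beta>0$ (half filling, zero chemical potential) let $$Z_{\beta,L}=\mathrm{Tr}_{\mathcal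 H_L^{\rm phys}}e^{-\beta H},\qquad \langle\mathcal O\rangle_{\beta,L}=\frac{\mathrm{Tr}_{\mathcal H_L^{\rm phys}}\mathcal O e^{-\beta H}}{Z_{\beta,L}},\qquad f_{\beta,L}=-\frac1{\beta L^2}\log Z_{\beta,L}.$$ A magnetic gauge-invariant observable $\mathcal O$ is a polynomial in the $Z_{x,\mu}$ and $a^\pm_x$ that commutes with every $Q_x$. For a sign configuration $\sigma$ on the bonds, $H(\sigma)$, $H_f(\sigma)$ and $\mathcal O(\sigma)$ denote the operators on $\mathcal F_L$ obtained by replacing each $Z_{x,\mu}$ by $\sigma_{x,\mu}$ in $H$, in the hopping part of $H$, and in $\mathcal O$. For $a,b\in\{\pm1\}$ let $\mathcal C(\pi,a,b)$ be the set of the $\sigma$ whose product around every plaquette is $-1$ and whose products along the circles $x_2=0$ and $x_1=0$ are $a$ and $b$; set $$Z_{\beta,L}(\pi,a,b)=\sum_{\sigma\in\mathcal C(\pi,a,b)}\frac{1}{2^{L^2}}\mathrm{Tr}_{\mathcal F_L}(1+(-1)^N)e^{-\beta H(\sigma)},\qquad f_{\beta,L}(\pi)=-\frac1{\beta L^2}\log\sum_{a,b=\pm1}Z_{\beta,L}(\pi,a,b),$$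 and, for any choice of representatives $\sigma^{a,b}\in\mathcal C(\pi,a,b)$, with $H_f(\pi,a,b)=H_f(\sigma^{a,b})$ and $\mathcal O(\pi,a,b)=\mathcal O(\sigma^{a,b})$, $$\langle\mathcal O\rangle^\pi_{\beta,L}=\frac{\sum_{a,b}\mathrm{Tr}_{\mathcal F_L}e^{-\beta H_f(\pi,a,b)}\mathcal O(\pi,a,b)(1+(-1)^N)}{\sum_{a,b}\mathrm{Tr}_{\mathcal F_L}e^{-\beta H_f(\pi,a,b)}(1+(-1)^N)}.$$ **Theorem (stability of the $\pi$-flux phase).** There are universal constants $\kappa>0$ and $t_0>0$ with $\kappa t_0\ge1$ (in particular independent of $\beta$ and $L$), a function $K:\mathbb R\to\mathbb R$, and for every $\alpha$ a constant $C_\alpha$, such that for every $t>t_0$ the following holds. 1. There are numbers $\Delta_{\beta,L}$ (depending also on $t$), with $\Delta_{\beta,L}=\kappa t+o(1)$ as $\beta,L\to\infty$ jointly, such that for all $\beta>0$ and all $L\in4\mathbb N$, $L\ge 4$, $$0\le\beta L^2\big(f_{\beta,L}(\pi)-f_{\beta,L}\big)\le\log\Big(\big(1+e^{-\beta(\Delta_{\beta,L}-1)}\big)^{L^2}+\big(1-e^{-\beta(\Delta_{\beta,L}-1)}\big)^{L^2}\Big)+\log2,$$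 and for every magnetic gauge-invariant observable $\mathcal O$ (and every choice of representatives) $$\big|\langle\mathcal O\rangle_{\beta,L}-\langle\mathcal O\rangle^\pi_{\beta,L}\big|\le K_{\mathcal O}\Big(\big(1+e^{-\beta(\Delta_{\beta,L}-1)}\big)^{L^2}-1\Big),\qquad K_{\mathcal O}=K\big(\max_\sigma\|\mathcal O(\sigma)\|\big).$$ 2. For every $L\in4\mathbb N$, $L\ge 4$, and $a,b\in\{\pm1\}$ the limit $E_{0;L}(\pi,a,b)=-\lim_{\beta\to\infty}\frac1\beta\log Z_{\beta,L}(\pi,a,b)$ exists, and $E_{0;L}(\pi,a,b)-L^2$ is the lowest eigenvalue of $H_f(\sigma)$ for every $\sigma\in\mathcal C(\pi,a,b)$ ($L^2$ is the energy of the plaquette term). Moreover $E_{0;L}(\pi,a,b)\ge E_{0;L}(\pi,-1,-1)$, and for every $0<\alpha<1/3$ $$\big|E_{0;L}(\pi,a,b)-E_{0;L}(\pi,-1,-1)\big|\le\frac{C_\alpha\,t}{L^{1-3\alpha}}.$$ -/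

import Mathlib

open Filter Topology
open scoped Kronecker

namespace Z2Gauge

/-- The vertices of the discrete torus `ℤ² / L ℤ²`. -/
abbrev Site (L : ℕ) : Type := ZMod L × ZMod L

/-- The unit vectors `e₁` (index `0`) and `e₂` (index `1`). -/
def unitVec (L : ℕ) (μ : Fin 2) : Site L := if μ = 0 then (1, 0) else (0, 1)

/-- The bonds: `(x, μ)` is the bond joining `x` and `x + e_μ`. -/
abbrev Bond (L : ℕ) : Type := Site L × Fin 2

/-- Classical gauge fields `σ`, one sign per bond: the joint eigenvalues of the operators `Z`. -/
abbrev Config (L : ℕ) : Type := Bond L → ℤˣ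

/-- Occupation number basis of the fermionic Fock space: the set of the occupied sites. -/
abbrev Occ (L : ℕ) : Type := Finset (Site L)

/-- Operators on the Fock space, as matrices in the occupation number basis. -/
abbrev FermiOp (L : ℕ) : Type := Matrix (Occ L) (Occ L) ℂ

/-- Operators on the gauge space `⨂_{bonds} ℂ²`, as matrices in the joint eigenbasis of the `Z`. -/
abbrev GaugeOp (L : ℕ) : Type := Matrix (Config L) (Config L) ℂ

/-- Operators on the total space (Fock space) ⊗ (gauge space). -/
abbrev TotalOp (L : ℕ) : Type := Matrix (Occ L × Config L) (Occ L × Config L) ℂ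

noncomputable section

variable {L : ℕ} [NeZero L]

/-! ### Fermions -/

/-- An enumeration of the sites, which fixes the signs of the fermionic operators. -/
def siteIndex (x : Site L) : ℕ := x.1.val + L * x.2.val

/-- The annihilation operator `a⁻_x`: it sends the basis vector `T` with `x ∈ T` to the basis vector
`T \ {x}`, times `-1` to the number of the elements of `T` that precede `x`, and the other basis
vectors to `0`. -/
def annih (x : Site L) : FermiOp L := fun S T =>
  if x ∈ T ∧ S = T.erase x then (-1) ^ (T.filter fun y => siteIndex y < siteIndex x).card else 0

/-- The creation operator `a⁺_x`, the adjoint of `a⁻_x`. -/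
def creat (x : Site L) : FermiOp L := (annih x).conjTranspose

/-- `(-1)^{n_x}`, with `n_x = a⁺_x a⁻_x` the occupation number of the site `x`. -/
def siteParity (x : Site L) : FermiOp L :=
  Matrix.diagonal fun S => if x ∈ S then -1 else 1

/-- `(-1)^N`, with `N = ∑_x a⁺_x a⁻_x` the number of particles. -/
def parity (L : ℕ) [NeZero L] : FermiOp L := Matrix.diagonal fun S => (-1) ^ S.card

/-! ### Gauge field -/

/-- The third Pauli matrix on the bond `b`. -/
def pauliZ (b : Bond L) : GaugeOp L := Matrix.diagonal fun σ => ((σ b : ℤ) : ℂ)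

/-- The first Pauli matrix on the bond `b`: it flips the sign on `b`. -/
def pauliX (b : Bond L) : GaugeOp L := fun σ τ =>
  if σ = Function.update τ b (-τ b) then 1 else 0

/-- The star operator `A_x`, the product of the `X` on the four bonds that touch `x`. -/
def starOp (x : Site L) : GaugeOp L :=
  pauliX (x, 0) * pauliX (x, 1) * pauliX (x - unitVec L 0, 0) * pauliX (x - unitVec L 1, 1)

/-! ### The coupled system -/

/-- A fermionic operator as an operator on the total space. -/
def ofFermi (A : FermiOp L) : TotalOp L := A ⊗ₖ (1 : GaugeOp L)

/-- A gauge field operator as an operator on the total space. -/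
def ofGauge (B : GaugeOp L) : TotalOp L := (1 : FermiOp L) ⊗ₖ B

/-- The `ℤ₂` charge `Q_x = A_x (-1)^{n_x}`. -/
def charge (x : Site L) : TotalOp L := ofGauge (starOp x) * ofFermi (siteParity x)

/-- The projection `∏_x (1 + Q_x) / 2` on the physical space (`Q_x ψ = ψ` for all `x`). The factors
commute with each other, so their order is immaterial. -/
def physProj (L : ℕ) [NeZero L] : TotalOp L :=
  ((Finset.univ : Finset (Site L)).toList.map fun x => (2⁻¹ : ℂ) • (1 + charge x)).prod

/-- The plaquette operator `B_Λ`; `Λ` is labelled by its lower left corner `x`. -/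
def plaquette (x : Site L) : TotalOp L :=
  ofGauge (pauliZ (x, 0) * pauliZ (x + unitVec L 0, 1) * pauliZ (x + unitVec L 1, 0) * pauliZ (x, 1))

/-- The Hamiltonian
`H = -∑_Λ B_Λ - t ∑_x ∑_μ (a⁺_x Z_{x,μ} a⁻_{x+e_μ} + h.c.)` (no electric field). -/
def hamiltonian (L : ℕ) [NeZero L] (t : ℝ) : TotalOp L :=
  -(∑ x : Site L, plaquette x)
    - (t : ℂ) • ∑ x : Site L, ∑ μ : Fin 2,
        (ofFermi (creat x) * ofGauge (pauliZ (x, μ)) * ofFermi (annih (x + unitVec L μ))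
          + (ofFermi (creat x) * ofGauge (pauliZ (x, μ)) *
              ofFermi (annih (x + unitVec L μ))).conjTranspose)

/-- The partition function at half filling (chemical potential `0`): the trace of `e^{-βH}` over
the physical space. -/
def partitionFn (L : ℕ) [NeZero L] (t β : ℝ) : ℝ :=
  (physProj L * NormedSpace.exp (((-β : ℝ) : ℂ) • hamiltonian L t)).trace.re

/-- The Gibbs expectation of `O`: traces over the physical space. -/
def gibbs (t β : ℝ) (O : TotalOp L) : ℂ :=
  (physProj L * O * NormedSpace.exp (((-β : ℝ) : ℂ) • hamiltonian L t)).trace /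
    (physProj L * NormedSpace.exp (((-β : ℝ) : ℂ) • hamiltonian L t)).trace

/-- Magnetic gauge-invariant observables: polynomials in the `Z` and in the fermionic operators
that commute with all the charges `Q_x`. -/
def IsMagneticGaugeInvariant (O : TotalOp L) : Prop :=
  O ∈ Algebra.adjoin ℂ
      ((Set.range fun b : Bond L => ofGauge (pauliZ b)) ∪
        (Set.range fun x : Site L => ofFermi (creat x)) ∪
        (Set.range fun x : Site L => ofFermi (annih x))) ∧
    ∀ x : Site L, Commute O (charge x)

/-! ### Fixed gauge fields -/

/-- The product of the spins around the plaquette with lower left corner `x`. -/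
def flux (σ : Config L) (x : Site L) : ℤˣ :=
  σ (x, 0) * σ (x + unitVec L 0, 1) * σ (x + unitVec L 1, 0) * σ (x, 1)

/-- The flux along the circle `x₂ = 0`. -/
def fluxA (σ : Config L) : ℤˣ := ∏ i : ZMod L, σ ((i, 0), 0)

/-- The flux along the circle `x₁ = 0`. -/
def fluxB (σ : Config L) : ℤˣ := ∏ i : ZMod L, σ ((0, i), 1)

/-- `σ` realizes the `π`-flux phase with fluxes `a`, `b` along the two non-contractible loops. -/
def IsPiFlux (σ : Config L) (a b : ℤˣ) : Prop :=
  (∀ x, flux σ x = -1) ∧ fluxA σ = a ∧ fluxB σ = b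

/-- The fermionic Hamiltonian `H_f(σ)` in the background `σ`. -/
def fermiHam (t : ℝ) (σ : Config L) : FermiOp L :=
  -((t : ℂ) • ∑ x : Site L, ∑ μ : Fin 2, ((σ (x, μ) : ℤ) : ℂ) •
      (creat x * annih (x + unitVec L μ) + (creat x * annih (x + unitVec L μ)).conjTranspose))

/-- `H(σ)`: the Hamiltonian evaluated at the gauge field `σ`. -/
def bgHam (t : ℝ) (σ : Config L) : FermiOp L :=
  -(∑ x : Site L, ((flux σ x : ℤ) : ℂ)) • (1 : FermiOp L) + fermiHam t σ

open Classical in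
/-- The partition function `Z_{β,L}(π,a,b)` of the `π`-flux phase with fluxes `a`, `b`: the sum over
the compatible `σ` of `Tr (1 + (-1)^N) / 2^{L²} e^{-βH(σ)}`. -/
def piPartitionFn (L : ℕ) [NeZero L] (t β : ℝ) (a b : ℤˣ) : ℝ :=
  ∑ σ : Config L with IsPiFlux σ a b,
    (((2 : ℂ) ^ (L ^ 2))⁻¹ *
      ((1 + parity L) * NormedSpace.exp (((-β : ℝ) : ℂ) • bgHam t σ)).trace).re

/-- The free energy `f_{β,L}` of the gauge theory. -/
def freeEnergy (L : ℕ) [NeZero L] (t β : ℝ) : ℝ :=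
  -(1 / (β * (L : ℝ) ^ 2)) * Real.log (partitionFn L t β)

/-- The free energy `f_{β,L}(π)` of the `π`-flux phase. -/
def piFreeEnergy (L : ℕ) [NeZero L] (t β : ℝ) : ℝ :=
  -(1 / (β * (L : ℝ) ^ 2)) * Real.log (∑ a : ℤˣ, ∑ b : ℤˣ, piPartitionFn L t β a b)

/-- `O(σ) = ⟨σ, O σ⟩`, an operator on the Fock space. -/
def evalAt (O : TotalOp L) (σ : Config L) : FermiOp L := fun S T => O (S, σ) (T, σ)

/-- The largest operator norm of `O(σ)`, over all gauge fields `σ`; for a gauge-invariant `O` this is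
the maximum of `‖O(Φ,a,b)‖` over all the flux configurations `(Φ,a,b)`. -/
def maxNorm (O : TotalOp L) : ℝ :=
  ⨆ σ : Config L, ‖Matrix.toEuclideanCLM (n := Occ L) (𝕜 := ℂ) (evalAt O σ)‖

/-- The expectation of `O` in the `π`-flux phase, computed with the representatives `s a b` of the
`π`-flux phases with fluxes `a`, `b`. -/
def piExpect (t β : ℝ) (s : ℤˣ → ℤˣ → Config L) (O : TotalOp L) : ℂ :=
  (∑ a : ℤˣ, ∑ b : ℤˣ, (NormedSpace.exp (((-β : ℝ) : ℂ) • fermiHam t (s a b)) *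
      evalAt O (s a b) * (1 + parity L)).trace) /
    (∑ a : ℤˣ, ∑ b : ℤˣ, (NormedSpace.exp (((-β : ℝ) : ℂ) • fermiHam t (s a b)) *
      (1 + parity L)).trace)

end

end Z2Gauge

open Z2Gauge

namespace Z2Gauge

noncomputable section

set_option linter.unusedSectionVars false

/-! ### Determinant inequalities -/

section DetIneq
variable {n p : Type*} [Fintype n] [DecidableEq n] [Fintype p]
open scoped ComplexOrder

theorem exists_unitary_diagonalization {H : Matrix n n ℂ} (hH : H.IsHermitian) :
    ∃ U : Matrix n n ℂ, U.conjTranspose * U = 1 ∧ U * U.conjTranspose = 1 ∧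
      H = U * Matrix.diagonal (fun i => ((hH.eigenvalues i : ℝ) : ℂ)) * U.conjTranspose :=
  ⟨hH.eigenvectorUnitary, Unitary.coe_star_mul_self _, Unitary.coe_mul_star_self _,
    hH.spectral_theorem⟩

theorem one_le_det_one_add {K : Matrix n n ℂ} (hK : K.PosSemidef) : 1 ≤ (1 + K).det := by
  obtain ⟨U, -, hU, hs⟩ := exists_unitary_diagonalization hK.1
  have h1 : 1 + K = U * (1 + Matrix.diagonal (fun i => ((hK.1.eigenvalues i : ℝ) : ℂ))) *
      U.conjTranspose := by
    rw [Matrix.mul_add, Matrix.add_mul, Matrix.mul_one, hU, ← hs]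
  have h2 : (1 + K).det = ∏ i, (1 + ((hK.1.eigenvalues i : ℝ) : ℂ)) := by
    rw [h1, Matrix.det_mul_right_comm, hU, Matrix.one_mul,
      ← Matrix.diagonal_one, Matrix.diagonal_add, Matrix.det_diagonal]
  rw [h2]
  have h3 : ∏ i, (1 + ((hK.1.eigenvalues i : ℝ) : ℂ)) = ((∏ i, (1 + hK.1.eigenvalues i) : ℝ) : ℂ) := by
    push_cast; rfl
  rw [h3]
  have : (1 : ℝ) ≤ ∏ i, (1 + hK.1.eigenvalues i) := by
    refine le_of_eq_of_le (Finset.prod_const_one (s := (Finset.univ : Finset n))).symm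
      (Finset.prod_le_prod (fun _ _ => zero_le_one)
      (fun i _ => by have := hK.eigenvalues_nonneg i; linarith))
  exact_mod_cast this

theorem exists_eq_conjTranspose_mul_self {A : Matrix n n ℂ} (hA : A.PosSemidef) :
    ∃ R : Matrix n n ℂ, A = R.conjTranspose * R := by
  obtain ⟨U, -, -, hs⟩ := exists_unitary_diagonalization hA.1
  refine ⟨Matrix.diagonal (fun i => ((√(hA.1.eigenvalues i) : ℝ) : ℂ)) * U.conjTranspose, ?_⟩
  conv_lhs => rw [hs]
  rw [Matrix.conjTranspose_mul, Matrix.conjTranspose_conjTranspose, Matrix.diagonal_conjTranspose,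
    Matrix.mul_assoc, Matrix.mul_assoc, ← Matrix.mul_assoc (Matrix.diagonal _) (Matrix.diagonal _),
    Matrix.diagonal_mul_diagonal]
  congr 3
  ext i
  simp only [Pi.star_apply, Complex.star_def, Complex.conj_ofReal]
  rw [← Complex.ofReal_mul, Real.mul_self_sqrt (hA.eigenvalues_nonneg i)]

theorem det_le_det_add {A B : Matrix n n ℂ} (hA : A.PosSemidef) (hB : B.PosSemidef) :
    A.det ≤ (A + B).det := by
  by_cases h : A.PosDef
  · obtain ⟨R, hR⟩ := exists_eq_conjTranspose_mul_self hA
    have hRd : IsUnit R.det := by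
      have := (Matrix.isUnit_iff_isUnit_det _).1 h.isUnit
      rw [hR, Matrix.det_mul] at this
      exact isUnit_of_mul_isUnit_right this
    subst hR
    have hRd' : IsUnit R.conjTranspose.det := by
      rw [Matrix.det_conjTranspose]; exact hRd.star
    have hK : ((R⁻¹).conjTranspose * B * R⁻¹).PosSemidef := hB.conjTranspose_mul_mul_same _
    have h1 : R.conjTranspose * R + B =
        R.conjTranspose * (1 + (R⁻¹).conjTranspose * B * R⁻¹) * R := by
      rw [Matrix.mul_add, Matrix.add_mul, Matrix.mul_one, Matrix.conjTranspose_nonsing_inv]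
      congr 1
      rw [← Matrix.mul_assoc, ← Matrix.mul_assoc, Matrix.mul_nonsing_inv _ hRd', Matrix.one_mul,
        Matrix.mul_assoc, Matrix.nonsing_inv_mul _ hRd, Matrix.mul_one]
    rw [h1, Matrix.det_mul_right_comm, Matrix.det_mul (R.conjTranspose * R)]
    have := one_le_det_one_add hK
    exact le_mul_of_one_le_right hA.det_nonneg this
  · have h0 : A.det = 0 := by
      by_contra h0
      exact h (hA.posDef_iff_det_ne_zero.2 h0)
    rw [h0]
    exact (hA.add hB).det_nonneg

theorem norm_det_conjTranspose_mul_sq_le (P Q : Matrix p n ℂ) (hP : (P.conjTranspose * P).PosDef) :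
    ‖(P.conjTranspose * Q).det‖ ^ 2 ≤
      ‖(P.conjTranspose * P).det‖ * ‖(Q.conjTranspose * Q).det‖ := by
  set A := P.conjTranspose * P with hA
  set B := P.conjTranspose * Q with hB
  set D := Q.conjTranspose * Q with hD
  have hBt : B.conjTranspose = Q.conjTranspose * P := by simp [hB, Matrix.conjTranspose_mul]
  have hblock : (Matrix.fromBlocks A B B.conjTranspose D).PosSemidef := by
    have : Matrix.fromBlocks A B B.conjTranspose D =
        (Matrix.fromCols P Q).conjTranspose * Matrix.fromCols P Q := by
      rw [Matrix.conjTranspose_fromCols_eq_fromRows_conjTranspose, Matrix.fromRows_mul_fromCols, hBt]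
    rw [this]
    exact Matrix.posSemidef_conjTranspose_mul_self _
  have : Invertible A := hP.isUnit.invertible
  rw [hP.fromBlocks₁₁] at hblock
  have hX : (B.conjTranspose * A⁻¹ * B).PosSemidef :=
    hP.inv.posSemidef.conjTranspose_mul_mul_same B
  have h1 := det_le_det_add hX hblock
  rw [add_sub_cancel] at h1
  have h2 : ‖(B.conjTranspose * A⁻¹ * B).det‖ ≤ ‖D.det‖ :=
    CStarAlgebra.norm_le_norm_of_nonneg_of_le hX.det_nonneg h1
  rw [Matrix.det_mul, Matrix.det_mul, Matrix.det_conjTranspose, norm_mul, norm_mul, norm_star] at h2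
  have h3 : ‖A.det‖ * ‖A⁻¹.det‖ = 1 := by
    rw [← norm_mul, ← Matrix.det_mul, Matrix.mul_nonsing_inv _ ((Matrix.isUnit_iff_isUnit_det _).1 hP.isUnit)]
    simp
  calc ‖B.det‖ ^ 2 = ‖A.det‖ * (‖B.det‖ * ‖A⁻¹.det‖ * ‖B.det‖) := by
        linear_combination (-‖B.det‖ ^ 2) * h3
    _ ≤ _ := by gcongr

theorem norm_det_one_add_sq_le (X Y : Matrix n n ℂ) :
    ‖(1 + Y.conjTranspose * X).det‖ ^ 2 ≤
      ‖(1 + Y.conjTranspose * Y).det‖ * ‖(1 + X.conjTranspose * X).det‖ := by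
  have key : ∀ U V : Matrix n n ℂ, (Matrix.fromRows (1 : Matrix n n ℂ) U).conjTranspose *
      Matrix.fromRows (1 : Matrix n n ℂ) V = 1 + U.conjTranspose * V := by
    intro U V
    rw [Matrix.conjTranspose_fromRows_eq_fromCols_conjTranspose, Matrix.fromCols_mul_fromRows]
    simp
  have := norm_det_conjTranspose_mul_sq_le (Matrix.fromRows (1 : Matrix n n ℂ) Y)
    (Matrix.fromRows (1 : Matrix n n ℂ) X) (by
      rw [key]
      exact Matrix.PosDef.one.add_posSemidef (Matrix.posSemidef_conjTranspose_mul_self _))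
  simpa only [key] using this

/-- `i s + H` for a Hermitian `H` and `s ≠ 0` is invertible. -/
theorem isUnit_det_smul_one_add {H : Matrix n n ℂ} (hH : H.IsHermitian) {s : ℝ} (hs : s ≠ 0) :
    IsUnit (((s : ℂ) * Complex.I) • (1 : Matrix n n ℂ) + H).det := by
  set A := ((s : ℂ) * Complex.I) • (1 : Matrix n n ℂ) + H
  have h1 : A.conjTranspose * A = (((s ^ 2 : ℝ) : ℂ)) • (1 : Matrix n n ℂ) + H.conjTranspose * H := by
    simp only [A, Matrix.conjTranspose_add, Matrix.conjTranspose_smul, Matrix.conjTranspose_one, hH.eq,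
      Matrix.add_mul, Matrix.mul_add, Matrix.smul_mul, Matrix.mul_smul, Matrix.one_mul, Matrix.mul_one]
    have e : star ((s : ℂ) * Complex.I) = -((s : ℂ) * Complex.I) := by
      simp
    rw [e]
    have e2 : -((s : ℂ) * Complex.I) * ((s : ℂ) * Complex.I) = ((s ^ 2 : ℝ) : ℂ) := by
      push_cast; linear_combination (-(s : ℂ) ^ 2) * Complex.I_sq
    rw [smul_add, smul_smul, mul_comm, e2]
    simp only [neg_smul]
    abel
  have h2 : (A.conjTranspose * A).PosDef := by
    rw [h1]
    refine Matrix.PosDef.add_posSemidef ?_ (Matrix.posSemidef_conjTranspose_mul_self _)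
    refine Matrix.PosDef.one.smul ?_
    have : 0 < s ^ 2 := by positivity
    exact_mod_cast this
  have h3 := (Matrix.isUnit_iff_isUnit_det _).1 h2.isUnit
  rw [Matrix.det_mul] at h3
  exact isUnit_of_mul_isUnit_right h3

theorem norm_det_fromBlocks_eq {A B P : Matrix n n ℂ} (hA : IsUnit A.det) (hB : IsUnit B.det)
    (hP : P * P = P) (hPs : P.conjTranspose = P) :
    ‖(Matrix.fromBlocks A P P (-B.conjTranspose)).det‖ =
      ‖A.det‖ * ‖B.det‖ * ‖(1 + (P * B⁻¹ * P).conjTranspose * (P * A⁻¹ * P)).det‖ := by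
  have h1 : Matrix.fromBlocks A P P (-B.conjTranspose) =
      Matrix.fromBlocks 1 0 0 (-1) * Matrix.fromBlocks A P (-P) B.conjTranspose := by
    simp [Matrix.fromBlocks_multiply]
  have h2 : ‖(Matrix.fromBlocks (1 : Matrix n n ℂ) 0 0 (-1 : Matrix n n ℂ)).det‖ = 1 := by
    rw [Matrix.det_fromBlocks_zero₂₁, Matrix.det_neg]; simp
  have hBs : IsUnit B.conjTranspose.det := by rw [Matrix.det_conjTranspose]; exact hB.star
  have : Invertible A := ((Matrix.isUnit_iff_isUnit_det _).2 hA).invertible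
  have h3 : (Matrix.fromBlocks A P (-P) B.conjTranspose).det =
      A.det * (B.conjTranspose.det * (1 + (P * B⁻¹ * P).conjTranspose * (P * A⁻¹ * P)).det) := by
    rw [Matrix.det_fromBlocks₁₁, Matrix.invOf_eq_nonsing_inv]
    congr 1
    have e1 : B.conjTranspose - -P * A⁻¹ * P =
        B.conjTranspose * (1 + (B.conjTranspose⁻¹ * P * P * A⁻¹) * (P * P)) := by
      rw [Matrix.mul_add, Matrix.mul_one]
      simp only [← Matrix.mul_assoc]
      rw [Matrix.mul_nonsing_inv _ hBs, Matrix.one_mul, hP]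
      simp only [Matrix.mul_assoc, hP]
      simp
    rw [e1, Matrix.det_mul]
    congr 1
    have e2 : (P * B⁻¹ * P).conjTranspose * (P * A⁻¹ * P) =
        (P * (B.conjTranspose⁻¹ * P * P * A⁻¹)) * P := by
      simp only [Matrix.conjTranspose_mul, hPs, Matrix.conjTranspose_nonsing_inv, Matrix.mul_assoc]
    rw [e2, ← Matrix.mul_assoc, Matrix.det_one_add_mul_comm, ← Matrix.mul_assoc]
  rw [h1, Matrix.det_mul, norm_mul, h2, one_mul, h3, norm_mul, norm_mul, Matrix.det_conjTranspose,
    norm_star, ← mul_assoc]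

/-- Reflection positivity of the determinants of `i s + H`, for a Hermitian `H` with the diagonal
blocks `H₁`, `H₂` and the diagonal off-diagonal block `P * G`. -/
theorem norm_det_reflection {H₁ H₂ : Matrix n n ℂ} (h₁ : H₁.IsHermitian) (h₂ : H₂.IsHermitian)
    {s : ℝ} (hs : s ≠ 0) {p g : n → ℝ} (hp : ∀ i, p i * p i = p i) (hg : ∀ i, g i * g i = 1) :
    let c : Matrix n n ℂ := ((s : ℂ) * Complex.I) • 1
    let P : Matrix n n ℂ := Matrix.diagonal fun i => (p i : ℂ)
    let V : Matrix n n ℂ := Matrix.diagonal fun i => ((p i * g i : ℝ) : ℂ)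
    ‖(Matrix.fromBlocks (c + H₁) V V (c + H₂)).det‖ ^ 2 ≤
      ‖(Matrix.fromBlocks (c + H₁) P P (c - H₁)).det‖ *
        ‖(Matrix.fromBlocks (c - H₂) P P (c + H₂)).det‖ := by
  intro c P V
  set G : Matrix n n ℂ := Matrix.diagonal fun i => (g i : ℂ) with hGdef
  have hGG : G * G = 1 := by
    rw [hGdef, Matrix.diagonal_mul_diagonal, ← Matrix.diagonal_one]
    congr 1; ext i; exact_mod_cast hg i
  have hPP : P * P = P := by
    simp only [P, Matrix.diagonal_mul_diagonal]
    congr 1; ext i; exact_mod_cast hp i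
  have hPG : P * G = V := by
    simp only [P, V, hGdef, Matrix.diagonal_mul_diagonal]
    congr 1; ext i; push_cast; rfl
  have hGP : G * P = V := by
    simp only [P, V, hGdef, Matrix.diagonal_mul_diagonal]
    congr 1; ext i; push_cast; ring
  have hGPG : G * P * G = P := by rw [hGP, ← hPG, Matrix.mul_assoc, hGG, Matrix.mul_one]
  have hPs : P.conjTranspose = P := by
    simp only [P, Matrix.diagonal_conjTranspose]
    congr 1; ext i; simp
  have hGs : G.conjTranspose = G := by
    simp only [hGdef, Matrix.diagonal_conjTranspose]
    congr 1; ext i; simp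
  have hGd : ‖G.det‖ * ‖G.det‖ = 1 := by
    rw [← norm_mul, ← Matrix.det_mul, hGG]; simp
  have hGcG : G * c * G = c := by simp [c, hGG]
  have hcs : c.conjTranspose = -c := by
    simp [c, Matrix.conjTranspose_smul]
  set A := c + H₁ with hAdef
  set B := G * (c - H₂) * G with hBdef
  have hA : IsUnit A.det := isUnit_det_smul_one_add h₁ hs
  have hB : IsUnit B.det := by
    have hGu : IsUnit G.det := (Matrix.isUnit_iff_isUnit_det _).1 (IsUnit.of_mul_eq_one _ hGG)
    rw [hBdef, Matrix.det_mul, Matrix.det_mul]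
    refine (hGu.mul ?_).mul hGu
    rw [sub_eq_add_neg]
    exact isUnit_det_smul_one_add h₂.neg hs
  have hBs : -B.conjTranspose = G * (c + H₂) * G := by
    rw [hBdef, Matrix.conjTranspose_mul, Matrix.conjTranspose_mul, hGs, Matrix.conjTranspose_sub,
      hcs, h₂.eq, ← Matrix.mul_assoc]
    rw [← neg_add', Matrix.mul_neg, Matrix.neg_mul, neg_neg]
  have hAs : -A.conjTranspose = c - H₁ := by
    rw [hAdef, Matrix.conjTranspose_add, hcs, h₁.eq]; abel
  have e1 : ‖(Matrix.fromBlocks (c + H₁) V V (c + H₂)).det‖ =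
      ‖(Matrix.fromBlocks A P P (-B.conjTranspose)).det‖ := by
    have : Matrix.fromBlocks A P P (-B.conjTranspose) =
        Matrix.fromBlocks 1 0 0 G * Matrix.fromBlocks (c + H₁) V V (c + H₂) *
          Matrix.fromBlocks 1 0 0 G := by
      simp only [Matrix.fromBlocks_multiply, Matrix.one_mul, Matrix.zero_mul, Matrix.mul_zero,
        Matrix.mul_one, add_zero, zero_add, hBs]
      congr 1
      · rw [← hPG, Matrix.mul_assoc, hGG, Matrix.mul_one]
      · rw [← hGP, ← Matrix.mul_assoc, hGG, Matrix.one_mul]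
    rw [this, Matrix.det_mul, Matrix.det_mul, Matrix.det_fromBlocks_zero₂₁, Matrix.det_one, one_mul,
      norm_mul, norm_mul, mul_right_comm, hGd, one_mul]
  have e2 : ‖(Matrix.fromBlocks (c - H₂) P P (c + H₂)).det‖ =
      ‖(Matrix.fromBlocks B P P (-B.conjTranspose)).det‖ := by
    have : Matrix.fromBlocks B P P (-B.conjTranspose) =
        Matrix.fromBlocks G 0 0 G * Matrix.fromBlocks (c - H₂) P P (c + H₂) *
          Matrix.fromBlocks G 0 0 G := by
      simp only [Matrix.fromBlocks_multiply, Matrix.zero_mul, Matrix.mul_zero,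
        add_zero, zero_add, hBs, hGPG]
      rw [hBdef]
    have hd : ‖G.det * G.det‖ = 1 := by rw [norm_mul, hGd]
    rw [this, Matrix.det_mul, Matrix.det_mul, Matrix.det_fromBlocks_zero₂₁, norm_mul, norm_mul,
      hd, one_mul, mul_one]
  rw [e1, e2, ← hAs, norm_det_fromBlocks_eq hA hB hPP hPs, norm_det_fromBlocks_eq hA hA hPP hPs,
    norm_det_fromBlocks_eq hB hB hPP hPs]
  have := norm_det_one_add_sq_le (P * A⁻¹ * P) (P * B⁻¹ * P)
  calc _ = (‖A.det‖ * ‖B.det‖) ^ 2 *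
        ‖(1 + (P * B⁻¹ * P).conjTranspose * (P * A⁻¹ * P)).det‖ ^ 2 := by ring
    _ ≤ (‖A.det‖ * ‖B.det‖) ^ 2 * _ := mul_le_mul_of_nonneg_left this (by positivity)
    _ = _ := by ring

end DetIneq

variable {L : ℕ} [NeZero L]

/-! ### The one-particle hopping matrix -/

/-- The integer hopping amplitude between two sites in the background `σ`. -/
def link (σ : Config L) (x y : Site L) : ℤ :=
  ((if y = x + unitVec L 0 then (σ (x, 0) : ℤ) else 0) +
    (if x = y + unitVec L 0 then (σ (y, 0) : ℤ) else 0)) +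
  ((if y = x + unitVec L 1 then (σ (x, 1) : ℤ) else 0) +
    (if x = y + unitVec L 1 then (σ (y, 1) : ℤ) else 0))

/-- The hopping matrix in the background `σ`. -/
def hop (σ : Config L) : Matrix (Site L) (Site L) ℂ := Matrix.of fun x y => (link σ x y : ℂ)

/-- The modulus of the determinant of `i s + hop σ`. -/
def hopDet (s : ℝ) (σ : Config L) : ℝ :=
  ‖(((s : ℂ) * Complex.I) • (1 : Matrix (Site L) (Site L) ℂ) + hop σ).det‖

theorem link_comm (σ : Config L) (x y : Site L) : link σ x y = link σ y x := by
  unfold link; ring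

theorem hop_isHermitian (σ : Config L) : (hop σ).IsHermitian := by
  ext x y
  simp [hop, link_comm σ x y]

theorem hopDet_pos {s : ℝ} (hs : s ≠ 0) (σ : Config L) : 0 < hopDet s σ :=
  norm_pos_iff.2 (isUnit_det_smul_one_add (hop_isHermitian σ) hs).ne_zero

theorem hopDet_eq_of_equiv (s : ℝ) {σ τ : Config L} (π : Site L ≃ Site L)
    (h : ∀ x y, link τ x y = link σ (π x) (π y)) : hopDet s τ = hopDet s σ := by
  unfold hopDet
  rw [← Matrix.det_submatrix_equiv_self π (_ + hop σ)]
  congr 2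
  ext x y
  simp [hop, h, Matrix.one_apply]

theorem unitVec_zero : unitVec L 0 = (1, 0) := rfl
theorem unitVec_one : unitVec L 1 = (0, 1) := rfl

/-- The translate of a gauge field. -/
def translate (v : Site L) (σ : Config L) : Config L := fun b => σ (b.1 + v, b.2)

/-- The gauge field with the two coordinates exchanged. -/
def swapCoord (σ : Config L) : Config L := fun b => σ (b.1.swap, 1 - b.2)

theorem link_translate (v : Site L) (σ : Config L) (x y : Site L) :
    link (translate v σ) x y = link σ (x + v) (y + v) := by
  have h : ∀ (x y e : Site L), (y + v = x + v + e) = (y = x + e) := by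
    intro x y e; rw [add_right_comm, add_left_inj]
  simp only [link, translate, h]

theorem link_swapCoord (σ : Config L) (x y : Site L) :
    link (swapCoord σ) x y = link σ x.swap y.swap := by
  have h0 : ∀ (x y : Site L), (y.swap = x.swap + unitVec L 0) = (y = x + unitVec L 1) := by
    intro x y; simp [unitVec_zero, unitVec_one, Prod.ext_iff, and_comm]
  have h1 : ∀ (x y : Site L), (y.swap = x.swap + unitVec L 1) = (y = x + unitVec L 0) := by
    intro x y; simp [unitVec_zero, unitVec_one, Prod.ext_iff, and_comm]
  simp only [link, swapCoord, h0, h1]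
  norm_num
  ring

theorem hopDet_translate (s : ℝ) (v : Site L) (σ : Config L) :
    hopDet s (translate v σ) = hopDet s σ :=
  hopDet_eq_of_equiv s (Equiv.addRight v) (fun x y => link_translate v σ x y)

theorem hopDet_swapCoord (s : ℝ) (σ : Config L) : hopDet s (swapCoord σ) = hopDet s σ :=
  hopDet_eq_of_equiv s (Equiv.prodComm _ _) (fun x y => link_swapCoord σ x y)

theorem flux_translate (v : Site L) (σ : Config L) (x : Site L) :
    flux (translate v σ) x = flux σ (x + v) := by
  simp only [flux, translate, add_right_comm x _ v]

theorem flux_swapCoord (σ : Config L) (x : Site L) : flux (swapCoord σ) x = flux σ x.swap := by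
  have h0 : (x + unitVec L 0).swap = x.swap + unitVec L 1 := by
    simp [unitVec_zero, unitVec_one]
  have h1 : (x + unitVec L 1).swap = x.swap + unitVec L 0 := by
    simp [unitVec_zero, unitVec_one]
  simp only [flux, swapCoord, h0, h1]
  norm_num
  ac_rfl

/-! ### Arithmetic on the circle -/

theorem zmod_eq_add_one_iff (hL : 2 ≤ L) (a b : ZMod L) :
    b = a + 1 ↔ b.val = a.val + 1 ∨ (a.val + 1 = L ∧ b.val = 0) := by
  have : Fact (1 < L) := ⟨hL⟩
  have ha := a.val_lt
  have h1 : (1 : ZMod L).val = 1 := ZMod.val_one L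
  rcases Nat.lt_or_ge (a.val + 1) L with h | h
  · have : (a + 1).val = a.val + 1 := by rw [ZMod.val_add_of_lt (by omega), h1]
    rw [← (ZMod.val_injective L).eq_iff, this]; omega
  · have : (a + 1).val = 0 := by
      rw [ZMod.val_add, h1, show a.val + 1 = L by omega, Nat.mod_self]
    rw [← (ZMod.val_injective L).eq_iff, this]
    have := b.val_lt
    omega

theorem zmod_val_neg_one_sub (hL : 2 ≤ L) (a : ZMod L) : (-1 - a).val = L - 1 - a.val := by
  have ha := a.val_lt
  have h : -1 - a = ((L - 1 - a.val : ℕ) : ZMod L) := by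
    rw [Nat.cast_sub (by omega), Nat.cast_sub (by omega)]
    simp
  rw [h, ZMod.val_natCast_of_lt (by omega)]

/-! ### Reflections -/

/-- The reflection of the sites in the two lines that bisect the bonds `(x, 1)` with
`x₁ = L / 2 - 1` or `x₁ = L - 1`. -/
def mirror (x : Site L) : Site L := (-1 - x.1, x.2)

/-- The same reflection, for the lower left corners of the plaquettes. -/
def mirrorPlaq (x : Site L) : Site L := (-2 - x.1, x.2)

/-- The half of the torus to which a site belongs. -/
def leftSide (x : Site L) : Bool := decide (x.1.val < L / 2)

/-- The reflection lines cut the bond `(x, 0)` and the plaquette of `x`. -/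
def IsCut (x : Site L) : Prop := x.1.val + 1 = L / 2 ∨ x.1.val + 1 = L

instance (x : Site L) : Decidable (IsCut x) := by unfold IsCut; infer_instance

/-- The gauge field which agrees with `σ` on the side `b`, with minus the mirror image of `σ` on the
other side, and with `1` on the bonds that are cut. -/
def reflectField (b : Bool) (σ : Config L) : Config L := fun p =>
  if p.2 = 0 then
    if IsCut p.1 then 1 else if leftSide p.1 = b then σ (p.1, 0) else -σ (mirrorPlaq p.1, 0)
  else if leftSide p.1 = b then σ (p.1, 1) else -σ (mirror p.1, 1)

theorem mirror_mirror (x : Site L) : mirror (mirror x) = x := by simp [mirror]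

theorem mirrorPlaq_mirrorPlaq (x : Site L) : mirrorPlaq (mirrorPlaq x) = x := by simp [mirrorPlaq]

theorem leftSide_mirror (hL : 4 ∣ L) (x : Site L) : leftSide (mirror x) = !leftSide x := by
  have h2 : 2 ≤ L := by have := NeZero.pos L; have := Nat.le_of_dvd this hL; omega
  have := x.1.val_lt
  simp only [leftSide, mirror, zmod_val_neg_one_sub h2]
  rw [← decide_not, decide_eq_decide]
  omega

theorem eq_add_unitVec_zero_iff (x y : Site L) : y = x + unitVec L 0 ↔ y.1 = x.1 + 1 ∧ y.2 = x.2 := by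
  simp [unitVec_zero, Prod.ext_iff]

theorem eq_add_unitVec_one_iff (x y : Site L) : y = x + unitVec L 1 ↔ y.1 = x.1 ∧ y.2 = x.2 + 1 := by
  simp [unitVec_one, Prod.ext_iff]

theorem mirror_eq_add_unitVec_zero (x y : Site L) :
    mirror y = mirror x + unitVec L 0 ↔ x = y + unitVec L 0 := by
  simp only [eq_add_unitVec_zero_iff, mirror]
  constructor
  · rintro ⟨h1, h2⟩; exact ⟨by linear_combination h1, h2.symm⟩
  · rintro ⟨h1, h2⟩; exact ⟨by linear_combination h1, h2.symm⟩

theorem mirror_eq_add_unitVec_one (x y : Site L) :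
    mirror y = mirror x + unitVec L 1 ↔ y = x + unitVec L 1 := by
  simp [eq_add_unitVec_one_iff, mirror]

/-- The weight of the bonds that join a site to its mirror image. -/
def edgeWeight (x : Site L) : ℤ :=
  if x.1.val = 0 ∨ x.1.val + 1 = L / 2 ∨ x.1.val = L / 2 ∨ x.1.val + 1 = L then 1 else 0

section Reflect
variable (hL : 4 ∣ L) (b : Bool) (σ : Config L)
include hL

theorem four_le_of_four_dvd : 4 ≤ L := Nat.le_of_dvd (NeZero.pos L) hL

theorem leftSide_eq_of_eq_add {x y : Site L} (h : y = x + unitVec L 0) :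
    (leftSide x = leftSide y) ↔ ¬ IsCut x := by
  have h4 := four_le_of_four_dvd hL
  rw [eq_add_unitVec_zero_iff, zmod_eq_add_one_iff (by omega)] at h
  have := x.1.val_lt
  have := y.1.val_lt
  simp only [leftSide, IsCut, decide_eq_decide]
  omega

theorem mirror_eq_mirrorPlaq {x y : Site L} (h : y = x + unitVec L 0) : mirror y = mirrorPlaq x := by
  rw [eq_add_unitVec_zero_iff] at h
  simp only [mirror, mirrorPlaq, h.1, h.2]
  congr 1; ring

theorem link_reflectField_same {x y : Site L} (hx : leftSide x = b) (hy : leftSide y = b) :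
    link (reflectField b σ) x y = link σ x y := by
  have h0 : ∀ x y : Site L, leftSide x = b → leftSide y = b →
      (if y = x + unitVec L 0 then (reflectField b σ (x, 0) : ℤ) else 0) =
        if y = x + unitVec L 0 then (σ (x, 0) : ℤ) else 0 := by
    intro x y hx hy
    split_ifs with h
    · have := (leftSide_eq_of_eq_add hL h).1 (hx.trans hy.symm)
      simp [reflectField, this, hx]
    · rfl
  unfold link
  rw [h0 x y hx hy, h0 y x hy hx]
  simp [reflectField, hx, hy]

theorem link_reflectField_opp {x y : Site L} (hx : leftSide x ≠ b) (hy : leftSide y ≠ b) :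
    link (reflectField b σ) x y = -link σ (mirror x) (mirror y) := by
  have h0 : ∀ x y : Site L, leftSide x ≠ b → leftSide y ≠ b →
      (if y = x + unitVec L 0 then (reflectField b σ (x, 0) : ℤ) else 0) =
        -if y = x + unitVec L 0 then (σ (mirror y, 0) : ℤ) else 0 := by
    intro x y hx hy
    split_ifs with h
    · have hs : leftSide x = leftSide y := by
        revert hx hy; cases leftSide x <;> cases leftSide y <;> cases b <;> simp
      have := (leftSide_eq_of_eq_add hL h).1 hs
      simp [reflectField, this, hx, mirror_eq_mirrorPlaq hL h]
    · rfl
  have h1 : ∀ x y : Site L, leftSide x ≠ b →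
      (if y = x + unitVec L 1 then (reflectField b σ (x, 1) : ℤ) else 0) =
        -if y = x + unitVec L 1 then (σ (mirror x, 1) : ℤ) else 0 := by
    intro x y hx
    split_ifs
    · simp [reflectField, hx]
    · rfl
  unfold link
  rw [h0 x y hx hy, h0 y x hy hx, h1 x y hx, h1 y x hy]
  simp only [mirror_eq_add_unitVec_zero, mirror_eq_add_unitVec_one]
  ring

theorem link_cross (x y : Site L) (hxy : leftSide x ≠ leftSide y) :
    ∃ g : ℤˣ, link σ x y = if y = mirror x then edgeWeight x * g else 0 := by
  have h4 := four_le_of_four_dvd hL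
  have hx := x.1.val_lt
  have hy := y.1.val_lt
  have h1 : ∀ x y : Site L, leftSide x ≠ leftSide y → ¬ y = x + unitVec L 1 := by
    intro x y hxy h
    rw [eq_add_unitVec_one_iff] at h
    exact hxy (by simp [leftSide, h.1])
  have hm : y = mirror x ↔ y.1.val + x.1.val + 1 = L ∧ y.2 = x.2 := by
    rw [mirror, Prod.ext_iff, ← (ZMod.val_injective L).eq_iff, zmod_val_neg_one_sub (by omega)]
    constructor
    · rintro ⟨h, h'⟩; exact ⟨by omega, h'⟩
    · rintro ⟨h, h'⟩; exact ⟨by omega, h'⟩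
  have key : ∀ x y : Site L, leftSide x ≠ leftSide y → y = x + unitVec L 0 →
      y.1.val + x.1.val + 1 = L ∧ y.2 = x.2 ∧ ¬ x = y + unitVec L 0 ∧
        edgeWeight x = 1 ∧ edgeWeight y = 1 := by
    intro x y hxy h
    have hc : IsCut x := by
      by_contra hc
      exact hxy ((leftSide_eq_of_eq_add hL h).2 hc)
    rw [eq_add_unitVec_zero_iff, zmod_eq_add_one_iff (by omega)] at h
    have := x.1.val_lt
    have := y.1.val_lt
    rw [eq_add_unitVec_zero_iff, zmod_eq_add_one_iff (by omega)]
    unfold IsCut at hc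
    refine ⟨by omega, h.2, by omega, if_pos (by omega), if_pos (by omega)⟩
  unfold link
  rw [if_neg (h1 x y hxy), if_neg (h1 y x hxy.symm)]
  by_cases ha : y = x + unitVec L 0
  · obtain ⟨k1, k2, k3, k4, k5⟩ := key x y hxy ha
    exact ⟨σ (x, 0), by rw [if_pos ha, if_neg k3, if_pos (hm.2 ⟨k1, k2⟩), k4]; ring⟩
  · by_cases hb : x = y + unitVec L 0
    · obtain ⟨k1, k2, k3, k4, k5⟩ := key y x hxy.symm hb
      exact ⟨σ (y, 0), by
        rw [if_neg ha, if_pos hb, if_pos (hm.2 ⟨by omega, k2.symm⟩), k5]; ring⟩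
    · refine ⟨1, ?_⟩
      rw [if_neg ha, if_neg hb]
      split_ifs with h
      · have h' := hm.1 h
        rw [eq_add_unitVec_zero_iff, zmod_eq_add_one_iff (by omega)] at ha hb
        have : edgeWeight x = 0 := by
          refine if_neg ?_
          simp only [h'.2, and_true] at ha hb
          omega
        rw [this]; ring
      · ring

theorem link_reflectField_cross (x y : Site L) (hxy : leftSide x ≠ leftSide y) :
    link (reflectField b σ) x y = if y = mirror x then edgeWeight x else 0 := by
  have h4 := four_le_of_four_dvd hL
  have key : ∀ x y : Site L, leftSide x ≠ leftSide y →
      (if y = x + unitVec L 0 then (reflectField b σ (x, 0) : ℤ) else 0) =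
      (if y = x + unitVec L 0 then ((1 : Config L) (x, 0) : ℤ) else 0) := by
    intro x y hxy
    split_ifs with h
    · have hc : IsCut x := by
        by_contra hc
        exact hxy ((leftSide_eq_of_eq_add hL h).2 hc)
      simp [reflectField, hc]
    · rfl
  have h1 : ∀ x y : Site L, leftSide x ≠ leftSide y → ¬ y = x + unitVec L 1 := by
    intro x y hxy h
    rw [eq_add_unitVec_one_iff] at h
    exact hxy (by simp [leftSide, h.1])
  have h2 : link (reflectField b σ) x y = link (1 : Config L) x y := by
    unfold link
    rw [key x y hxy, key y x hxy.symm]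
    simp only [if_neg (h1 x y hxy), if_neg (h1 y x hxy.symm)]
  have h3 : 0 ≤ link (1 : Config L) x y := by
    unfold link; simp only [Pi.one_apply, Units.val_one]; positivity
  obtain ⟨g, hg⟩ := link_cross hL 1 x y hxy
  rw [h2, hg]
  rw [hg] at h3
  split_ifs at h3 ⊢ with h
  · rcases Int.units_eq_one_or g with rfl | rfl
    · simp
    · have : edgeWeight x = 0 ∨ edgeWeight x = 1 := by unfold edgeWeight; split_ifs <;> simp
      rcases this with h' | h' <;> simp [h'] at h3 ⊢
  · rfl

theorem hopDet_sq_le {s : ℝ} (hs : s ≠ 0) :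
    hopDet s σ ^ 2 ≤ hopDet s (reflectField true σ) * hopDet s (reflectField false σ) := by
  let e' : {x : Site L // leftSide x = true} ≃ {x : Site L // ¬ leftSide x = true} :=
    { toFun := fun x => ⟨mirror x, by rw [leftSide_mirror hL, x.2]; simp⟩
      invFun := fun x => ⟨mirror x, by
        have := x.2; rw [leftSide_mirror hL]; simpa using this⟩
      left_inv := fun x => by ext1; exact mirror_mirror _
      right_inv := fun x => by ext1; exact mirror_mirror _ }
  let e : {x : Site L // leftSide x = true} ⊕ {x : Site L // leftSide x = true} ≃ Site L :=
    ((Equiv.refl _).sumCongr e').trans (Equiv.sumCompl _)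
  have el : ∀ x, e (Sum.inl x) = x := fun x => rfl
  have er : ∀ x, e (Sum.inr x) = mirror x := fun x => rfl
  have hsl : ∀ x : {x : Site L // leftSide x = true}, leftSide (x : Site L) = true := fun x => x.2
  have hsr : ∀ x : {x : Site L // leftSide x = true}, leftSide (mirror (x : Site L)) = false := by
    intro x; rw [leftSide_mirror hL, x.2]; rfl
  choose g hg using fun x : {x : Site L // leftSide x = true} =>
    link_cross hL σ x (mirror x) (by rw [hsl, hsr]; simp)
  simp only [if_true] at hg
  let H₁ : Matrix {x : Site L // leftSide x = true} {x : Site L // leftSide x = true} ℂ :=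
    Matrix.of fun x y => (link σ x y : ℂ)
  let H₂ : Matrix {x : Site L // leftSide x = true} {x : Site L // leftSide x = true} ℂ :=
    Matrix.of fun x y => (link σ (mirror x) (mirror y) : ℂ)
  have hH₁ : H₁.IsHermitian := by ext x y; simp [H₁, link_comm σ x y]
  have hH₂ : H₂.IsHermitian := by ext x y; simp [H₂, link_comm σ (mirror x) (mirror y)]
  have main := norm_det_reflection hH₁ hH₂ hs (p := fun x => (edgeWeight (x : Site L) : ℝ))
    (g := fun x => ((g x : ℤ) : ℝ))
    (by intro x; simp only [edgeWeight]; split_ifs <;> simp)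
    (by intro x; rcases Int.units_eq_one_or (g x) with h | h <;> simp [h])
  have toBlocks : ∀ τ : Config L, hopDet s τ = ‖(Matrix.fromBlocks
      (((s : ℂ) * Complex.I) • 1 + Matrix.of fun x y : {x : Site L // leftSide x = true} =>
        (link τ x y : ℂ))
      (Matrix.of fun x y : {x : Site L // leftSide x = true} => (link τ x (mirror y) : ℂ))
      (Matrix.of fun x y : {x : Site L // leftSide x = true} => (link τ (mirror x) y : ℂ))
      (((s : ℂ) * Complex.I) • 1 + Matrix.of fun x y : {x : Site L // leftSide x = true} =>
        (link τ (mirror x) (mirror y) : ℂ))).det‖ := by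
    intro τ
    unfold hopDet
    rw [← Matrix.det_submatrix_equiv_self e]
    congr 2
    ext i j
    rcases i with i | i <;> rcases j with j | j
    · simp [el, hop, Matrix.one_apply, Subtype.ext_iff]
    · have : ¬ (i : Site L) = mirror j := by
        intro h; have h1 := hsl i; rw [h, hsr j] at h1; exact absurd h1 (by simp)
      simp [el, er, hop, this]
    · have : ¬ mirror (i : Site L) = j := by
        intro h; have h1 := hsl j; rw [← h, hsr i] at h1; exact absurd h1 (by simp)
      simp [el, er, hop, this]
    · have : mirror (i : Site L) = mirror j ↔ i = j := by
        rw [Subtype.ext_iff]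
        exact ⟨fun h => by rw [← mirror_mirror (i : Site L), h, mirror_mirror], fun h => by rw [h]⟩
      simp [er, hop, Matrix.one_apply, this]
  have eqm : ∀ x y : {x : Site L // leftSide x = true}, mirror (y : Site L) = mirror x ↔ x = y := by
    intro x y
    rw [Subtype.ext_iff]
    exact ⟨fun h => by rw [← mirror_mirror (x : Site L), ← h, mirror_mirror], fun h => by rw [h]⟩
  have hV : (Matrix.of fun x y : {x : Site L // leftSide x = true} => (link σ x (mirror y) : ℂ)) =
      Matrix.diagonal fun x : {x : Site L // leftSide x = true} =>
        (((edgeWeight (x : Site L) : ℝ) * ((g x : ℤ) : ℝ) : ℝ) : ℂ) := by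
    ext x y
    obtain ⟨g', hg'⟩ := link_cross hL σ x (mirror y) (by rw [hsl, hsr]; simp)
    rw [Matrix.diagonal_apply, Matrix.of_apply]
    split_ifs with h
    · subst h; rw [hg]; push_cast; rfl
    · rw [hg', if_neg (by rwa [eqm])]; simp
  have hP : ∀ b, (Matrix.of fun x y : {x : Site L // leftSide x = true} =>
      (link (reflectField b σ) x (mirror y) : ℂ)) =
      Matrix.diagonal fun x : {x : Site L // leftSide x = true} =>
        ((edgeWeight (x : Site L) : ℝ) : ℂ) := by
    intro b
    ext x y
    rw [Matrix.diagonal_apply, Matrix.of_apply, link_reflectField_cross hL b σ _ _ (by rw [hsl, hsr]; simp)]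
    simp only [eqm]
    split_ifs <;> simp
  have symm : ∀ τ : Config L, (Matrix.of fun x y : {x : Site L // leftSide x = true} =>
      (link τ (mirror x) y : ℂ)) = (Matrix.of fun x y : {x : Site L // leftSide x = true} =>
      (link τ x (mirror y) : ℂ)).transpose := by
    intro τ; ext x y; simp [link_comm τ (mirror (x : Site L))]
  rw [toBlocks σ, toBlocks (reflectField true σ), toBlocks (reflectField false σ)]
  simp only [symm, hV, hP, Matrix.diagonal_transpose]
  have b1 : (Matrix.of fun x y : {x : Site L // leftSide x = true} =>
      (link (reflectField true σ) x y : ℂ)) = H₁ := by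
    ext x y; simp [H₁, link_reflectField_same hL true σ (hsl x) (hsl y)]
  have b2 : (Matrix.of fun x y : {x : Site L // leftSide x = true} =>
      (link (reflectField true σ) (mirror x) (mirror y) : ℂ)) = -H₁ := by
    ext x y
    simp [H₁, link_reflectField_opp hL true σ (x := mirror x) (y := mirror y)
      (by rw [hsr]; simp) (by rw [hsr]; simp), mirror_mirror]
  have b3 : (Matrix.of fun x y : {x : Site L // leftSide x = true} =>
      (link (reflectField false σ) x y : ℂ)) = -H₂ := by
    ext x y
    simp [H₂, link_reflectField_opp hL false σ (x := x) (y := y)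
      (by rw [hsl]; simp) (by rw [hsl]; simp)]
  have b4 : (Matrix.of fun x y : {x : Site L // leftSide x = true} =>
      (link (reflectField false σ) (mirror x) (mirror y) : ℂ)) = H₂ := by
    ext x y; simp [H₂, link_reflectField_same hL false σ (hsr x) (hsr y)]
  rw [b1, b2, b3, b4, ← sub_eq_add_neg, ← sub_eq_add_neg]
  exact main

end Reflect

theorem prod_zmod_eq_prod_range {M : Type*} [CommMonoid M] (f : ZMod L → M) :
    ∏ i : ZMod L, f i = ∏ k ∈ Finset.range L, f (k : ZMod L) := by
  symm
  refine Finset.prod_bij (fun k _ => (k : ZMod L)) (fun _ _ => Finset.mem_univ _) ?_ ?_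
    (fun _ _ => rfl)
  · intro a ha b hb h
    rw [Finset.mem_range] at ha hb
    have := congrArg ZMod.val h
    rwa [ZMod.val_natCast_of_lt ha, ZMod.val_natCast_of_lt hb] at this
  · intro i _
    exact ⟨i.val, Finset.mem_range.2 i.val_lt, by simp⟩

section Reflect
variable (hL : 4 ∣ L) (b : Bool) (σ : Config L)
include hL

theorem leftSide_add_unitVec_one (x : Site L) : leftSide (x + unitVec L 1) = leftSide x := by
  simp [leftSide, unitVec_one]

theorem isCut_add_unitVec_one (x : Site L) : IsCut (x + unitVec L 1) ↔ IsCut x := by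
  simp [IsCut, unitVec_one]

theorem mirrorPlaq_of_isCut {x : Site L} (h : IsCut x) : mirrorPlaq x = x := by
  have h4 := four_le_of_four_dvd hL
  have hx := x.1.val_lt
  have : (2 * (x.1 + 1) : ZMod L) = 0 := by
    have h1 : (2 * (x.1 + 1) : ZMod L) = ((2 * (x.1.val + 1) : ℕ) : ZMod L) := by simp
    rw [h1, ZMod.natCast_eq_zero_iff]
    unfold IsCut at h
    rcases h with h | h
    · rw [h]; exact ⟨1, by omega⟩
    · rw [h]; exact ⟨2, by omega⟩
  simp only [mirrorPlaq]
  ext1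
  · linear_combination -this
  · rfl

theorem mirror_eq_mirrorPlaq_add (x : Site L) : mirror x = mirrorPlaq x + unitVec L 0 := by
  simp only [mirror, mirrorPlaq, unitVec_zero, Prod.mk_add_mk, add_zero]
  congr 1; ring

theorem mirrorPlaq_add_unitVec_one (x : Site L) :
    mirrorPlaq (x + unitVec L 1) = mirrorPlaq x + unitVec L 1 := by
  simp [mirrorPlaq, unitVec_one]

theorem mirror_add_unitVec_zero (x : Site L) : mirror (x + unitVec L 0) = mirrorPlaq x :=
  mirror_eq_mirrorPlaq hL rfl

theorem isCut_mirrorPlaq (x : Site L) : IsCut (mirrorPlaq x) ↔ IsCut x := by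
  constructor
  · intro h
    have := mirrorPlaq_of_isCut hL h
    rw [mirrorPlaq_mirrorPlaq] at this
    rwa [this]
  · intro h; rwa [mirrorPlaq_of_isCut hL h]

theorem leftSide_mirrorPlaq {x : Site L} (h : ¬ IsCut x) : leftSide (mirrorPlaq x) = !leftSide x := by
  rw [← leftSide_mirror hL, mirror_eq_mirrorPlaq_add hL]
  exact (leftSide_eq_of_eq_add hL rfl).2 (by rwa [isCut_mirrorPlaq hL])

theorem flux_reflectField (x : Site L) : flux (reflectField b σ) x =
    if IsCut x then -1 else if leftSide x = b then flux σ x else flux σ (mirrorPlaq x) := by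
  have hs := leftSide_eq_of_eq_add hL (rfl : x + unitVec L 0 = x + unitVec L 0)
  have e0 : ∀ y, reflectField b σ (y, 0) = if IsCut y then 1 else
      if leftSide y = b then σ (y, 0) else -σ (mirrorPlaq y, 0) := fun y => rfl
  have e1 : ∀ y, reflectField b σ (y, 1) =
      if leftSide y = b then σ (y, 1) else -σ (mirror y, 1) := fun y => rfl
  simp only [flux, e0, e1, isCut_add_unitVec_one hL, leftSide_add_unitVec_one hL,
    mirror_add_unitVec_zero hL, mirrorPlaq_add_unitVec_one hL]
  by_cases hc : IsCut x
  · have hx : mirror x = x + unitVec L 0 := by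
      rw [mirror_eq_mirrorPlaq_add hL, mirrorPlaq_of_isCut hL hc]
    have hne : leftSide x ≠ leftSide (x + unitVec L 0) := fun h => hs.1 h hc
    simp only [hc, if_true, hx, mirrorPlaq_of_isCut hL hc]
    by_cases hb : leftSide x = b
    · have : leftSide (x + unitVec L 0) ≠ b := fun h => hne (hb.trans h.symm)
      simp [hb, this, Int.units_mul_self]
    · have : leftSide (x + unitVec L 0) = b := by
        revert hb hne; cases leftSide x <;> cases leftSide (x + unitVec L 0) <;> cases b <;> simp
      simp [hb, this, Int.units_mul_self]
  · have hse := hs.2 hc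
    simp only [hc, if_false, ← hse, mirror_eq_mirrorPlaq_add hL x]
    by_cases hb : leftSide x = b
    · simp [hb]
    · simp only [hb, if_false, mul_neg, neg_mul, neg_neg]
      ac_rfl

theorem fluxA_reflectField_true : fluxA (reflectField true σ) = -1 := by
  have h4 := four_le_of_four_dvd hL
  obtain ⟨q, rfl⟩ := hL
  have hq : 1 ≤ q := by omega
  unfold fluxA
  rw [prod_zmod_eq_prod_range]
  set F : ℕ → ℤˣ := fun k => reflectField true σ (((k : ZMod (4 * q)), 0), 0) with hF
  have hval : ∀ k < 4 * q, ((k : ZMod (4 * q))).val = k := fun k hk => ZMod.val_natCast_of_lt hk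
  have e1 : ∏ k ∈ Finset.range (4 * q), F k =
      (∏ k ∈ Finset.range (2 * q - 1), F k) * F (2 * q - 1) *
      ((∏ k ∈ Finset.range (2 * q - 1), F (2 * q + k)) * F (4 * q - 1)) := by
    rw [show 4 * q = 2 * q + 2 * q by ring, Finset.prod_range_add,
      show Finset.range (2 * q) = Finset.range (2 * q - 1 + 1) by congr 1; omega,
      Finset.prod_range_succ, Finset.prod_range_succ]
    congr 3; omega
  have hc1 : F (2 * q - 1) = 1 := by
    have : IsCut (((2 * q - 1 : ℕ) : ZMod (4 * q)), (0 : ZMod (4 * q))) := by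
      left; simp only [hval (2 * q - 1) (by omega)]; omega
    simp only [hF, reflectField, if_true]; exact if_pos this
  have hc2 : F (4 * q - 1) = 1 := by
    have : IsCut (((4 * q - 1 : ℕ) : ZMod (4 * q)), (0 : ZMod (4 * q))) := by
      right; simp only [hval (4 * q - 1) (by omega)]; omega
    simp only [hF, reflectField, if_true]; exact if_pos this
  have hl : ∀ k ∈ Finset.range (2 * q - 1), F k = σ (((k : ZMod (4 * q)), 0), 0) := by
    intro k hk
    rw [Finset.mem_range] at hk
    have h1 : ¬ IsCut ((k : ZMod (4 * q)), (0 : ZMod (4 * q))) := by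
      simp only [IsCut, hval k (by omega)]; omega
    have h2 : leftSide ((k : ZMod (4 * q)), (0 : ZMod (4 * q))) = true := by
      simp only [leftSide, hval k (by omega), decide_eq_true_eq]; omega
    simp only [hF, reflectField, if_true, h1, h2, if_false]
  have hr : ∀ k ∈ Finset.range (2 * q - 1),
      F (2 * q + (2 * q - 1 - 1 - k)) = -σ (((k : ZMod (4 * q)), 0), 0) := by
    intro k hk
    rw [Finset.mem_range] at hk
    set j := 2 * q + (2 * q - 1 - 1 - k) with hj
    have h1 : ¬ IsCut ((j : ZMod (4 * q)), (0 : ZMod (4 * q))) := by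
      simp only [IsCut, hval j (by omega)]; omega
    have h2 : leftSide ((j : ZMod (4 * q)), (0 : ZMod (4 * q))) = false := by
      simp only [leftSide, hval j (by omega), decide_eq_false_iff_not]; omega
    have h3 : mirrorPlaq ((j : ZMod (4 * q)), (0 : ZMod (4 * q))) = ((k : ZMod (4 * q)), 0) := by
      simp only [mirrorPlaq]
      congr 1
      have : ((j + 2 + k : ℕ) : ZMod (4 * q)) = 0 := by
        rw [show j + 2 + k = 4 * q by omega]; simp
      push_cast at this
      linear_combination -this
    simp only [hF, reflectField, if_true, h1, h2, if_false, Bool.false_eq_true, h3]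
  change ∏ k ∈ Finset.range (4 * q), F k = -1
  rw [e1, hc1, hc2, mul_one, mul_one, ← Finset.prod_range_reflect (fun k => F (2 * q + k)),
    Finset.prod_congr rfl hl, Finset.prod_congr rfl hr, ← Finset.prod_mul_distrib]
  have : ∀ k ∈ Finset.range (2 * q - 1), σ (((k : ZMod (4 * q)), 0), 0) *
      -σ (((k : ZMod (4 * q)), 0), 0) = -1 := by
    intro k _; rw [mul_neg, Int.units_mul_self]
  rw [Finset.prod_congr rfl this, Finset.prod_const, Finset.card_range]
  exact Odd.neg_one_pow ⟨q - 1, by omega⟩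

theorem fluxB_reflectField_true : fluxB (reflectField true σ) = fluxB σ := by
  have h4 := four_le_of_four_dvd hL
  unfold fluxB
  refine Finset.prod_congr rfl fun i _ => ?_
  have : leftSide ((0 : ZMod L), i) = true := by
    simp only [leftSide, ZMod.val_zero, decide_eq_true_eq]; omega
  simp [reflectField, this]

/-- Reflections preserve a sum over plaquettes, up to the plaquettes that are cut. -/
theorem sum_reflect {f f₁ f₂ : Site L → ℕ}
    (hc : ∀ z, IsCut z → f₁ z = 0 ∧ f₂ z = 0)
    (hu : ∀ z, ¬ IsCut z → f₁ z + f₂ z = f z + f (mirrorPlaq z)) :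
    ∑ z, f₁ z + ∑ z, f₂ z + 2 * ∑ z : Site L with IsCut z, f z = 2 * ∑ z, f z := by
  have h1 : ∑ z, f₁ z + ∑ z, f₂ z = ∑ z : Site L with ¬ IsCut z, (f z + f (mirrorPlaq z)) := by
    rw [← Finset.sum_add_distrib, ← Finset.sum_filter_add_sum_filter_not _ IsCut,
      Finset.sum_eq_zero, zero_add]
    · exact Finset.sum_congr rfl fun z hz => hu z (Finset.mem_filter.1 hz).2
    · intro z hz
      have := hc z (Finset.mem_filter.1 hz).2
      omega
  have h2 : ∑ z : Site L with ¬ IsCut z, f (mirrorPlaq z) = ∑ z : Site L with ¬ IsCut z, f z := by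
    refine Finset.sum_bij' (fun z _ => mirrorPlaq z) (fun z _ => mirrorPlaq z) ?_ ?_ ?_ ?_ ?_
    · intro z hz; simpa [isCut_mirrorPlaq hL] using hz
    · intro z hz; simpa [isCut_mirrorPlaq hL] using hz
    · intro z _; exact mirrorPlaq_mirrorPlaq z
    · intro z _; exact mirrorPlaq_mirrorPlaq z
    · intro z _; rfl
  rw [h1, Finset.sum_add_distrib, h2, ← Finset.sum_filter_add_sum_filter_not Finset.univ IsCut f]
  ring

theorem two_mul_log_hopDet_le {s : ℝ} (hs : s ≠ 0) :
    2 * Real.log (hopDet s σ) ≤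
      Real.log (hopDet s (reflectField true σ)) + Real.log (hopDet s (reflectField false σ)) := by
  rw [← Real.log_mul (hopDet_pos hs _).ne' (hopDet_pos hs _).ne']
  have := Real.log_le_log (pow_pos (hopDet_pos hs σ) 2) (hopDet_sq_le hL σ hs)
  rwa [Real.log_pow] at this

end Reflect

theorem exists_optimal {X : Type*} [Finite X] [Nonempty X] (G : X → ℝ) (N d : X → ℕ)
    (r₁ r₂ : X → X) (hG : ∀ σ, 2 * G σ ≤ G (r₁ σ) + G (r₂ σ))
    (hN : ∀ σ, N (r₁ σ) + N (r₂ σ) + d σ ≤ 2 * N σ) :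
    ∃ σ, (∀ τ, G τ ≤ G σ) ∧ ∀ τ, G τ = G σ → N τ = N σ → d τ = 0 := by
  obtain ⟨σ₀, h₀⟩ := Finite.exists_max G
  have : Nonempty {σ // G σ = G σ₀} := ⟨⟨σ₀, rfl⟩⟩
  obtain ⟨⟨σ, hσ⟩, h⟩ := Finite.exists_min (fun σ : {σ // G σ = G σ₀} => N σ)
  refine ⟨σ, fun τ => hσ ▸ h₀ τ, fun τ hτ hNτ => ?_⟩
  have a1 : G (r₁ τ) = G σ₀ := le_antisymm (h₀ _) (by have := hG τ; have := h₀ (r₂ τ); linarith)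
  have a2 : G (r₂ τ) = G σ₀ := le_antisymm (h₀ _) (by have := hG τ; have := h₀ (r₁ τ); linarith)
  have b1 := h ⟨_, a1⟩
  have b2 := h ⟨_, a2⟩
  have := hN τ
  simp only at b1 b2
  omega

theorem fluxB_swapCoord (σ : Config L) : fluxB (swapCoord σ) = fluxA σ := rfl

theorem isCut_neg_one (hL : 4 ∣ L) (y : ZMod L) : IsCut ((-1 : ZMod L), y) := by
  have h4 := four_le_of_four_dvd hL
  right
  have := zmod_val_neg_one_sub (L := L) (by omega) 0
  simp only [sub_zero, ZMod.val_zero] at this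
  simp only [this]; omega

/-- The determinant is largest in a `π`-flux phase. -/
theorem exists_isPiFlux_forall_hopDet_le (hL : 4 ∣ L) {s : ℝ} (hs : s ≠ 0) :
    ∃ σ : Config L, IsPiFlux σ (-1) (-1) ∧ ∀ τ : Config L, hopDet s τ ≤ hopDet s σ := by
  let f : Config L → Site L → ℕ := fun σ z => if flux σ z = -1 then 0 else 1
  obtain ⟨σ, h1, h2⟩ := exists_optimal (fun σ : Config L => Real.log (hopDet s σ))
    (fun σ : Config L => ∑ z, f σ z) (fun σ : Config L => 2 * ∑ z : Site L with IsCut z, f σ z) (reflectField true)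
    (reflectField false) (fun σ => two_mul_log_hopDet_le hL σ hs) (fun σ => by
      refine le_of_eq (sum_reflect hL (fun z hz => ?_) (fun z hz => ?_))
      · simp [f, flux_reflectField hL, hz]
      · simp only [f, flux_reflectField hL, hz, if_false]
        cases leftSide z <;> simp [add_comm])
  have hflux : ∀ z, flux σ z = -1 := by
    intro z
    have h3 := h2 (translate (z - (-1, 0)) σ) (by simp only [hopDet_translate]) (by
      simp only [f, flux_translate]
      exact Equiv.sum_comp (Equiv.addRight (z - (-1, 0))) (f σ))
    simp only [mul_eq_zero, OfNat.ofNat_ne_zero, false_or, Finset.sum_eq_zero_iff,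
      Finset.mem_filter, Finset.mem_univ, true_and] at h3
    have h4 := h3 (-1, 0) (isCut_neg_one hL 0)
    by_contra h
    simp [f, flux_translate, h] at h4
  have hmax : ∀ τ : Config L, hopDet s τ ≤ hopDet s σ := fun τ =>
    (Real.log_le_log_iff (hopDet_pos hs _) (hopDet_pos hs _)).1 (h1 τ)
  have step : ∀ τ : Config L, (∀ z, flux τ z = -1) → (∀ τ' : Config L, hopDet s τ' ≤ hopDet s τ) →
      (∀ z, flux (reflectField true τ) z = -1) ∧
        ∀ τ' : Config L, hopDet s τ' ≤ hopDet s (reflectField true τ) := by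
    intro τ k1 k2
    refine ⟨fun z => by rw [flux_reflectField hL]; split_ifs <;> simp [k1], fun τ' => ?_⟩
    have k3 := hopDet_sq_le hL τ hs
    have k4 := k2 (reflectField false τ)
    have k5 := hopDet_pos hs τ
    have k6 := hopDet_pos hs (reflectField true τ)
    refine (k2 τ').trans ?_
    nlinarith
  have step' : ∀ τ : Config L, (∀ z, flux τ z = -1) → (∀ τ' : Config L, hopDet s τ' ≤ hopDet s τ) →
      (∀ z, flux (swapCoord τ) z = -1) ∧ ∀ τ' : Config L, hopDet s τ' ≤ hopDet s (swapCoord τ) :=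
    fun τ k1 k2 => ⟨fun z => by rw [flux_swapCoord, k1], fun τ' => by
      rw [hopDet_swapCoord]; exact k2 τ'⟩
  obtain ⟨a1, a2⟩ := step σ hflux hmax
  obtain ⟨b1, b2⟩ := step' _ a1 a2
  obtain ⟨c1, c2⟩ := step _ b1 b2
  refine ⟨_, ⟨c1, fluxA_reflectField_true hL _, ?_⟩, c2⟩
  rw [fluxB_reflectField_true hL, fluxB_swapCoord, fluxA_reflectField_true hL]

/-! ### Chessboard estimate -/

theorem even_val_add (hL : 2 ∣ L) (a b : ZMod L) :
    Even (a + b).val ↔ (Even a.val ↔ Even b.val) := by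
  rw [ZMod.val_add, ← Nat.even_add, Nat.even_iff, Nat.even_iff, Nat.mod_mod_of_dvd _ hL]

theorem even_val_neg (hL : 2 ∣ L) (a : ZMod L) : Even (-a).val ↔ Even a.val := by
  have := even_val_add hL a (-a)
  rw [add_neg_cancel, ZMod.val_zero] at this
  simpa [iff_comm] using this

theorem even_val_sub (hL : 2 ∣ L) (a b : ZMod L) :
    Even (a - b).val ↔ (Even a.val ↔ Even b.val) := by
  rw [sub_eq_add_neg, even_val_add hL, even_val_neg hL]

theorem not_even_val_one (hL : 4 ∣ L) : ¬ Even (1 : ZMod L).val := by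
  have h4 := four_le_of_four_dvd hL
  have : Fact (1 < L) := ⟨by omega⟩
  rw [ZMod.val_one]; decide

theorem even_val_two (hL : 4 ∣ L) : Even (2 : ZMod L).val := by
  have := even_val_add (Dvd.dvd.trans ⟨2, rfl⟩ hL) (1 : ZMod L) 1
  rw [one_add_one_eq_two] at this
  exact this.2 Iff.rfl

/-- Both coordinates are even. -/
def IsEven (x : Site L) : Prop := Even x.1.val ∧ Even x.2.val

instance (x : Site L) : Decidable (IsEven x) := by unfold IsEven; infer_instance

/-- Deviations from a periodic flux pattern: wrong fluxes at the sites with an odd coordinate, and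
different fluxes at neighbouring sites with even coordinates. -/
def defect (σ : Config L) (z : Site L) : ℕ :=
  (if IsEven z ∨ flux σ z = -1 then 0 else 1) +
  (if ¬ Even z.1.val ∧ Even z.2.val ∧ flux σ (z - unitVec L 0) ≠ flux σ (z + unitVec L 0)
    then 1 else 0) +
  (if Even z.1.val ∧ ¬ Even z.2.val ∧ flux σ (z - unitVec L 1) ≠ flux σ (z + unitVec L 1)
    then 1 else 0)

/-- The number of the plaquettes at even sites without flux. -/
def evenMonopoles (σ : Config L) : ℕ := ∑ z, if IsEven z ∧ flux σ z ≠ -1 then 1 else 0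

section Chess
variable (hL : 4 ∣ L) (b : Bool) (σ : Config L)
include hL

theorem not_even_of_isCut {z : Site L} (hz : IsCut z) : ¬ Even z.1.val := by
  obtain ⟨q, hq⟩ := hL
  rw [Nat.even_iff]
  rcases hz with h | h <;> omega

theorem even_mirrorPlaq (z : Site L) : Even (mirrorPlaq z).1.val ↔ Even z.1.val := by
  have h2 : 2 ∣ L := Dvd.dvd.trans ⟨2, rfl⟩ hL
  have : Even (-2 : ZMod L).val := (even_val_neg h2 _).2 (even_val_two hL)
  simp [mirrorPlaq, even_val_sub h2, this]

theorem mirrorPlaq_snd (z : Site L) : (mirrorPlaq z).2 = z.2 := rfl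

theorem mirrorPlaq_add_unitVec_zero (z : Site L) :
    mirrorPlaq (z + unitVec L 0) = mirrorPlaq z - unitVec L 0 := by
  simp only [mirrorPlaq, unitVec_zero, Prod.fst_add, Prod.snd_add, add_zero, Prod.mk_sub_mk, sub_zero]
  congr 1; ring

theorem mirrorPlaq_sub_unitVec_zero (z : Site L) :
    mirrorPlaq (z - unitVec L 0) = mirrorPlaq z + unitVec L 0 := by
  simp only [mirrorPlaq, unitVec_zero, Prod.fst_sub, Prod.snd_sub, Prod.mk_add_mk, add_zero, sub_zero]
  congr 1; ring

theorem mirrorPlaq_sub_unitVec_one (x : Site L) :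
    mirrorPlaq (x - unitVec L 1) = mirrorPlaq x - unitVec L 1 := by
  simp [mirrorPlaq, unitVec_one]

theorem not_isCut_add_of_odd {z : Site L} (h : ¬ Even z.1.val) :
    ¬ IsCut (z + unitVec L 0) ∧ ¬ IsCut (z - unitVec L 0) := by
  have h2 : 2 ∣ L := Dvd.dvd.trans ⟨2, rfl⟩ hL
  constructor <;> intro hc <;> have := not_even_of_isCut hL hc
  · rw [unitVec_zero, Prod.fst_add, even_val_add h2] at this
    exact this (iff_of_false h (not_even_val_one hL))
  · rw [unitVec_zero, Prod.fst_sub, even_val_sub h2] at this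
    exact this (iff_of_false h (not_even_val_one hL))

theorem defect_reflectField_of_isCut {z : Site L} (hz : IsCut z) :
    defect (reflectField b σ) z = 0 := by
  have hodd := not_even_of_isCut hL hz
  obtain ⟨c1, c2⟩ := not_isCut_add_of_odd hL hodd
  have hm : mirrorPlaq (z + unitVec L 0) = z - unitVec L 0 := by
    rw [mirrorPlaq_add_unitVec_zero hL, mirrorPlaq_of_isCut hL hz]
  have hm' : mirrorPlaq (z - unitVec L 0) = z + unitVec L 0 := by
    rw [mirrorPlaq_sub_unitVec_zero hL, mirrorPlaq_of_isCut hL hz]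
  have hs := leftSide_mirrorPlaq hL c1
  rw [hm] at hs
  have hfl : flux (reflectField b σ) (z - unitVec L 0) = flux (reflectField b σ) (z + unitVec L 0) := by
    rw [flux_reflectField hL, flux_reflectField hL, if_neg c1, if_neg c2, hm, hm', hs]
    cases leftSide (z + unitVec L 0) <;> cases b <;> rfl
  have hfz : flux (reflectField b σ) z = -1 := by rw [flux_reflectField hL, if_pos hz]
  simp [defect, hodd, hfl, hfz]

theorem defect_reflectField_of_not_isCut {z : Site L} (hz : ¬ IsCut z) :
    defect (reflectField b σ) z =
      if leftSide z = b then defect σ z else defect σ (mirrorPlaq z) := by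
  have hv : ∀ w : Site L, (IsCut (w - unitVec L 1) ↔ IsCut w) ∧
      leftSide (w - unitVec L 1) = leftSide w := by
    intro w
    constructor
    · rw [← isCut_add_unitVec_one hL, sub_add_cancel]
    · rw [← leftSide_add_unitVec_one hL, sub_add_cancel]
  have hh : ¬ Even z.1.val → leftSide (z + unitVec L 0) = leftSide z ∧
      leftSide (z - unitVec L 0) = leftSide z := by
    intro h
    obtain ⟨c1, c2⟩ := not_isCut_add_of_odd hL h
    exact ⟨((leftSide_eq_of_eq_add hL rfl).2 hz).symm,
      (leftSide_eq_of_eq_add hL (sub_add_cancel z _).symm).2 c2⟩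
  have heven : IsEven (mirrorPlaq z) ↔ IsEven z := by
    simp only [IsEven, even_mirrorPlaq hL, mirrorPlaq_snd hL]
  unfold defect
  simp only [flux_reflectField hL, isCut_add_unitVec_one hL, leftSide_add_unitVec_one hL, hv, hz,
    if_false, mirrorPlaq_add_unitVec_one hL, mirrorPlaq_sub_unitVec_one hL, even_mirrorPlaq hL,
    mirrorPlaq_snd hL, heven]
  by_cases ho : Even z.1.val
  · simp only [ho, not_true_eq_false, false_and, if_false, true_and]
    split_ifs <;> simp_all
  · obtain ⟨c1, c2⟩ := not_isCut_add_of_odd hL ho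
    obtain ⟨d1, d2⟩ := hh ho
    simp only [c1, c2, d1, d2, if_false, ho, not_false_eq_true, true_and, false_and,
      mirrorPlaq_add_unitVec_zero hL, mirrorPlaq_sub_unitVec_zero hL, add_zero]
    by_cases hb : leftSide z = b
    · simp only [hb, if_true]
    · simp only [hb, if_false, ne_comm]

theorem sum_defect_reflectField :
    ∑ z, defect (reflectField true σ) z + ∑ z, defect (reflectField false σ) z +
      2 * ∑ z : Site L with IsCut z, defect σ z = 2 * ∑ z, defect σ z := by
  refine sum_reflect hL (fun z hz => ?_) (fun z hz => ?_)
  · exact ⟨defect_reflectField_of_isCut hL _ σ hz, defect_reflectField_of_isCut hL _ σ hz⟩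
  · rw [defect_reflectField_of_not_isCut hL _ σ hz, defect_reflectField_of_not_isCut hL _ σ hz]
    cases leftSide z <;> simp [add_comm]

theorem evenMonopoles_reflectField :
    evenMonopoles (reflectField true σ) + evenMonopoles (reflectField false σ) =
      2 * evenMonopoles σ := by
  have heven : ∀ z : Site L, IsEven (mirrorPlaq z) ↔ IsEven z := fun z => by
    simp only [IsEven, even_mirrorPlaq hL, mirrorPlaq_snd hL]
  have hcut : ∀ z : Site L, IsCut z → ¬ IsEven z := fun z hz h => not_even_of_isCut hL hz h.1
  have := sum_reflect hL (f := fun z => if IsEven z ∧ flux σ z ≠ -1 then 1 else 0)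
    (f₁ := fun z => if IsEven z ∧ flux (reflectField true σ) z ≠ -1 then 1 else 0)
    (f₂ := fun z => if IsEven z ∧ flux (reflectField false σ) z ≠ -1 then 1 else 0)
    (fun z hz => by simp [hcut z hz])
    (fun z hz => by
      simp only [flux_reflectField hL, hz, if_false, heven]
      cases leftSide z <;> simp [add_comm])
  rw [Finset.sum_eq_zero (s := {z | IsCut z})] at this
  · simpa [evenMonopoles] using this
  · intro z hz
    simp [hcut z (Finset.mem_filter.1 hz).2]

theorem defect_translate {v : Site L} (hv : IsEven v) (z : Site L) :
    defect (translate v σ) z = defect σ (z + v) := by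
  have h2 : 2 ∣ L := Dvd.dvd.trans ⟨2, rfl⟩ hL
  have e1 : Even (z + v).1.val ↔ Even z.1.val := by simp [even_val_add h2, hv.1]
  have e2 : Even (z + v).2.val ↔ Even z.2.val := by simp [even_val_add h2, hv.2]
  simp only [defect, IsEven, e1, e2, flux_translate, add_right_comm z _ v, sub_add_eq_add_sub]

theorem defect_swapCoord (z : Site L) : defect (swapCoord σ) z = defect σ z.swap := by
  have e0 : (z + unitVec L 0).swap = z.swap + unitVec L 1 := by simp [unitVec_zero, unitVec_one]
  have e1 : (z + unitVec L 1).swap = z.swap + unitVec L 0 := by simp [unitVec_zero, unitVec_one]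
  have e2 : (z - unitVec L 0).swap = z.swap - unitVec L 1 := by simp [unitVec_zero, unitVec_one]
  have e3 : (z - unitVec L 1).swap = z.swap - unitVec L 0 := by simp [unitVec_zero, unitVec_one]
  simp only [defect, flux_swapCoord, e0, e1, e2, e3, IsEven, Prod.fst_swap, Prod.snd_swap]
  rw [add_right_comm]
  congr 1
  · congr 1
    · simp only [and_comm]
    · congr 1
      exact propext ⟨fun h => ⟨h.2.1, h.1, h.2.2⟩, fun h => ⟨h.2.1, h.1, h.2.2⟩⟩
  · congr 1
    exact propext ⟨fun h => ⟨h.2.1, h.1, h.2.2⟩, fun h => ⟨h.2.1, h.1, h.2.2⟩⟩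

theorem evenMonopoles_translate {v : Site L} (hv : IsEven v) :
    evenMonopoles (translate v σ) = evenMonopoles σ := by
  have h2 : 2 ∣ L := Dvd.dvd.trans ⟨2, rfl⟩ hL
  unfold evenMonopoles
  rw [← Equiv.sum_comp (Equiv.addRight v) (fun z => if IsEven z ∧ flux σ z ≠ -1 then 1 else 0)]
  refine Finset.sum_congr rfl fun z _ => ?_
  have : IsEven (z + v) ↔ IsEven z := by
    simp [IsEven, even_val_add h2, hv.1, hv.2]
  simp [flux_translate, this]

theorem evenMonopoles_swapCoord : evenMonopoles (swapCoord σ) = evenMonopoles σ := by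
  unfold evenMonopoles
  rw [← Equiv.sum_comp (Equiv.prodComm _ _) (fun z => if IsEven z ∧ flux σ z ≠ -1 then 1 else 0)]
  refine Finset.sum_congr rfl fun z _ => ?_
  simp only [flux_swapCoord, IsEven, Equiv.prodComm_apply, Prod.fst_swap, Prod.snd_swap,
    and_comm (a := Even z.2.val)]

theorem flux_eq_of_defect_eq_zero (h : ∀ z, defect σ z = 0) :
    (∀ z, ¬ IsEven z → flux σ z = -1) ∧ ∀ z, IsEven z → flux σ z = flux σ 0 := by
  have h2 : 2 ∣ L := Dvd.dvd.trans ⟨2, rfl⟩ hL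
  have h' : ∀ z, (IsEven z ∨ flux σ z = -1) ∧
      (¬ Even z.1.val → Even z.2.val → flux σ (z - unitVec L 0) = flux σ (z + unitVec L 0)) ∧
      (Even z.1.val → ¬ Even z.2.val → flux σ (z - unitVec L 1) = flux σ (z + unitVec L 1)) := by
    intro z
    have := h z
    unfold defect at this
    refine ⟨?_, ?_, ?_⟩
    · by_contra hc; rw [if_neg hc] at this; omega
    · intro a1 a2; by_contra hc; rw [if_pos (c := ¬ Even z.1.val ∧ _) ⟨a1, a2, hc⟩] at this; omega
    · intro a1 a2; by_contra hc; rw [if_pos (c := Even z.1.val ∧ _) ⟨a1, a2, hc⟩] at this; omega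
  refine ⟨fun z hz => ((h' z).1).resolve_left hz, ?_⟩
  have s1 : ∀ x : Site L, IsEven x → flux σ (x + (2, 0)) = flux σ x := by
    intro x hx
    have h3 := (h' (x + unitVec L 0)).2.1
      (by simp [unitVec_zero, even_val_add h2, hx.1, not_even_val_one hL])
      (by simpa [unitVec_zero] using hx.2)
    rw [add_sub_cancel_right, add_assoc] at h3
    rw [h3]; congr 2
    simp [unitVec_zero, one_add_one_eq_two]
  have s2 : ∀ x : Site L, IsEven x → flux σ (x + (0, 2)) = flux σ x := by
    intro x hx
    have h3 := (h' (x + unitVec L 1)).2.2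
      (by simpa [unitVec_one] using hx.1)
      (by simp [unitVec_one, even_val_add h2, hx.2, not_even_val_one hL])
    rw [add_sub_cancel_right, add_assoc] at h3
    rw [h3]; congr 2
    simp [unitVec_one, one_add_one_eq_two]
  have ev : ∀ j : ℕ, Even ((2 * j : ℕ) : ZMod L).val := by
    intro j
    rw [ZMod.val_natCast, Nat.even_iff, Nat.mod_mod_of_dvd _ h2]; omega
  have t1 : ∀ j : ℕ, flux σ (((2 * j : ℕ) : ZMod L), 0) = flux σ 0 := by
    intro j
    induction j with
    | zero => simp; rfl
    | succ j ih =>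
      rw [← ih, ← s1 (((2 * j : ℕ) : ZMod L), 0) ⟨ev j, by simp⟩]
      congr 1; simp [mul_add]
  have t2 : ∀ j k : ℕ, flux σ (((2 * j : ℕ) : ZMod L), ((2 * k : ℕ) : ZMod L)) = flux σ 0 := by
    intro j k
    induction k with
    | zero => simpa using t1 j
    | succ k ih =>
      rw [← ih, ← s2 (((2 * j : ℕ) : ZMod L), ((2 * k : ℕ) : ZMod L)) ⟨ev j, ev k⟩]
      congr 1; simp [mul_add]
  intro z hz
  obtain ⟨j, hj⟩ := hz.1
  obtain ⟨k, hk⟩ := hz.2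
  have := t2 j k
  rwa [two_mul, two_mul, ← hj, ← hk, ZMod.natCast_zmod_val, ZMod.natCast_zmod_val] at this

theorem exists_periodic_optimum {s : ℝ} (hs : s ≠ 0) (c : ℝ) :
    ∃ σ : Config L, (∀ τ : Config L, Real.log (hopDet s τ) + c * evenMonopoles τ ≤
      Real.log (hopDet s σ) + c * evenMonopoles σ) ∧
      ((∀ z, flux σ z = -1) ∨ (∀ z, flux σ z = if IsEven z then 1 else -1)) := by
  have h2 : 2 ∣ L := Dvd.dvd.trans ⟨2, rfl⟩ hL
  obtain ⟨σ, h1, h3⟩ := exists_optimal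
    (fun σ : Config L => Real.log (hopDet s σ) + c * evenMonopoles σ)
    (fun σ : Config L => ∑ z, defect σ z) (fun σ : Config L => 2 * ∑ z : Site L with IsCut z, defect σ z) (reflectField true)
    (reflectField false) (fun σ => by
      have a1 := two_mul_log_hopDet_le hL σ hs
      have a2 : (evenMonopoles (reflectField true σ) : ℝ) + evenMonopoles (reflectField false σ) =
        2 * evenMonopoles σ := by exact_mod_cast evenMonopoles_reflectField hL σ
      linear_combination a1 - c * a2) (fun σ => (sum_defect_reflectField hL σ).le)
  refine ⟨σ, h1, ?_⟩
  have key : ∀ τ : Config L, Real.log (hopDet s τ) + c * evenMonopoles τ =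
      Real.log (hopDet s σ) + c * evenMonopoles σ → ∑ z, defect τ z = ∑ z, defect σ z →
      ∀ z : Site L, ¬ Even z.1.val → defect τ z = 0 := by
    intro τ e1 e2 z hz
    have hv : IsEven ((z.1 + 1, 0) : Site L) :=
      ⟨by simp [even_val_add h2, hz, not_even_val_one hL], by simp⟩
    have h4 := h3 (translate (z.1 + 1, 0) τ)
      (by simp only [hopDet_translate, evenMonopoles_translate hL τ hv, e1]) (by
      simp only [defect_translate hL τ hv]
      rw [← e2]
      exact Equiv.sum_comp (Equiv.addRight ((z.1 + 1, 0) : Site L)) (defect τ))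
    simp only [mul_eq_zero, OfNat.ofNat_ne_zero, false_or, Finset.sum_eq_zero_iff,
      Finset.mem_filter, Finset.mem_univ, true_and] at h4
    have h5 := h4 (-1, z.2) (isCut_neg_one hL _)
    rw [defect_translate hL τ hv] at h5
    simpa using h5
  have hzero : ∀ z, defect σ z = 0 := by
    intro z
    by_cases hz1 : Even z.1.val
    · by_cases hz2 : Even z.2.val
      · simp [defect, IsEven, hz1, hz2]
      · have := key (swapCoord σ) (by rw [hopDet_swapCoord, evenMonopoles_swapCoord hL]) (by
          simp only [defect_swapCoord hL]
          exact Equiv.sum_comp (Equiv.prodComm _ _) (defect σ)) z.swap hz2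
        rwa [defect_swapCoord hL, Prod.swap_swap] at this
    · exact key σ rfl rfl z hz1
  obtain ⟨f1, f2⟩ := flux_eq_of_defect_eq_zero hL σ hzero
  rcases Int.units_eq_one_or (flux σ 0) with h0 | h0
  · right
    intro z
    split_ifs with hz
    · rw [f2 z hz, h0]
    · exact f1 z hz
  · left
    intro z
    by_cases hz : IsEven z
    · rw [f2 z hz, h0]
    · exact f1 z hz

end Chess

/-! ### Moments of the hopping matrix -/

section Spectral
variable {n : Type*} [Fintype n] [DecidableEq n]

theorem det_smul_one_add_eq_prod {H : Matrix n n ℂ} (hH : H.IsHermitian) (c : ℂ) :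
    (c • (1 : Matrix n n ℂ) + H).det = ∏ i, (c + ((hH.eigenvalues i : ℝ) : ℂ)) := by
  obtain ⟨U, -, hU, hs⟩ := exists_unitary_diagonalization hH
  have h1 : c • (1 : Matrix n n ℂ) + H =
      U * (c • (1 : Matrix n n ℂ) + Matrix.diagonal (fun i => ((hH.eigenvalues i : ℝ) : ℂ))) *
      U.conjTranspose := by
    rw [Matrix.mul_add, Matrix.add_mul, Matrix.mul_smul, Matrix.mul_one, Matrix.smul_mul, hU, ← hs]
  rw [h1, Matrix.det_mul_right_comm, hU, Matrix.one_mul, Matrix.smul_one_eq_diagonal,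
    Matrix.diagonal_add, Matrix.det_diagonal]

theorem trace_pow_eq_sum {H : Matrix n n ℂ} (hH : H.IsHermitian) (k : ℕ) :
    (H ^ k).trace = ∑ i, (((hH.eigenvalues i) ^ k : ℝ) : ℂ) := by
  obtain ⟨U, hU', hU, hs⟩ := exists_unitary_diagonalization hH
  set D := Matrix.diagonal (fun i => ((hH.eigenvalues i : ℝ) : ℂ)) with hD
  have h1 : H ^ k = U * D ^ k * U.conjTranspose := by
    induction k with
    | zero => rw [pow_zero, pow_zero, Matrix.mul_one, hU]
    | succ k ih =>
      rw [pow_succ, ih, pow_succ]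
      calc _ = U * D ^ k * U.conjTranspose * (U * D * U.conjTranspose) := by rw [← hs]
        _ = U * D ^ k * (U.conjTranspose * U) * D * U.conjTranspose := by
            simp only [Matrix.mul_assoc]
        _ = _ := by rw [hU', Matrix.mul_one]; simp only [Matrix.mul_assoc]
  rw [h1, Matrix.trace_mul_cycle, hU', Matrix.one_mul, hD, Matrix.diagonal_pow, Matrix.trace_diagonal]
  simp

end Spectral


/-- The eigenvalues of the hopping matrix. -/
def hopEig (σ : Config L) : Site L → ℝ := (hop_isHermitian σ).eigenvalues

theorem hopDet_sq (s : ℝ) (σ : Config L) : hopDet s σ ^ 2 = ∏ x, (s ^ 2 + hopEig σ x ^ 2) := by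
  unfold hopDet
  rw [det_smul_one_add_eq_prod (hop_isHermitian σ), norm_prod, ← Finset.prod_pow]
  refine Finset.prod_congr rfl fun x _ => ?_
  rw [← Complex.normSq_eq_norm_sq, Complex.normSq_apply]
  simp [hopEig]; ring

theorem link_eq (σ : Config L) (x y : Site L) : link σ x y =
    ((if y = x + unitVec L 0 then (σ (x, 0) : ℤ) else 0) +
      (if y = x - unitVec L 0 then (σ (x - unitVec L 0, 0) : ℤ) else 0)) +
    ((if y = x + unitVec L 1 then (σ (x, 1) : ℤ) else 0) +
      (if y = x - unitVec L 1 then (σ (x - unitVec L 1, 1) : ℤ) else 0)) := by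
  have h : ∀ e : Site L, (x = y + e) = (y = x - e) := fun e => by
    rw [eq_sub_iff_add_eq, eq_comm (a := x)]
  unfold link
  simp only [h]
  congr 2 <;> (split_ifs with h1 <;> [rw [h1]; rfl])

theorem sum_link_mul (σ : Config L) (x : Site L) (f : Site L → ℤ) : ∑ z, link σ x z * f z =
    σ (x, 0) * f (x + unitVec L 0) + σ (x - unitVec L 0, 0) * f (x - unitVec L 0) +
      (σ (x, 1) * f (x + unitVec L 1) + σ (x - unitVec L 1, 1) * f (x - unitVec L 1)) := by
  simp only [link_eq, add_mul, Finset.sum_add_distrib, ite_mul, zero_mul, Finset.sum_ite_eq',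
    Finset.mem_univ, if_true]

theorem sum_abs_link_le (σ : Config L) (x : Site L) : ∑ y, |link σ x y| ≤ 4 := by
  have hu : ∀ u : ℤˣ, |(u : ℤ)| = 1 := fun u => by
    rcases Int.units_eq_one_or u with rfl | rfl <;> simp
  have h : ∀ y, |link σ x y| ≤ ((if y = x + unitVec L 0 then 1 else 0) +
      (if y = x - unitVec L 0 then 1 else 0)) + ((if y = x + unitVec L 1 then 1 else 0) +
      (if y = x - unitVec L 1 then 1 else 0)) := by
    intro y
    rw [link_eq]
    refine (abs_add_le _ _).trans (add_le_add ((abs_add_le _ _).trans (add_le_add ?_ ?_))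
      ((abs_add_le _ _).trans (add_le_add ?_ ?_))) <;> split_ifs <;> simp [hu]
  refine (Finset.sum_le_sum fun y _ => h y).trans ?_
  simp [Finset.sum_add_distrib]

theorem abs_hopEig_le (σ : Config L) (x : Site L) : |hopEig σ x| ≤ 4 := by
  have hd := (hop_isHermitian σ).mulVec_eigenvectorBasis x
  set v : Site L → ℂ := ((hop_isHermitian σ).eigenvectorBasis x).ofLp with hv
  have hv0 : v ≠ 0 := by
    intro h0
    have h1 := (hop_isHermitian σ).eigenvectorBasis.orthonormal.1 x
    have : (hop_isHermitian σ).eigenvectorBasis x = 0 := by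
      ext i; exact congrFun h0 i
    rw [this] at h1; simp at h1
  obtain ⟨y, hy⟩ := Finite.exists_max (fun y => ‖v y‖)
  have hpos : 0 < ‖v y‖ := by
    rcases (norm_nonneg (v y)).lt_or_eq with h | h
    · exact h
    · exact absurd (funext fun z => norm_eq_zero.1 (le_antisymm (h ▸ hy z) (norm_nonneg _))) hv0
  have h1 := congrFun hd y
  have h2 : ‖∑ z, hop σ y z * v z‖ ≤ 4 * ‖v y‖ := by
    refine (norm_sum_le _ _).trans ?_
    calc ∑ z, ‖hop σ y z * v z‖ ≤ ∑ z, ((|link σ y z| : ℤ) : ℝ) * ‖v y‖ := by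
          refine Finset.sum_le_sum fun z _ => ?_
          rw [norm_mul]
          refine mul_le_mul (le_of_eq ?_) (hy z) (norm_nonneg _) (by positivity)
          simp [hop, Complex.norm_intCast]
      _ ≤ 4 * ‖v y‖ := by
          rw [← Finset.sum_mul]
          refine mul_le_mul_of_nonneg_right ?_ hpos.le
          exact_mod_cast sum_abs_link_le σ y
  have h3 : ∑ z, hop σ y z * v z = (hopEig σ x : ℂ) * v y := by
    simpa [Matrix.mulVec, dotProduct, hopEig] using h1
  rw [h3, norm_mul, Complex.norm_real] at h2
  exact le_of_mul_le_mul_right h2 hpos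

theorem units_coe_mul_self (u : ℤˣ) : (u : ℤ) * u = 1 := by
  rcases Int.units_eq_one_or u with rfl | rfl <;> simp

theorem sum_sq_of_injective {ι κ : Type*} [Fintype ι] [DecidableEq ι] [Fintype κ] [DecidableEq κ]
    (p : κ → ι) (hp : Function.Injective p) (c : κ → ℤ) :
    ∑ y, (∑ i, if y = p i then c i else 0) ^ 2 = ∑ i, c i ^ 2 := by
  have h1 : ∀ j, (∑ i, if p j = p i then c i else 0) = c j := by
    intro j; simp [hp.eq_iff]
  calc ∑ y, (∑ i, if y = p i then c i else 0) ^ 2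
      = ∑ y, ∑ j, if y = p j then (∑ i, if y = p i then c i else 0) * c j else 0 := by
        refine Finset.sum_congr rfl fun y _ => ?_
        rw [sq, Finset.mul_sum]
        exact Finset.sum_congr rfl fun j _ => by rw [mul_ite, mul_zero]
    _ = ∑ j, (∑ i, if p j = p i then c i else 0) * c j := by
        rw [Finset.sum_comm]
        exact Finset.sum_congr rfl fun j _ => by simp only [Finset.sum_ite_eq', Finset.mem_univ, if_true]
    _ = _ := Finset.sum_congr rfl fun j _ => by rw [h1, sq]

theorem injective_add_offset (hL : 8 ≤ L) (x : Site L) {κ : Type*} (o : κ → ℤ × ℤ)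
    (ho : Function.Injective o) (hb : ∀ i, |(o i).1| ≤ 2 ∧ |(o i).2| ≤ 2) :
    Function.Injective fun i => x + (((o i).1 : ZMod L), ((o i).2 : ZMod L)) := by
  have key : ∀ u v : ℤ, |u| ≤ 2 → |v| ≤ 2 → (u : ZMod L) = v → u = v := by
    intro u v hu hv h
    rw [ZMod.intCast_eq_intCast_iff_dvd_sub] at h
    rw [abs_le] at hu hv
    have := Int.eq_zero_of_abs_lt_dvd h (by rw [abs_lt]; constructor <;> omega)
    omega
  intro i j h
  have h' := add_left_cancel h
  rw [Prod.mk.injEq] at h'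
  exact ho (Prod.ext (key _ _ (hb i).1 (hb j).1 h'.1) (key _ _ (hb i).2 (hb j).2 h'.2))

theorem units_coe_sq (u : ℤˣ) : (u : ℤ) ^ 2 = 1 := by rw [sq, units_coe_mul_self]

theorem sum_link_sq (hL : 8 ≤ L) (σ : Config L) (x : Site L) : ∑ y, link σ x y ^ 2 = 4 := by
  have h := sum_sq_of_injective _ (injective_add_offset hL x
    ![(1, 0), (-1, 0), (0, 1), (0, -1)] (by decide) (by decide))
    ![(σ (x, 0) : ℤ), σ (x - unitVec L 0, 0), σ (x, 1), σ (x - unitVec L 1, 1)]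
  obtain ⟨a, b⟩ := x
  simp [Fin.sum_univ_succ, units_coe_sq, unitVec_zero, unitVec_one] at h
  simp only [link_eq, unitVec_zero, unitVec_one, Prod.mk_add_mk, Prod.mk_sub_mk, add_zero, sub_zero]
  rw [← h]
  refine Finset.sum_congr rfl fun y _ => ?_
  simp only [← sub_eq_add_neg, add_assoc]

theorem sum_flux_sq (σ : Config L) (x : Site L) (hL : 8 ≤ L) :
    ∑ y, (∑ z, link σ x z * link σ z y) ^ 2 =
      28 + 2 * (flux σ x + flux σ (x - unitVec L 1) + flux σ (x - unitVec L 0) +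
        flux σ (x - unitVec L 0 - unitVec L 1)) := by
  simp only [sum_link_mul]
  obtain ⟨a, b⟩ := x
  have h := sum_sq_of_injective _ (injective_add_offset hL (a, b)
    ![(0, 0), (2, 0), (-2, 0), (0, 2), (0, -2), (1, 1), (1, -1), (-1, 1), (-1, -1)]
    (by decide) (by decide))
    ![4, (σ ((a, b), 0) : ℤ) * σ ((a + 1, b), 0), (σ ((a - 1, b), 0) : ℤ) * σ ((a - 1 - 1, b), 0),
      (σ ((a, b), 1) : ℤ) * σ ((a, b + 1), 1), (σ ((a, b - 1), 1) : ℤ) * σ ((a, b - 1 - 1), 1),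
      (σ ((a, b), 0) : ℤ) * σ ((a + 1, b), 1) + σ ((a, b), 1) * σ ((a, b + 1), 0),
      (σ ((a, b), 0) : ℤ) * σ ((a + 1, b - 1), 1) + σ ((a, b - 1), 1) * σ ((a, b - 1), 0),
      (σ ((a - 1, b), 0) : ℤ) * σ ((a - 1, b), 1) + σ ((a, b), 1) * σ ((a - 1, b + 1), 0),
      (σ ((a - 1, b), 0) : ℤ) * σ ((a - 1, b - 1), 1) + σ ((a, b - 1), 1) * σ ((a - 1, b - 1), 0)]
  have hp : ∀ y : Site L, (∑ i : Fin 9, if y = (fun i : Fin 9 => ((a, b) : Site L) +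
      ((((![(0, 0), (2, 0), (-2, 0), (0, 2), (0, -2), (1, 1), (1, -1), (-1, 1), (-1, -1)] :
        Fin 9 → ℤ × ℤ) i).1 : ZMod L), (((![(0, 0), (2, 0), (-2, 0), (0, 2), (0, -2), (1, 1),
        (1, -1), (-1, 1), (-1, -1)] : Fin 9 → ℤ × ℤ) i).2 : ZMod L))) i then
      (![4, (σ ((a, b), 0) : ℤ) * σ ((a + 1, b), 0), (σ ((a - 1, b), 0) : ℤ) * σ ((a - 1 - 1, b), 0),
      (σ ((a, b), 1) : ℤ) * σ ((a, b + 1), 1), (σ ((a, b - 1), 1) : ℤ) * σ ((a, b - 1 - 1), 1),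
      (σ ((a, b), 0) : ℤ) * σ ((a + 1, b), 1) + σ ((a, b), 1) * σ ((a, b + 1), 0),
      (σ ((a, b), 0) : ℤ) * σ ((a + 1, b - 1), 1) + σ ((a, b - 1), 1) * σ ((a, b - 1), 0),
      (σ ((a - 1, b), 0) : ℤ) * σ ((a - 1, b), 1) + σ ((a, b), 1) * σ ((a - 1, b + 1), 0),
      (σ ((a - 1, b), 0) : ℤ) * σ ((a - 1, b - 1), 1) + σ ((a, b - 1), 1) * σ ((a - 1, b - 1), 0)] :
        Fin 9 → ℤ) i else 0) = (σ ((a, b), 0) : ℤ) * link σ ((a, b) + unitVec L 0) y +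
      σ ((a, b) - unitVec L 0, 0) * link σ ((a, b) - unitVec L 0) y +
      (σ ((a, b), 1) * link σ ((a, b) + unitVec L 1) y +
        σ ((a, b) - unitVec L 1, 1) * link σ ((a, b) - unitVec L 1) y) := by
    intro y
    have e1 : a + 1 + 1 = a + 2 := by ring
    have e2 : a - 1 - 1 = a - 2 := by ring
    have e3 : b + 1 + 1 = b + 2 := by ring
    have e4 : b - 1 - 1 = b - 2 := by ring
    simp only [link_eq, unitVec_zero, unitVec_one, Prod.mk_add_mk, Prod.mk_sub_mk, add_zero,
      sub_zero, add_sub_cancel_right, sub_add_cancel, Fin.sum_univ_succ, Fin.sum_univ_zero,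
      Matrix.cons_val_zero, Matrix.cons_val_succ, Int.cast_zero, Int.cast_one, Int.cast_ofNat,
      Int.cast_neg, ← sub_eq_add_neg]
    simp only [e1, e2, e3, e4]
    have u1 := units_coe_mul_self (σ ((a, b), 0))
    have u2 := units_coe_mul_self (σ ((a, b), 1))
    have u3 := units_coe_mul_self (σ ((a - 1, b), 0))
    have u4 := units_coe_mul_self (σ ((a, b - 1), 1))
    obtain ⟨δ, hδ⟩ : ∃ δ : Site L → ℤ, ∀ p c, (if y = p then c else 0) = c * δ p :=
      ⟨fun p => if y = p then 1 else 0, fun p c => by simp⟩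
    simp only [hδ]
    linear_combination (-δ (a, b)) * (u1 + u2 + u3 + u4)
  simp only [hp] at h
  have v1 : ∀ p q : ℤˣ, ((p : ℤ) * q) ^ 2 = 1 := fun p q => by
    rw [mul_pow, units_coe_sq, units_coe_sq, one_mul]
  have v2 : ∀ p q r s : ℤˣ, ((p : ℤ) * q + r * s) ^ 2 = 2 + 2 * (p * q * r * s) := fun p q r s => by
    linear_combination v1 p q + v1 r s
  rw [h]
  simp only [Fin.sum_univ_succ, Fin.sum_univ_zero, Matrix.cons_val_zero, Matrix.cons_val_succ, flux,
    unitVec_zero, unitVec_one, Prod.mk_add_mk, Prod.mk_sub_mk, add_zero, sub_zero, sub_add_cancel,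
    v1, v2]
  push_cast
  ring

/-- The number of the plaquettes without flux. -/
def monopoles (σ : Config L) : ℕ := ∑ z, if flux σ z ≠ -1 then 1 else 0

theorem flux_eq_monopole (σ : Config L) (z : Site L) :
    (flux σ z : ℤ) = 2 * (if flux σ z ≠ -1 then 1 else 0) - 1 := by
  rcases Int.units_eq_one_or (flux σ z) with h | h <;> simp [h]

theorem card_site : Fintype.card (Site L) = L ^ 2 := by
  rw [Fintype.card_prod, ZMod.card, sq]

theorem sum_flux (σ : Config L) : ∑ z, (flux σ z : ℤ) = 2 * monopoles σ - (L : ℤ) ^ 2 := by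
  simp only [flux_eq_monopole]
  rw [Finset.sum_sub_distrib, ← Finset.mul_sum, Finset.sum_const, Finset.card_univ, card_site,
    monopoles]
  push_cast; simp

theorem trace_hop_sq (hL : 8 ≤ L) (σ : Config L) : ∑ x, hopEig σ x ^ 2 = 4 * (L : ℝ) ^ 2 := by
  have h := trace_pow_eq_sum (hop_isHermitian σ) 2
  have h1 : (hop σ ^ 2).trace = ((4 * (L : ℝ) ^ 2 : ℝ) : ℂ) := by
    have : (hop σ ^ 2).trace = ((∑ x, ∑ y, link σ x y ^ 2 : ℤ) : ℂ) := by
      rw [sq, Matrix.trace]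
      push_cast
      refine Finset.sum_congr rfl fun x _ => ?_
      rw [Matrix.diag_apply, Matrix.mul_apply]
      exact Finset.sum_congr rfl fun y _ => by simp [hop, link_comm σ y x, sq]
    rw [this]
    simp only [sum_link_sq hL, Finset.sum_const, Finset.card_univ, card_site]
    push_cast; simp; ring
  rw [h1] at h
  exact_mod_cast h.symm

theorem trace_hop_four (hL : 8 ≤ L) (σ : Config L) :
    ∑ x, hopEig σ x ^ 4 = 20 * (L : ℝ) ^ 2 + 16 * monopoles σ := by
  have h := trace_pow_eq_sum (hop_isHermitian σ) 4
  have h1 : (hop σ ^ 4).trace = ((20 * (L : ℝ) ^ 2 + 16 * monopoles σ : ℝ) : ℂ) := by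
    have h2 : (hop σ ^ 4).trace = ((∑ x, ∑ y, (∑ z, link σ x z * link σ z y) ^ 2 : ℤ) : ℂ) := by
      rw [show 4 = 2 + 2 from rfl, pow_add, Matrix.trace]
      push_cast
      refine Finset.sum_congr rfl fun x _ => ?_
      rw [Matrix.diag_apply, Matrix.mul_apply]
      refine Finset.sum_congr rfl fun y _ => ?_
      have e : ∀ x y, (hop σ ^ 2) x y = ∑ z, (link σ x z : ℂ) * link σ z y := fun x y => by
        rw [sq, Matrix.mul_apply]; rfl
      rw [e, e, sq]
      congr 1
      exact Finset.sum_congr rfl fun z _ => by rw [link_comm σ y z, link_comm σ z x, mul_comm]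
    have h3 : ∀ v : Site L, ∑ x, (flux σ (x - v) : ℤ) = ∑ x, (flux σ x : ℤ) := fun v =>
      Equiv.sum_comp (Equiv.subRight v) (fun x => (flux σ x : ℤ))
    rw [h2]
    simp only [sum_flux_sq σ _ hL, Finset.sum_add_distrib, ← Finset.mul_sum, sub_sub, h3, sum_flux,
      Finset.sum_const, Finset.card_univ, card_site]
    push_cast; simp; ring
  rw [h1] at h
  exact_mod_cast h.symm

theorem log_hopDet {s : ℝ} (hs : s ≠ 0) (σ : Config L) :
    2 * Real.log (hopDet s σ) = ∑ x, Real.log (s ^ 2 + hopEig σ x ^ 2) := by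
  have h := congrArg Real.log (hopDet_sq s σ)
  rw [Real.log_pow, Real.log_prod (fun x _ => by positivity)] at h
  exact_mod_cast h

theorem abs_log_one_add_sub_le {y : ℝ} (hy : 0 ≤ y) (hy' : y ≤ 1 / 8) :
    |Real.log (1 + y) - (y - y ^ 2 / 2)| ≤ 2 * y ^ 3 := by
  have h := Real.abs_log_sub_add_sum_range_le (x := -y) (by rw [abs_neg, abs_of_nonneg hy]; linarith) 2
  simp only [Finset.sum_range_succ, Finset.sum_range_zero, abs_neg, abs_of_nonneg hy] at h
  norm_num at h
  have h2 : y ^ 3 / (1 - y) ≤ 2 * y ^ 3 := by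
    rw [div_le_iff₀ (by linarith)]
    have : 0 ≤ y ^ 3 := by positivity
    nlinarith
  refine le_trans (le_of_eq ?_) (h.trans h2)
  congr 1; ring

/-- A second order expansion of the logarithm of the determinant. -/
theorem abs_log_hopDet_sub_le (hL : 8 ≤ L) {s : ℝ} (hs : 32 ≤ s) (σ : Config L) :
    |2 * Real.log (hopDet s σ) - (L ^ 2 * Real.log (s ^ 2) + 4 * (L : ℝ) ^ 2 / s ^ 2 -
      (20 * (L : ℝ) ^ 2 + 16 * monopoles σ) / (2 * s ^ 4))| ≤
      32 * (20 * (L : ℝ) ^ 2 + 16 * monopoles σ) / s ^ 6 := by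
  have hs0 : 0 < s := by linarith
  rw [log_hopDet hs0.ne', ← trace_hop_four hL, ← trace_hop_sq hL]
  have h1 : ∀ x, hopEig σ x ^ 2 ≤ 16 := fun x => by
    have := abs_hopEig_le σ x
    rw [← sq_abs]; nlinarith [abs_nonneg (hopEig σ x)]
  have h2 : ∀ x, |Real.log (s ^ 2 + hopEig σ x ^ 2) - (Real.log (s ^ 2) + hopEig σ x ^ 2 / s ^ 2 -
      hopEig σ x ^ 4 / (2 * s ^ 4))| ≤ 32 * hopEig σ x ^ 4 / s ^ 6 := by
    intro x
    set q := hopEig σ x ^ 2 with hq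
    have hq0 : 0 ≤ q := by positivity
    have e4 : hopEig σ x ^ 4 = q ^ 2 := by rw [hq]; ring
    have h3 := abs_log_one_add_sub_le (y := q / s ^ 2) (by positivity) (by
      rw [div_le_iff₀ (by positivity)]; nlinarith [h1 x])
    have h4 : Real.log (s ^ 2 + q) = Real.log (s ^ 2) + Real.log (1 + q / s ^ 2) := by
      rw [← Real.log_mul (by positivity) (by positivity)]
      congr 1; field_simp
    rw [h4, e4]
    refine le_trans (le_of_eq ?_) (h3.trans ?_)
    · congr 1; field_simp; ring
    · rw [div_pow, ← mul_div_assoc, ← pow_mul s]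
      refine div_le_div_of_nonneg_right ?_ (by positivity)
      have : q ^ 3 ≤ 16 * q ^ 2 := by nlinarith [h1 x, sq_nonneg q]
      linarith
  have h3 : ∑ x : Site L, Real.log (s ^ 2) = L ^ 2 * Real.log (s ^ 2) := by
    rw [Finset.sum_const, Finset.card_univ, card_site, nsmul_eq_mul]; push_cast; rfl
  rw [← h3, Finset.sum_div, Finset.sum_div, ← Finset.sum_add_distrib, ← Finset.sum_sub_distrib,
    ← Finset.sum_sub_distrib, Finset.mul_sum, Finset.sum_div]
  exact (Finset.abs_sum_le_sum_abs _ _).trans (Finset.sum_le_sum fun x _ => h2 x)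

/-! ### The energy of the monopoles -/

theorem sum_isEven_sub (hL : 4 ∣ L) (z : Site L) :
    (if IsEven (z - 0) then 1 else 0) + (if IsEven (z - unitVec L 0) then 1 else 0) +
      (if IsEven (z - unitVec L 1) then 1 else 0) +
      (if IsEven (z - (unitVec L 0 + unitVec L 1)) then 1 else 0) = 1 := by
  have h2 : 2 ∣ L := Dvd.dvd.trans ⟨2, rfl⟩ hL
  by_cases h1 : Even z.1.val <;> by_cases h3 : Even z.2.val <;>
    simp [IsEven, unitVec_zero, unitVec_one, even_val_sub h2, not_even_val_one hL, h1, h3]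

theorem evenMonopoles_translate_eq (v : Site L) (σ : Config L) :
    evenMonopoles (translate v σ) =
      ∑ z, (if IsEven (z - v) then 1 else 0) * (if flux σ z ≠ -1 then 1 else 0) := by
  unfold evenMonopoles
  rw [← Equiv.sum_comp (Equiv.addRight v) (fun z => (if IsEven (z - v) then 1 else 0) * _)]
  refine Finset.sum_congr rfl fun z _ => ?_
  by_cases h : IsEven z <;> by_cases h' : flux σ (z + v) = -1 <;> simp [flux_translate, h, h']

theorem sum_evenMonopoles (hL : 4 ∣ L) (σ : Config L) :
    evenMonopoles (translate 0 σ) + evenMonopoles (translate (unitVec L 0) σ) +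
      evenMonopoles (translate (unitVec L 1) σ) +
      evenMonopoles (translate (unitVec L 0 + unitVec L 1) σ) = monopoles σ := by
  simp only [evenMonopoles_translate_eq, ← Finset.sum_add_distrib, ← add_mul, sum_isEven_sub hL,
    one_mul, monopoles]

theorem four_mul_sum_isEven (hL : 4 ∣ L) : 4 * ∑ z : Site L, (if IsEven z then 1 else 0) = L ^ 2 := by
  have h : ∀ v : Site L, ∑ z : Site L, (if IsEven (z - v) then 1 else 0) =
      ∑ z : Site L, (if IsEven z then 1 else 0) := fun v =>
    Equiv.sum_comp (Equiv.subRight v) (fun z => if IsEven z then 1 else 0)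
  have h2 : ∑ z : Site L, 1 = L ^ 2 := by simp [sq, ZMod.card]
  rw [← h2, ← Finset.sum_congr rfl fun z _ => sum_isEven_sub hL z]
  simp only [Finset.sum_add_distrib, h]
  ring

theorem log_hopDet_add_monopoles_le (hL : 4 ∣ L) (hL8 : 8 ≤ L) {s : ℝ} (hs : 64 ≤ s) (hs' : s ≤ 128)
    {σ₀ : Config L} (h₀ : ∀ z, flux σ₀ z = -1) (hmax : ∀ τ : Config L, hopDet s τ ≤ hopDet s σ₀)
    (τ : Config L) :
    Real.log (hopDet s τ) + 1 / (2 * 128 ^ 4) * monopoles τ ≤ Real.log (hopDet s σ₀) := by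
  have hs0 : 0 < s := by linarith
  obtain ⟨σ, h1, h2⟩ := exists_periodic_optimum hL hs0.ne' (2 / 128 ^ 4)
  have h3 : Real.log (hopDet s σ) + 2 / 128 ^ 4 * evenMonopoles σ ≤ Real.log (hopDet s σ₀) := by
    rcases h2 with h2 | h2
    · have : evenMonopoles σ = 0 := by simp [evenMonopoles, h2]
      rw [this]
      simpa using Real.log_le_log (hopDet_pos hs0.ne' σ) (hmax σ)
    · have e0 : monopoles σ₀ = 0 := by simp [monopoles, h₀]
      have hne : (1 : ℤˣ) ≠ -1 := by decide
      have e1 : evenMonopoles σ = ∑ z : Site L, (if IsEven z then 1 else 0) := by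
        refine Finset.sum_congr rfl fun z _ => ?_
        by_cases h : IsEven z <;> simp [h2, h, hne]
      have e2 : monopoles σ = ∑ z : Site L, (if IsEven z then 1 else 0) := by
        refine Finset.sum_congr rfl fun z _ => ?_
        by_cases h : IsEven z <;> simp [h2, h, hne]
      have e3 : (L : ℝ) ^ 2 = 4 * evenMonopoles σ := by
        rw [e1]; exact_mod_cast (four_mul_sum_isEven hL).symm
      have b1 := (abs_le.1 (abs_log_hopDet_sub_le hL8 (by linarith : 32 ≤ s) σ)).2
      have b2 := (abs_le.1 (abs_log_hopDet_sub_le hL8 (by linarith : 32 ≤ s) σ₀)).1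
      rw [e0] at b2
      rw [e2, ← e1] at b1
      set k : ℝ := (evenMonopoles σ : ℝ) with hk
      have hk0 : 0 ≤ k := by positivity
      have hs4 : 0 < s ^ 4 := by positivity
      have hs6 : 0 < s ^ 6 := by positivity
      rw [e3] at b1 b2
      have c1 : 32 * (20 * (4 * k) + 16 * k) / s ^ 6 + 32 * (20 * (4 * k) + 16 * (0 : ℕ)) / s ^ 6 ≤
          4 * k / s ^ 4 := by
        rw [← add_div, div_le_div_iff₀ hs6 hs4]
        have : s ^ 6 = s ^ 4 * s ^ 2 := by ring
        rw [this]
        have : (4096 : ℝ) ≤ s ^ 2 := by nlinarith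
        push_cast
        nlinarith [mul_nonneg hk0 hs4.le]
      have c2 : (20 * (4 * k) + 16 * k) / (2 * s ^ 4) =
          (20 * (4 * k) + 16 * (0 : ℕ)) / (2 * s ^ 4) + 8 * k / s ^ 4 := by
        push_cast; field_simp; ring
      have c3 : 2 / 128 ^ 4 * k ≤ 2 * (k / s ^ 4) := by
        rw [div_mul_eq_mul_div, mul_div_assoc]
        have : s ^ 4 ≤ 128 ^ 4 := pow_le_pow_left₀ hs0.le hs' 4
        gcongr
      have c4 : 4 * k / s ^ 4 = 4 * (k / s ^ 4) := by ring
      have c5 : 8 * k / s ^ 4 = 8 * (k / s ^ 4) := by ring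
      rw [c2, c5] at b1
      rw [c4] at c1
      linarith
  have h4 : ∀ v : Site L, Real.log (hopDet s τ) + 2 / 128 ^ 4 * evenMonopoles (translate v τ) ≤
      Real.log (hopDet s σ₀) := fun v => by
    have := h1 (translate v τ)
    rw [hopDet_translate] at this
    exact this.trans h3
  have h5 := sum_evenMonopoles hL τ
  have h6 : ((evenMonopoles (translate 0 τ) : ℝ) + evenMonopoles (translate (unitVec L 0) τ) +
      evenMonopoles (translate (unitVec L 1) τ) +
      evenMonopoles (translate (unitVec L 0 + unitVec L 1) τ)) = monopoles τ := by exact_mod_cast h5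
  rw [← h6]
  linarith [h4 0, h4 (unitVec L 0), h4 (unitVec L 1), h4 (unitVec L 0 + unitVec L 1)]

/-! ### Gauge transformations and fluxes -/

/-- The gauge transform of `σ` by `g`. -/
def gaugeTransform (g : Site L → ℤˣ) (σ : Config L) : Config L :=
  fun b => g b.1 * σ b * g (b.1 + unitVec L b.2)

theorem gaugeTransform_eq_mul (g : Site L → ℤˣ) (σ : Config L) :
    gaugeTransform g σ = gaugeTransform g 1 * σ := by
  ext b; simp [gaugeTransform]; ring

theorem gaugeTransform_gaugeTransform (g g' : Site L → ℤˣ) (σ : Config L) :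
    gaugeTransform g (gaugeTransform g' σ) = gaugeTransform (g * g') σ := by
  ext b; simp [gaugeTransform]; ring

theorem flux_mul (σ τ : Config L) (x : Site L) : flux (σ * τ) x = flux σ x * flux τ x := by
  simp only [flux, Pi.mul_apply]; ac_rfl

theorem fluxA_mul (σ τ : Config L) : fluxA (σ * τ) = fluxA σ * fluxA τ := by
  simp [fluxA, Finset.prod_mul_distrib]

theorem fluxB_mul (σ τ : Config L) : fluxB (σ * τ) = fluxB σ * fluxB τ := by
  simp [fluxB, Finset.prod_mul_distrib]

theorem link_gaugeTransform (g : Site L → ℤˣ) (σ : Config L) (x y : Site L) :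
    link (gaugeTransform g σ) x y = g x * link σ x y * g y := by
  have h : ∀ (x y : Site L) (μ : Fin 2), (if y = x + unitVec L μ then
      (gaugeTransform g σ (x, μ) : ℤ) else 0) =
      g x * (if y = x + unitVec L μ then (σ (x, μ) : ℤ) else 0) * g y := by
    intro x y μ
    split_ifs with h
    · simp [gaugeTransform, h]
    · simp
  unfold link
  rw [h, h, h, h]
  ring

theorem hopDet_gaugeTransform (s : ℝ) (g : Site L → ℤˣ) (σ : Config L) :
    hopDet s (gaugeTransform g σ) = hopDet s σ := by
  set G : Matrix (Site L) (Site L) ℂ := Matrix.diagonal fun x => ((g x : ℤ) : ℂ) with hG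
  have hGG : G * G = 1 := by
    rw [hG, Matrix.diagonal_mul_diagonal, ← Matrix.diagonal_one]
    congr 1; ext x; exact_mod_cast units_coe_mul_self (g x)
  have h1 : hop (gaugeTransform g σ) = G * hop σ * G := by
    ext x y
    simp [hG, hop, link_gaugeTransform]
  unfold hopDet
  have h2 : ((s : ℂ) * Complex.I) • (1 : Matrix (Site L) (Site L) ℂ) + hop (gaugeTransform g σ) =
      G * (((s : ℂ) * Complex.I) • (1 : Matrix (Site L) (Site L) ℂ) + hop σ) * G := by
    rw [h1, Matrix.mul_add, Matrix.add_mul, Matrix.mul_smul, Matrix.smul_mul, Matrix.mul_one, hGG]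
  rw [h2, Matrix.det_mul_right_comm, hGG, Matrix.one_mul]

/-- A gauge field without fluxes is a pure gauge. -/
theorem exists_gaugeTransform_eq {σ : Config L} (hL : 2 ≤ L) (h : ∀ x, flux σ x = 1)
    (hA : fluxA σ = 1) (hB : fluxB σ = 1) : ∃ g : Site L → ℤˣ, σ = gaugeTransform g 1 := by
  have : Fact (1 < L) := ⟨hL⟩
  unfold fluxA at hA
  unfold fluxB at hB
  rw [prod_zmod_eq_prod_range] at hA hB
  set p : ℕ → ℤˣ := fun n => ∏ k ∈ Finset.range n, σ (((0 : ZMod L), (k : ZMod L)), 1) with hp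
  set q : ZMod L → ℕ → ℤˣ := fun j n => ∏ k ∈ Finset.range n, σ (((k : ZMod L), j), 0) with hq
  have hflux : ∀ a b : ZMod L, σ ((a, b), 0) * σ ((a, b + 1), 0) =
      σ ((a, b), 1) * σ ((a + 1, b), 1) := by
    intro a b
    have h1 := h (a, b)
    simp only [flux, unitVec_zero, unitVec_one, Prod.mk_add_mk, add_zero] at h1
    revert h1
    generalize σ ((a, b), 0) = u, σ ((a, b + 1), 0) = v, σ ((a, b), 1) = w, σ ((a + 1, b), 1) = z
    revert u v w z
    decide
  have hqq : ∀ (j : ZMod L) (n : ℕ), q j n * q (j + 1) n =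
      σ ((0, j), 1) * σ (((n : ZMod L), j), 1) := by
    intro j n
    induction n with
    | zero => simp [hq, Int.units_mul_self]
    | succ n ih =>
      have e : q j (n + 1) * q (j + 1) (n + 1) =
          (q j n * q (j + 1) n) * (σ (((n : ZMod L), j), 0) * σ (((n : ZMod L), j + 1), 0)) := by
        simp only [hq, Finset.prod_range_succ]; ac_rfl
      rw [e, ih, hflux, mul_assoc, ← mul_assoc (σ (((n : ZMod L), j), 1)), Int.units_mul_self, one_mul]
      push_cast; rfl
  have hqL : ∀ j : ZMod L, q j L = 1 := by
    intro j
    have step : ∀ n : ℕ, q (n : ZMod L) L = 1 := by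
      intro n
      induction n with
      | zero => simpa [hq] using hA
      | succ n ih =>
        have := hqq n L
        rw [ih, one_mul, ZMod.natCast_self, Int.units_mul_self] at this
        push_cast; exact this
    simpa using step j.val
  have hval : ∀ a : ZMod L, (a + 1).val = if a.val + 1 = L then 0 else a.val + 1 := by
    intro a
    have := (zmod_eq_add_one_iff hL a (a + 1)).1 rfl
    have h2 := (a + 1).val_lt
    split_ifs <;> omega
  have hpstep : ∀ b : ZMod L, p b.val * p (b + 1).val = σ ((0, b), 1) := by
    intro b
    have e : p (b.val + 1) = p b.val * σ ((0, b), 1) := by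
      simp only [hp, Finset.prod_range_succ, ZMod.natCast_zmod_val]
    rw [hval]
    split_ifs with hb
    · have : p 0 = p L := by rw [show p L = 1 from hB]; rfl
      rw [hb] at e
      rw [this, e, ← mul_assoc, Int.units_mul_self, one_mul]
    · rw [e, ← mul_assoc, Int.units_mul_self, one_mul]
  have hqstep : ∀ a b : ZMod L, q b a.val * q b (a + 1).val = σ ((a, b), 0) := by
    intro a b
    have e : q b (a.val + 1) = q b a.val * σ ((a, b), 0) := by
      simp only [hq, Finset.prod_range_succ, ZMod.natCast_zmod_val]
    rw [hval]
    split_ifs with hb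
    · have : q b 0 = q b L := by rw [hqL]; rfl
      rw [hb] at e
      rw [this, e, ← mul_assoc, Int.units_mul_self, one_mul]
    · rw [e, ← mul_assoc, Int.units_mul_self, one_mul]
  refine ⟨fun x => p x.2.val * q x.2 x.1.val, ?_⟩
  funext ⟨⟨a, b⟩, μ⟩
  fin_cases μ
  · simp only [gaugeTransform, Fin.zero_eta, unitVec_zero, Prod.mk_add_mk, add_zero, Pi.one_apply,
      mul_one, Fin.isValue]
    rw [mul_mul_mul_comm, Int.units_mul_self, one_mul, hqstep]
  · simp only [gaugeTransform, Fin.mk_one, unitVec_one, Prod.mk_add_mk, add_zero, Pi.one_apply,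
      mul_one, Fin.isValue]
    have := hqq b a.val
    rw [ZMod.natCast_zmod_val] at this
    rw [mul_mul_mul_comm, hpstep, this, ← mul_assoc, Int.units_mul_self, one_mul]

theorem units_mul_eq_one_iff (u v : ℤˣ) : u * v = 1 ↔ u = v := by
  rcases Int.units_eq_one_or u with rfl | rfl <;> rcases Int.units_eq_one_or v with rfl | rfl <;> simp

/-- Gauge fields with the same fluxes are gauge equivalent. -/
theorem exists_gaugeTransform_of_flux_eq (hL : 2 ≤ L) {σ τ : Config L} (h : ∀ x, flux σ x = flux τ x)
    (hA : fluxA σ = fluxA τ) (hB : fluxB σ = fluxB τ) : ∃ g, τ = gaugeTransform g σ := by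
  obtain ⟨g, hg⟩ := exists_gaugeTransform_eq (σ := τ * σ) hL
    (fun x => by rw [flux_mul, h, Int.units_mul_self])
    (by rw [fluxA_mul, hA, Int.units_mul_self]) (by rw [fluxB_mul, hB, Int.units_mul_self])
  refine ⟨g, ?_⟩
  rw [gaugeTransform_eq_mul, ← hg, mul_assoc]
  have : σ * σ = 1 := by ext b; simp
  rw [this, mul_one]

theorem prod_flux (σ : Config L) : ∏ x, flux σ x = 1 := by
  have h0 : ∀ v : Site L, ∏ x, σ (x + v, 0) = ∏ x, σ (x, 0) := fun v =>
    Equiv.prod_comp (Equiv.addRight v) (fun x => σ (x, 0))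
  have h1 : ∀ v : Site L, ∏ x, σ (x + v, 1) = ∏ x, σ (x, 1) := fun v =>
    Equiv.prod_comp (Equiv.addRight v) (fun x => σ (x, 1))
  simp only [flux, Finset.prod_mul_distrib, h0, h1]
  rw [mul_right_comm (∏ x, σ (x, 0)), Int.units_mul_self, one_mul, Int.units_mul_self]

theorem even_monopoles (hL : 4 ∣ L) (σ : Config L) : Even (monopoles σ) := by
  have h := prod_flux σ
  have h1 : ∀ x, flux σ x = -1 * (-1) ^ (if flux σ x ≠ -1 then 1 else 0) := by
    intro x
    rcases Int.units_eq_one_or (flux σ x) with h | h <;> simp [h]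
  rw [Finset.prod_congr rfl fun x _ => h1 x, Finset.prod_mul_distrib, Finset.prod_pow_eq_pow_sum,
    Finset.prod_const, Finset.card_univ, card_site] at h
  have h2 : ((-1 : ℤˣ)) ^ (L ^ 2) = 1 := Even.neg_one_pow (by
    obtain ⟨q, rfl⟩ := hL
    exact ⟨8 * q ^ 2, by ring⟩)
  rw [h2, one_mul] at h
  rcases Nat.even_or_odd (monopoles σ) with h3 | h3
  · exact h3
  · rw [monopoles] at h3
    rw [h3.neg_one_pow] at h
    exact absurd h (by decide)

/-- Vertical bonds with alternating signs, and a twist `a`, `b` of the two circles. -/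
def twistedField (a b : ℤˣ) : Config L := fun p =>
  if p.2 = 0 then (if p.1.1.val + 1 = L then a else 1)
  else (-1) ^ p.1.1.val * (if p.1.2.val + 1 = L then b else 1)

theorem prod_ite_val_eq (b : ℤˣ) : ∏ i : ZMod L, (if i.val + 1 = L then b else 1) = b := by
  have hL := NeZero.pos L
  rw [prod_zmod_eq_prod_range, Finset.prod_eq_single (L - 1)]
  · rw [ZMod.val_natCast_of_lt (by omega), if_pos (by omega)]
  · intro k hk hk'
    rw [Finset.mem_range] at hk
    rw [ZMod.val_natCast_of_lt hk, if_neg (by omega)]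
  · intro h; exact absurd (Finset.mem_range.2 (by omega)) h

theorem neg_one_pow_val_add_one (hL : 4 ∣ L) (a : ZMod L) :
    (-1 : ℤˣ) ^ (a + 1).val = -(-1) ^ a.val := by
  have h2 : 2 ∣ L := Dvd.dvd.trans ⟨2, rfl⟩ hL
  have := even_val_add h2 a 1
  by_cases h : Even a.val
  · have h3 : ¬ Even (a + 1).val := by simp [this, h, not_even_val_one hL]
    rw [(Nat.not_even_iff_odd.1 h3).neg_one_pow, h.neg_one_pow]
  · have h3 : Even (a + 1).val := by simp [this, h, not_even_val_one hL]
    rw [h3.neg_one_pow, (Nat.not_even_iff_odd.1 h).neg_one_pow]; rfl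

theorem isPiFlux_twistedField (hL : 4 ∣ L) (a b : ℤˣ) : IsPiFlux (twistedField a b : Config L) a b := by
  refine ⟨fun x => ?_, ?_, ?_⟩
  · have e0 : ∀ y : Site L, (twistedField a b : Config L) (y, 0) =
      if y.1.val + 1 = L then a else 1 := fun y => rfl
    have e1 : ∀ y : Site L, (twistedField a b : Config L) (y, 1) =
      (-1) ^ y.1.val * (if y.2.val + 1 = L then b else 1) := fun y => rfl
    simp only [flux, e0, e1, unitVec_zero, unitVec_one, Prod.fst_add, Prod.snd_add, add_zero,
      neg_one_pow_val_add_one hL]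
    set u : ℤˣ := if x.1.val + 1 = L then a else 1
    set v : ℤˣ := if x.2.val + 1 = L then b else 1
    set w : ℤˣ := (-1) ^ x.1.val
    rw [neg_mul, mul_neg, neg_mul, neg_mul,
      show u * (w * v) * u * (w * v) = (u * u) * ((w * v) * (w * v)) by ac_rfl,
      Int.units_mul_self, Int.units_mul_self, one_mul]
  · exact prod_ite_val_eq a
  · have : fluxB (twistedField a b : Config L) = ∏ i : ZMod L, (if i.val + 1 = L then b else 1) :=
      Finset.prod_congr rfl fun i _ => by simp [twistedField]
    rw [this, prod_ite_val_eq]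

/-- Every `π`-flux field with antiperiodic fluxes maximizes the determinant. -/
theorem hopDet_le_of_isPiFlux (hL : 4 ∣ L) {σ₀ : Config L} (h₀ : IsPiFlux σ₀ (-1) (-1)) {s : ℝ}
    (hs : s ≠ 0) (τ : Config L) : hopDet s τ ≤ hopDet s σ₀ := by
  obtain ⟨σ, h1, h2⟩ := exists_isPiFlux_forall_hopDet_le hL hs
  have h4 := four_le_of_four_dvd hL
  obtain ⟨g, rfl⟩ := exists_gaugeTransform_of_flux_eq (by omega) (σ := σ) (τ := σ₀)
    (fun x => by rw [h1.1, h₀.1]) (by rw [h1.2.1, h₀.2.1]) (by rw [h1.2.2, h₀.2.2])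
  rw [hopDet_gaugeTransform]
  exact h2 τ

open Classical in
/-- The number of the gauge fields with prescribed fluxes is at most that of a `π`-flux phase. -/
theorem card_flux_le (hL : 4 ∣ L) (φ : Site L → ℤˣ) (a b : ℤˣ) (a' b' : ℤˣ) :
    (Finset.univ.filter fun σ : Config L => (∀ x, flux σ x = φ x) ∧ fluxA σ = a ∧ fluxB σ = b).card ≤
      (Finset.univ.filter fun σ : Config L => IsPiFlux σ a' b').card := by
  rcases Finset.eq_empty_or_nonempty (Finset.univ.filter fun σ : Config L =>
      (∀ x, flux σ x = φ x) ∧ fluxA σ = a ∧ fluxB σ = b) with h | ⟨σ₁, h₁⟩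
  · rw [h]; simp
  · have k1 := (Finset.mem_filter.1 h₁).2
    have k2 := isPiFlux_twistedField (L := L) hL a' b'
    refine Finset.card_le_card_of_injOn (fun σ => σ * (σ₁ * twistedField a' b')) ?_ ?_
    · intro σ hσ
      have k3 := (Finset.mem_filter.1 hσ).2
      refine Finset.mem_coe.2 (Finset.mem_filter.2 ⟨Finset.mem_univ _, fun x => ?_, ?_, ?_⟩)
      · rw [flux_mul, flux_mul, k3.1, k1.1, k2.1, ← mul_assoc, Int.units_mul_self, one_mul]
      · rw [fluxA_mul, fluxA_mul, k3.2.1, k1.2.1, k2.2.1, ← mul_assoc, Int.units_mul_self, one_mul]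
      · rw [fluxB_mul, fluxB_mul, k3.2.2, k1.2.2, k2.2.2, ← mul_assoc, Int.units_mul_self, one_mul]
    · intro σ _ τ _ h
      exact mul_right_cancel h

/-! ### Canonical anticommutation relations -/

/-- The sign `(-1)^{#{y ∈ T : y < x}}` of the Jordan-Wigner transformation. -/
def jwSign (x : Site L) (T : Occ L) : ℂ :=
  (-1) ^ (T.filter fun y => siteIndex y < siteIndex x).card

/-- The exchange sign of two sites. -/
def orderSign (y x : Site L) : ℂ := if siteIndex y < siteIndex x then -1 else 1

theorem siteIndex_injective : Function.Injective (siteIndex (L := L)) := by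
  intro x y h
  unfold siteIndex at h
  have h1 := x.1.val_lt
  have h2 := y.1.val_lt
  have hm := congrArg (· % L) h
  simp only [Nat.add_mul_mod_self_left, Nat.mod_eq_of_lt h1, Nat.mod_eq_of_lt h2] at hm
  rw [hm, add_right_inj] at h
  have h3 := Nat.eq_of_mul_eq_mul_left (NeZero.pos L) h
  exact Prod.ext (ZMod.val_injective L hm) (ZMod.val_injective L h3)

theorem orderSign_self (x : Site L) : orderSign x x = 1 := by simp [orderSign]

theorem orderSign_add_comm {x y : Site L} (h : x ≠ y) : orderSign x y + orderSign y x = 0 := by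
  have : siteIndex x ≠ siteIndex y := fun h' => h (siteIndex_injective h')
  unfold orderSign
  rcases lt_or_gt_of_ne this with h1 | h1
  · rw [if_pos h1, if_neg h1.asymm]; norm_num
  · rw [if_neg h1.asymm, if_pos h1]; norm_num

theorem orderSign_mul_comm {x y : Site L} (h : x ≠ y) : orderSign x y * orderSign y x = -1 := by
  have : siteIndex x ≠ siteIndex y := fun h' => h (siteIndex_injective h')
  unfold orderSign
  rcases lt_or_gt_of_ne this with h1 | h1
  · rw [if_pos h1, if_neg h1.asymm]; norm_num
  · rw [if_neg h1.asymm, if_pos h1]; norm_num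

theorem jwSign_mul_self (x : Site L) (T : Occ L) : jwSign x T * jwSign x T = 1 := by
  rw [jwSign, ← mul_pow]; norm_num

theorem star_jwSign (x : Site L) (T : Occ L) : star (jwSign x T) = jwSign x T := by simp [jwSign]

theorem jwSign_insert (x : Site L) {y : Site L} {T : Occ L} (hy : y ∉ T) :
    jwSign x (insert y T) = orderSign y x * jwSign x T := by
  unfold jwSign orderSign
  rw [Finset.filter_insert]
  split_ifs with h
  · rw [Finset.card_insert_of_notMem (by simp [hy]), pow_succ]; ring
  · rw [one_mul]

theorem jwSign_erase (x : Site L) {y : Site L} {T : Occ L} (hy : y ∈ T) :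
    jwSign x T = orderSign y x * jwSign x (T.erase y) := by
  conv_lhs => rw [← Finset.insert_erase hy]
  exact jwSign_insert x (Finset.notMem_erase y T)

theorem annih_apply (x : Site L) (S T : Occ L) :
    annih x S T = if x ∈ T ∧ S = T.erase x then jwSign x T else 0 := rfl

theorem creat_apply (x : Site L) (S T : Occ L) :
    creat x S T = if x ∉ T ∧ S = insert x T then jwSign x T else 0 := by
  rw [creat, Matrix.conjTranspose_apply, annih_apply]
  by_cases h : x ∉ T ∧ S = insert x T
  · have h' : x ∈ S ∧ T = S.erase x := by
      rw [h.2]; exact ⟨Finset.mem_insert_self _ _, (Finset.erase_insert h.1).symm⟩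
    rw [if_pos h, if_pos h', star_jwSign, h.2, jwSign_insert x h.1, orderSign_self, one_mul]
  · have h' : ¬ (x ∈ S ∧ T = S.erase x) := by
      rintro ⟨h1, rfl⟩
      exact h ⟨Finset.notMem_erase _ _, (Finset.insert_erase h1).symm⟩
    rw [if_neg h, if_neg h', star_zero]

theorem mul_annih_apply (M : FermiOp L) (y : Site L) (S T : Occ L) :
    (M * annih y) S T = if y ∈ T then M S (T.erase y) * jwSign y T else 0 := by
  rw [Matrix.mul_apply]
  simp only [annih_apply, mul_ite, mul_zero]
  split_ifs with h
  · simp [h]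
  · simp [h]

theorem mul_creat_apply (M : FermiOp L) (y : Site L) (S T : Occ L) :
    (M * creat y) S T = if y ∉ T then M S (insert y T) * jwSign y T else 0 := by
  rw [Matrix.mul_apply]
  simp only [creat_apply, mul_ite, mul_zero]
  split_ifs with h
  · simp [h]
  · simp [h]

theorem annih_mul_annih_add (x y : Site L) : annih x * annih y + annih y * annih x = 0 := by
  ext S T
  rw [Matrix.add_apply, mul_annih_apply, mul_annih_apply, annih_apply, annih_apply, Matrix.zero_apply]
  by_cases hxy : x = y
  · subst hxy; simp
  · by_cases hx : x ∈ T <;> by_cases hy : y ∈ T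
    · rw [if_pos hx, if_pos hy, Finset.erase_right_comm (a := x)]
      simp only [Finset.mem_erase, hx, hy, hxy, Ne.symm hxy, ne_eq, not_false_eq_true, and_self,
        true_and]
      split_ifs
      · rw [jwSign_erase y hx, jwSign_erase x hy]
        have := orderSign_add_comm hxy
        linear_combination (jwSign x (T.erase y) * jwSign y (T.erase x)) * this
      · ring
    · simp [hx, hy]
    · simp [hx, hy]
    · simp [hx, hy]

theorem annih_mul_creat_add (x y : Site L) :
    annih x * creat y + creat y * annih x = if x = y then 1 else 0 := by
  ext S T
  rw [Matrix.add_apply, mul_annih_apply, mul_creat_apply, annih_apply, creat_apply]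
  by_cases hxy : x = y
  · subst hxy
    by_cases hx : x ∈ T
    · have e : jwSign x T = jwSign x (T.erase x) := by
        rw [jwSign_erase x hx, orderSign_self, one_mul]
      simp [hx, Matrix.one_apply, ← e, jwSign_mul_self]
    · simp [hx, Matrix.one_apply, jwSign_insert x hx, orderSign_self, jwSign_mul_self]
  · rw [if_neg hxy, Matrix.zero_apply]
    by_cases hx : x ∈ T <;> by_cases hy : y ∈ T
    · simp [hx, hy, Ne.symm hxy]
    · have hc : (insert y T).erase x = insert y (T.erase x) :=
        Finset.erase_insert_of_ne (Ne.symm hxy)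
      have hy' : y ∉ T.erase x := fun h => hy (Finset.mem_of_mem_erase h)
      simp only [hx, hy, hy', hc, Finset.mem_insert, or_true, true_and, not_false_eq_true, if_true]
      split_ifs
      · rw [jwSign_insert x hy, jwSign_erase y hx]
        have := orderSign_mul_comm hxy
        linear_combination (jwSign x T * jwSign y (T.erase x)) * this
      · ring
    · simp [hx, hy]
    · simp [hx, hy, hxy]

theorem sum_creat_mul_annih : ∑ x : Site L, creat x * annih x =
    Matrix.diagonal fun S : Occ L => (S.card : ℂ) := by
  ext S T
  rw [Matrix.sum_apply, Matrix.diagonal_apply]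
  have h : ∀ x : Site L, (creat x * annih x) S T = if x ∈ T then (if S = T then 1 else 0) else 0 := by
    intro x
    rw [mul_annih_apply, creat_apply]
    split_ifs with h1 h2 h3 h3
    · rw [← jwSign_mul_self x T]
      congr 1
      rw [jwSign_erase x h1, orderSign_self, one_mul]
    · exact absurd (h2.2.trans (Finset.insert_erase h1)) h3
    · exact absurd ⟨Finset.notMem_erase _ _, h3.trans (Finset.insert_erase h1).symm⟩ h2
    · ring
    · rfl
  simp only [h]
  split_ifs with h1
  · subst h1; simp
  · simp

/-! ### Exponentials of quadratic operators -/

section Exp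
variable {n : Type*} [Fintype n] [DecidableEq n]

theorem exp_smul_hermitian {H U : Matrix n n ℂ} {d : n → ℂ}
    (hU : U * U.conjTranspose = 1) (hs : H = U * Matrix.diagonal d * U.conjTranspose) (c : ℂ) :
    NormedSpace.exp (c • H) =
      U * Matrix.diagonal (fun i => Complex.exp (c * d i)) * U.conjTranspose := by
  have hinv : U⁻¹ = U.conjTranspose := Matrix.inv_eq_right_inv hU
  have h1 : c • H = U * Matrix.diagonal (fun i => c * d i) * U⁻¹ := by
    rw [hs, hinv, ← Matrix.smul_mul, ← Matrix.mul_smul, ← Matrix.diagonal_smul]; rfl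
  rw [h1, Matrix.exp_conj _ _ (IsUnit.of_mul_eq_one _ hU), Matrix.exp_diagonal, hinv]
  congr 3
  ext i
  rw [Pi.coe_exp, Complex.exp_eq_exp_ℂ]

theorem exp_smul_of_idempotent {P : Matrix n n ℂ} (hP : P.IsHermitian) (hPP : P * P = P) (c : ℂ) :
    NormedSpace.exp (c • P) = 1 + (Complex.exp c - 1) • P := by
  obtain ⟨U, hU', hU, hs⟩ := exists_unitary_diagonalization hP
  set d : n → ℂ := fun i => ((hP.eigenvalues i : ℝ) : ℂ) with hd
  have h1 : Matrix.diagonal d = U.conjTranspose * P * U := by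
    rw [hs, Matrix.mul_assoc, Matrix.mul_assoc (U * _), hU', Matrix.mul_one, ← Matrix.mul_assoc, hU',
      Matrix.one_mul]
  have h2 : ∀ i, d i * d i = d i := by
    have : Matrix.diagonal d * Matrix.diagonal d = Matrix.diagonal d := by
      conv_lhs => rw [h1]
      calc _ = U.conjTranspose * P * (U * U.conjTranspose) * P * U := by simp only [Matrix.mul_assoc]
        _ = U.conjTranspose * (P * P) * U := by rw [hU, Matrix.mul_one]; simp only [Matrix.mul_assoc]
        _ = _ := by rw [hPP, h1]
    rw [Matrix.diagonal_mul_diagonal] at this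
    exact fun i => congrFun (Matrix.diagonal_injective this) i
  rw [exp_smul_hermitian hU hs]
  have h3 : (1 : Matrix n n ℂ) + (Complex.exp c - 1) • P =
      U * (1 + (Complex.exp c - 1) • Matrix.diagonal d) * U.conjTranspose := by
    rw [Matrix.mul_add, Matrix.add_mul, Matrix.mul_one, hU, Matrix.mul_smul, Matrix.smul_mul, ← hs]
  rw [h3, ← Matrix.diagonal_one, ← Matrix.diagonal_smul, Matrix.diagonal_add]
  congr 3
  ext i
  have h4 : d i = 0 ∨ d i = 1 := by
    have := h2 i
    have h5 : d i * (d i - 1) = 0 := by linear_combination this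
    rcases mul_eq_zero.1 h5 with h | h
    · exact Or.inl h
    · exact Or.inr (by linear_combination h)
  rcases h4 with h | h <;> simp [h]

/-- Fermionic modes: operators that satisfy the canonical anticommutation relations. -/
structure IsModes {ι : Type*} [DecidableEq ι] (B : ι → Matrix n n ℂ) : Prop where
  anticomm : ∀ j k, B j * B k + B k * B j = 0
  anticomm_star : ∀ j k, B j * (B k).conjTranspose + (B k).conjTranspose * B j = if j = k then 1 else 0

namespace IsModes
variable {ι : Type*} [DecidableEq ι] {B : ι → Matrix n n ℂ} (hB : IsModes B)
include hB

theorem sq_eq_zero (j : ι) : B j * B j = 0 := by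
  have h : (2 : ℂ) • (B j * B j) = 0 := by rw [two_smul]; exact hB.anticomm j j
  exact (smul_eq_zero.1 h).resolve_left two_ne_zero

theorem anticomm_star_star (j k : ι) :
    (B j).conjTranspose * (B k).conjTranspose + (B k).conjTranspose * (B j).conjTranspose = 0 := by
  have := congrArg Matrix.conjTranspose (hB.anticomm k j)
  simpa [Matrix.conjTranspose_mul] using this

theorem star_sq_eq_zero (j : ι) : (B j).conjTranspose * (B j).conjTranspose = 0 := by
  rw [← Matrix.conjTranspose_mul, hB.sq_eq_zero, Matrix.conjTranspose_zero]

theorem mul_star (j : ι) : B j * (B j).conjTranspose = 1 - (B j).conjTranspose * B j := by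
  have := hB.anticomm_star j j
  rw [if_pos rfl] at this
  exact eq_sub_of_add_eq this

theorem number_mul_self (j : ι) :
    ((B j).conjTranspose * B j) * ((B j).conjTranspose * B j) = (B j).conjTranspose * B j := by
  calc _ = (B j).conjTranspose * (B j * (B j).conjTranspose) * B j := by simp only [Matrix.mul_assoc]
    _ = (B j).conjTranspose * B j - (B j).conjTranspose * ((B j).conjTranspose * (B j * B j)) := by
      rw [hB.mul_star, Matrix.mul_sub, Matrix.sub_mul, Matrix.mul_one]; simp only [Matrix.mul_assoc]
    _ = _ := by rw [hB.sq_eq_zero]; simp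

/-- `b_j + b_j^*`. -/
theorem flip_mul_self (j : ι) :
    (B j + (B j).conjTranspose) * (B j + (B j).conjTranspose) = 1 := by
  rw [Matrix.add_mul, Matrix.mul_add, Matrix.mul_add, hB.sq_eq_zero, hB.star_sq_eq_zero, hB.mul_star]
  abel

theorem flip_number (j : ι) :
    (B j + (B j).conjTranspose) * ((B j).conjTranspose * B j) * (B j + (B j).conjTranspose) =
      1 - (B j).conjTranspose * B j := by
  have h1 : (B j + (B j).conjTranspose) * ((B j).conjTranspose * B j) = B j := by
    rw [Matrix.add_mul, ← Matrix.mul_assoc, ← Matrix.mul_assoc, hB.star_sq_eq_zero, hB.mul_star,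
      Matrix.sub_mul, Matrix.mul_assoc, hB.sq_eq_zero]
    simp
  rw [h1, Matrix.mul_add, hB.sq_eq_zero, hB.mul_star, zero_add]

theorem commute_number {j k : ι} (h : j ≠ k) :
    Commute (B j + (B j).conjTranspose) ((B k).conjTranspose * B k) := by
  have e1 : B j * (B k).conjTranspose = -((B k).conjTranspose * B j) := by
    have := hB.anticomm_star j k; rw [if_neg h] at this; exact eq_neg_of_add_eq_zero_left this
  have e2 : B j * B k = -(B k * B j) := eq_neg_of_add_eq_zero_left (hB.anticomm j k)
  have e3 : (B j).conjTranspose * (B k).conjTranspose = -((B k).conjTranspose * (B j).conjTranspose) :=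
    eq_neg_of_add_eq_zero_left (hB.anticomm_star_star j k)
  have e4 : (B j).conjTranspose * B k = -(B k * (B j).conjTranspose) := by
    have := hB.anticomm_star k j; rw [if_neg h.symm, add_comm] at this
    exact eq_neg_of_add_eq_zero_left this
  unfold Commute SemiconjBy
  rw [Matrix.add_mul, Matrix.mul_add]
  congr 1
  · rw [← Matrix.mul_assoc, e1, Matrix.neg_mul, Matrix.mul_assoc, e2, Matrix.mul_neg, neg_neg,
      Matrix.mul_assoc]
  · rw [← Matrix.mul_assoc, e3, Matrix.neg_mul, Matrix.mul_assoc, e4, Matrix.mul_neg, neg_neg,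
      Matrix.mul_assoc]

theorem commute_number_number (j k : ι) :
    Commute ((B j).conjTranspose * B j) ((B k).conjTranspose * B k) := by
  by_cases h : j = k
  · subst h; exact Commute.refl _
  · have e1 : B j * (B k).conjTranspose = -((B k).conjTranspose * B j) := by
      have := hB.anticomm_star j k; rw [if_neg h] at this; exact eq_neg_of_add_eq_zero_left this
    have e2 : B j * B k = -(B k * B j) := eq_neg_of_add_eq_zero_left (hB.anticomm j k)
    have e3 : (B j).conjTranspose * (B k).conjTranspose =
        -((B k).conjTranspose * (B j).conjTranspose) :=
      eq_neg_of_add_eq_zero_left (hB.anticomm_star_star j k)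
    have e4 : (B j).conjTranspose * B k = -(B k * (B j).conjTranspose) := by
      have := hB.anticomm_star k j; rw [if_neg (Ne.symm h), add_comm] at this
      exact eq_neg_of_add_eq_zero_left this
    have c1 : B j * ((B k).conjTranspose * B k) = (B k).conjTranspose * B k * B j := by
      rw [← Matrix.mul_assoc, e1, Matrix.neg_mul, Matrix.mul_assoc, e2, Matrix.mul_neg, neg_neg,
        Matrix.mul_assoc]
    have c2 : (B j).conjTranspose * ((B k).conjTranspose * B k) =
        (B k).conjTranspose * B k * (B j).conjTranspose := by
      rw [← Matrix.mul_assoc, e3, Matrix.neg_mul, Matrix.mul_assoc, e4, Matrix.mul_neg, neg_neg,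
        Matrix.mul_assoc]
    unfold Commute SemiconjBy
    rw [Matrix.mul_assoc, c1, ← Matrix.mul_assoc, c2, Matrix.mul_assoc]

theorem trace_number_mul (j : ι) {X : Matrix n n ℂ} (hX : Commute (B j + (B j).conjTranspose) X) :
    (((B j).conjTranspose * B j) * X).trace = X.trace / 2 := by
  set W := B j + (B j).conjTranspose with hW
  set N := (B j).conjTranspose * B j with hN
  have hWW : W * W = 1 := hB.flip_mul_self j
  have h1 : (N * X).trace = ((1 - N) * X).trace := by
    rw [← hB.flip_number j, ← hW, ← hN]
    calc (N * X).trace = (N * X * (W * W)).trace := by rw [hWW, Matrix.mul_one]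
      _ = (W * (N * X * W)).trace := by rw [← Matrix.mul_assoc, Matrix.trace_mul_comm]
      _ = _ := by
        congr 1
        rw [Matrix.mul_assoc N, ← hX.eq]
        simp only [Matrix.mul_assoc]
  rw [Matrix.sub_mul, Matrix.one_mul, Matrix.trace_sub] at h1
  linear_combination h1 / 2

theorem trace_exp_sum (c : ι → ℂ) (A : Finset ι) :
    (NormedSpace.exp (∑ j ∈ A, c j • ((B j).conjTranspose * B j))).trace =
      (∏ j ∈ A, ((1 + Complex.exp (c j)) / 2)) * Fintype.card n := by
  induction A using Finset.induction_on with
  | empty => simp [NormedSpace.exp_zero]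
  | insert j A hj ih =>
    set X := ∑ j ∈ A, c j • ((B j).conjTranspose * B j) with hX
    have hc : Commute (c j • ((B j).conjTranspose * B j)) X :=
      Commute.sum_right _ _ _ fun k _ => ((hB.commute_number_number j k).smul_left _).smul_right _
    have hc2 : Commute (B j + (B j).conjTranspose) X :=
      Commute.sum_right _ _ _ fun k hk =>
        (hB.commute_number (by rintro rfl; exact hj hk)).smul_right _
    have hc3 : Commute (B j + (B j).conjTranspose) (NormedSpace.exp X) := by
      have hWW := hB.flip_mul_self j
      have hinv : (B j + (B j).conjTranspose)⁻¹ = B j + (B j).conjTranspose :=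
        Matrix.inv_eq_right_inv hWW
      have h1 := Matrix.exp_conj (B j + (B j).conjTranspose) X (IsUnit.of_mul_eq_one _ hWW)
      rw [hinv, hc2.eq, Matrix.mul_assoc, hWW, Matrix.mul_one] at h1
      unfold Commute SemiconjBy
      conv_rhs => rw [h1, Matrix.mul_assoc, hWW, Matrix.mul_one]
    rw [Finset.sum_insert hj, Matrix.exp_add_of_commute _ _ hc,
      exp_smul_of_idempotent (Matrix.isHermitian_conjTranspose_mul_self _) (hB.number_mul_self j),
      Matrix.add_mul, Matrix.one_mul, Matrix.trace_add, Matrix.smul_mul, Matrix.trace_smul,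
      hB.trace_number_mul j hc3, ih, Finset.prod_insert hj, smul_eq_mul]
    ring

end IsModes
end Exp

theorem isModes_annih : IsModes (annih : Site L → FermiOp L) :=
  ⟨annih_mul_annih_add, annih_mul_creat_add⟩

section Bogoliubov
variable {n ι : Type*} [Fintype n] [DecidableEq n] [Fintype ι] [DecidableEq ι]

/-- The modes `b_j = ∑_x conj (U x j) a_x`. -/
def rotateModes (a : ι → Matrix n n ℂ) (U : Matrix ι ι ℂ) (j : ι) : Matrix n n ℂ :=
  ∑ x, star (U x j) • a x

theorem conjTranspose_rotateModes (a : ι → Matrix n n ℂ) (U : Matrix ι ι ℂ) (j : ι) :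
    (rotateModes a U j).conjTranspose = ∑ x, U x j • (a x).conjTranspose := by
  simp [rotateModes, Matrix.conjTranspose_sum, Matrix.conjTranspose_smul]

theorem sum_smul_mul_sum_smul (f g : ι → ℂ) (A B : ι → Matrix n n ℂ) :
    (∑ x, f x • A x) * (∑ y, g y • B y) = ∑ x, ∑ y, (f x * g y) • (A x * B y) := by
  rw [Finset.sum_mul]
  refine Finset.sum_congr rfl fun x _ => ?_
  rw [Finset.mul_sum]
  exact Finset.sum_congr rfl fun y _ => by rw [Matrix.smul_mul, Matrix.mul_smul, smul_smul]

theorem sum_smul_anticomm (f g : ι → ℂ) (A B : ι → Matrix n n ℂ) :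
    (∑ x, f x • A x) * (∑ y, g y • B y) + (∑ y, g y • B y) * (∑ x, f x • A x) =
      ∑ x, ∑ y, (f x * g y) • (A x * B y + B y * A x) := by
  rw [sum_smul_mul_sum_smul, sum_smul_mul_sum_smul, Finset.sum_comm (f := fun x y => (g x * f y) • _),
    ← Finset.sum_add_distrib]
  refine Finset.sum_congr rfl fun x _ => ?_
  rw [← Finset.sum_add_distrib]
  exact Finset.sum_congr rfl fun y _ => by rw [smul_add, mul_comm (g y)]

theorem IsModes.rotate {a : ι → Matrix n n ℂ} (ha : IsModes a) {U : Matrix ι ι ℂ}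
    (hU : U.conjTranspose * U = 1) : IsModes (rotateModes a U) := by
  constructor
  · intro j k
    unfold rotateModes
    rw [sum_smul_anticomm]
    simp [ha.anticomm]
  · intro j k
    rw [conjTranspose_rotateModes, rotateModes, sum_smul_anticomm]
    simp only [ha.anticomm_star, smul_ite, smul_zero, Finset.sum_ite_eq, Finset.mem_univ, if_true]
    rw [← Finset.sum_smul]
    have h := congrFun (congrFun hU j) k
    rw [Matrix.mul_apply, Matrix.one_apply] at h
    simp only [Matrix.conjTranspose_apply] at h
    rw [h]
    split_ifs <;> simp

theorem sum_smul_rotateModes (a : ι → Matrix n n ℂ) (U : Matrix ι ι ℂ) (d : ι → ℂ) :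
    ∑ j, d j • ((rotateModes a U j).conjTranspose * rotateModes a U j) =
      ∑ x, ∑ y, (U * Matrix.diagonal d * U.conjTranspose) x y • ((a x).conjTranspose * a y) := by
  have h : ∀ j, d j • ((rotateModes a U j).conjTranspose * rotateModes a U j) =
      ∑ x, ∑ y, (d j * (U x j * star (U y j))) • ((a x).conjTranspose * a y) := by
    intro j
    rw [conjTranspose_rotateModes, rotateModes, sum_smul_mul_sum_smul, Finset.smul_sum]
    simp only [Finset.smul_sum, smul_smul]
  simp only [h]
  rw [Finset.sum_comm]
  refine Finset.sum_congr rfl fun x _ => ?_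
  rw [Finset.sum_comm]
  refine Finset.sum_congr rfl fun y _ => ?_
  rw [← Finset.sum_smul, Matrix.mul_apply]
  congr 1
  refine Finset.sum_congr rfl fun j _ => ?_
  rw [Matrix.mul_diagonal, Matrix.conjTranspose_apply]
  ring

end Bogoliubov

/-! ### Free fermions -/

theorem sum_link_smul {M : Type*} [AddCommGroup M] [Module ℂ M] (σ : Config L) (x : Site L)
    (f : Site L → M) : ∑ z, (link σ x z : ℂ) • f z =
    (((σ (x, 0) : ℤ) : ℂ) • f (x + unitVec L 0) +
      ((σ (x - unitVec L 0, 0) : ℤ) : ℂ) • f (x - unitVec L 0)) +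
      (((σ (x, 1) : ℤ) : ℂ) • f (x + unitVec L 1) +
        ((σ (x - unitVec L 1, 1) : ℤ) : ℂ) • f (x - unitVec L 1)) := by
  simp only [link_eq, Int.cast_add, Int.cast_ite, Int.cast_zero, add_smul, Finset.sum_add_distrib,
    ite_smul, zero_smul, Finset.sum_ite_eq', Finset.mem_univ, if_true]

theorem fermiHam_eq_sum_link (t : ℝ) (σ : Config L) :
    fermiHam t σ = -((t : ℂ) • ∑ x, ∑ y, hop σ x y • (creat x * annih y)) := by
  unfold fermiHam
  congr 2
  have hh : ∀ x y, hop σ x y = (link σ x y : ℂ) := fun x y => rfl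
  simp only [hh, sum_link_smul]
  have hs : ∀ μ : Fin 2, ∑ x : Site L, ((σ (x - unitVec L μ, μ) : ℤ) : ℂ) •
      (creat x * annih (x - unitVec L μ)) =
      ∑ x : Site L, ((σ (x, μ) : ℤ) : ℂ) • (creat x * annih (x + unitVec L μ)).conjTranspose := by
    intro μ
    refine Fintype.sum_equiv (Equiv.subRight (unitVec L μ)) _ _ fun x => ?_
    simp [Matrix.conjTranspose_mul, creat]
  simp only [Finset.sum_add_distrib, hs, Fin.sum_univ_two, smul_add]
  exact add_add_add_comm _ _ _ _

theorem fermiHam_isHermitian (t : ℝ) (σ : Config L) : (fermiHam t σ).IsHermitian := by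
  unfold Matrix.IsHermitian fermiHam
  simp only [Matrix.conjTranspose_neg, Matrix.conjTranspose_smul, Matrix.conjTranspose_sum,
    Matrix.conjTranspose_add, Matrix.conjTranspose_conjTranspose, star_intCast, Complex.star_def,
    Complex.conj_ofReal]
  congr 2
  exact Finset.sum_congr rfl fun x _ => Finset.sum_congr rfl fun μ _ => by rw [add_comm]

theorem exists_modes_fermiHam (σ : Config L) : ∃ B : Site L → FermiOp L, IsModes B ∧
    (∀ t : ℝ, fermiHam t σ =
      ∑ j, (-(t * hopEig σ j) : ℂ) • ((B j).conjTranspose * B j)) ∧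
    ∑ x : Site L, creat x * annih x = ∑ j, (B j).conjTranspose * B j := by
  obtain ⟨U, hU', hU, hs⟩ := exists_unitary_diagonalization (hop_isHermitian σ)
  refine ⟨rotateModes annih U, isModes_annih.rotate hU', fun t => ?_, ?_⟩
  · have h := sum_smul_rotateModes annih U (fun i => (((hop_isHermitian σ).eigenvalues i : ℝ) : ℂ))
    rw [← hs] at h
    rw [fermiHam_eq_sum_link]
    change _ = _ at h
    rw [show (∑ x, ∑ y, hop σ x y • (creat x * annih y)) = _ from h.symm, Finset.smul_sum,
      ← Finset.sum_neg_distrib]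
    refine Finset.sum_congr rfl fun j _ => ?_
    rw [smul_smul, ← neg_smul]
    rfl
  · have h := sum_smul_rotateModes annih U (fun _ => 1)
    simp only [one_smul] at h
    rw [h, Matrix.diagonal_one, Matrix.mul_one, hU]
    refine Finset.sum_congr rfl fun x _ => ?_
    simp [Matrix.one_apply, creat]

theorem parity_eq_exp : parity L =
    NormedSpace.exp (((Real.pi : ℂ) * Complex.I) • ∑ x : Site L, creat x * annih x) := by
  rw [sum_creat_mul_annih, ← Matrix.diagonal_smul, Matrix.exp_diagonal, parity]
  congr 1
  ext S
  rw [Pi.coe_exp, ← Complex.exp_eq_exp_ℂ, Pi.smul_apply, smul_eq_mul, mul_comm, Complex.exp_nat_mul,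
    Complex.exp_pi_mul_I]

theorem card_occ : (Fintype.card (Occ L) : ℂ) = ∏ _x : Site L, 2 := by
  rw [Fintype.card_finset]
  simp

theorem trace_exp_fermiHam (t β : ℝ) (σ : Config L) :
    (NormedSpace.exp (((-β : ℝ) : ℂ) • fermiHam t σ)).trace =
      ((∏ x, (1 + Real.exp (β * t * hopEig σ x)) : ℝ) : ℂ) := by
  obtain ⟨B, hB, hH, -⟩ := exists_modes_fermiHam σ
  rw [hH, Finset.smul_sum]
  simp only [smul_smul]
  rw [hB.trace_exp_sum, card_occ, ← Finset.prod_mul_distrib]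
  push_cast
  refine Finset.prod_congr rfl fun x _ => ?_
  rw [show (-(β : ℂ) * -(t * hopEig σ x)) = β * t * hopEig σ x by ring]
  ring

theorem trace_parity_mul_exp_fermiHam (t β : ℝ) (σ : Config L) :
    (parity L * NormedSpace.exp (((-β : ℝ) : ℂ) • fermiHam t σ)).trace =
      ((∏ x, (1 - Real.exp (β * t * hopEig σ x)) : ℝ) : ℂ) := by
  obtain ⟨B, hB, hH, hN⟩ := exists_modes_fermiHam σ
  have hcomm : ∀ c d : Site L → ℂ, Commute (∑ j, c j • ((B j).conjTranspose * B j))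
      (∑ j, d j • ((B j).conjTranspose * B j)) := fun c d =>
    Commute.sum_left _ _ _ fun j _ => Commute.sum_right _ _ _ fun k _ =>
      ((hB.commute_number_number j k).smul_left _).smul_right _
  rw [hH, parity_eq_exp, hN, Finset.smul_sum, Finset.smul_sum]
  simp only [smul_smul]
  rw [← Matrix.exp_add_of_commute _ _ (hcomm _ _), ← Finset.sum_add_distrib]
  simp only [← add_smul]
  rw [hB.trace_exp_sum, card_occ, ← Finset.prod_mul_distrib]
  push_cast
  refine Finset.prod_congr rfl fun x _ => ?_
  rw [show ((Real.pi : ℂ) * Complex.I + -(β : ℂ) * -(t * hopEig σ x)) =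
    Real.pi * Complex.I + β * t * hopEig σ x by ring, Complex.exp_add, Complex.exp_pi_mul_I]
  ring

theorem commute_parity_exp_fermiHam (t : ℝ) (c : ℂ) (σ : Config L) :
    Commute (parity L) (NormedSpace.exp (c • fermiHam t σ)) := by
  obtain ⟨B, hB, hH, hN⟩ := exists_modes_fermiHam σ
  have hcomm : ∀ c d : Site L → ℂ, Commute (∑ j, c j • ((B j).conjTranspose * B j))
      (∑ j, d j • ((B j).conjTranspose * B j)) := fun c d =>
    Commute.sum_left _ _ _ fun j _ => Commute.sum_right _ _ _ fun k _ =>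
      ((hB.commute_number_number j k).smul_left _).smul_right _
  rw [hH, parity_eq_exp, hN, Finset.smul_sum, Finset.smul_sum]
  simp only [smul_smul]
  unfold Commute SemiconjBy
  rw [← Matrix.exp_add_of_commute _ _ (hcomm _ _), ← Matrix.exp_add_of_commute _ _ (hcomm _ _),
    add_comm]

/-! ### The sign of the hopping determinant -/

theorem det_nonneg_of_antisymm {n : Type*} [Fintype n] [DecidableEq n] {A : Matrix n n ℝ}
    (hA : A.transpose = -A) : 0 ≤ A.det := by
  have hne : ∀ u : ℝ, (1 + u • A).det ≠ 0 := by
    intro u h0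
    obtain ⟨v, hv, h⟩ := Matrix.exists_mulVec_eq_zero_iff.2 h0
    have h1 : v ⬝ᵥ A.mulVec v = 0 := by
      have e : v ⬝ᵥ A.mulVec v = -(v ⬝ᵥ A.mulVec v) := by
        conv_lhs => rw [Matrix.dotProduct_mulVec, ← Matrix.mulVec_transpose, hA, Matrix.neg_mulVec,
          neg_dotProduct, dotProduct_comm]
      linarith
    have h2 := congrArg (v ⬝ᵥ ·) h
    simp only [Matrix.add_mulVec, Matrix.one_mulVec, Matrix.smul_mulVec, dotProduct_add,
      dotProduct_smul, h1, smul_zero, add_zero, dotProduct_zero] at h2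
    exact hv (dotProduct_self_eq_zero.1 h2)
  have hc : Continuous fun u : ℝ => (1 + u • A).det := by fun_prop
  have hpos : ∀ u : ℝ, 0 < (1 + u • A).det := by
    intro u
    by_contra hle
    push Not at hle
    obtain ⟨w, -, hw⟩ := mem_range_of_exists_le_of_exists_ge hc ⟨u, hle⟩ ⟨0, by simp⟩ |>.imp
      fun w hw => And.intro trivial hw
    exact hne w hw
  have hc2 : Continuous fun s : ℝ => (s • (1 : Matrix n n ℝ) + A).det := by fun_prop
  have hpos2 : ∀ s : ℝ, 0 < s → 0 ≤ (s • (1 : Matrix n n ℝ) + A).det := by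
    intro s hs
    have : s • (1 : Matrix n n ℝ) + A = s • (1 + s⁻¹ • A) := by
      rw [smul_add, smul_smul, mul_inv_cancel₀ hs.ne', one_smul]
    rw [this, Matrix.det_smul]
    exact mul_nonneg (pow_nonneg hs.le _) (hpos _).le
  have ht : Tendsto (fun s : ℝ => (s • (1 : Matrix n n ℝ) + A).det) (𝓝[>] 0) (𝓝 A.det) := by
    have := (hc2.tendsto 0).mono_left (nhdsWithin_le_nhds (s := Set.Ioi 0))
    simpa using this
  exact ge_of_tendsto ht (eventually_nhdsWithin_of_forall hpos2)

theorem det_hop_nonneg (hL : 4 ∣ L) (σ : Config L) : 0 ≤ (hop σ).det.re := by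
  set ε : Site L → ℝ := fun x => (((-1 : ℤˣ) ^ x.1.val * (-1) ^ x.2.val : ℤˣ) : ℝ) with hε
  set h : Matrix (Site L) (Site L) ℝ := Matrix.of fun x y => (link σ x y : ℝ) with hh
  have hstep : ∀ (x : Site L) (μ : Fin 2), ε (x + unitVec L μ) = -ε x := by
    intro x μ
    have h1 : ∀ a : ZMod L, (((-1 : ℤˣ) ^ (a + 1).val : ℤˣ) : ℝ) = -(((-1 : ℤˣ) ^ a.val : ℤˣ) : ℝ) :=
      fun a => by rw [neg_one_pow_val_add_one hL]; simp
    simp only [Units.val_mul, Int.cast_mul, hε]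
    fin_cases μ
    · simp only [Fin.zero_eta, unitVec_zero, Prod.fst_add, Prod.snd_add, add_zero, h1]; ring
    · simp only [Fin.mk_one, unitVec_one, Prod.fst_add, Prod.snd_add, add_zero, h1]; ring
  have hstep' : ∀ (x : Site L) (μ : Fin 2), ε (x - unitVec L μ) = -ε x := by
    intro x μ
    rw [← neg_eq_iff_eq_neg, ← hstep, sub_add_cancel]
  have hanti : ∀ x y, ε y * (link σ x y : ℝ) = -(ε x * link σ x y) := by
    intro x y
    by_cases hy : link σ x y = 0
    · simp [hy]
    · have : ε y = -ε x := by
        by_contra hne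
        apply hy
        rw [link_eq, if_neg, if_neg, if_neg, if_neg]
        · rfl
        · rintro rfl; exact hne (hstep' x 1)
        · rintro rfl; exact hne (hstep x 1)
        · rintro rfl; exact hne (hstep' x 0)
        · rintro rfl; exact hne (hstep x 0)
      rw [this]; ring
  have h1 : (Matrix.diagonal ε * h).transpose = -(Matrix.diagonal ε * h) := by
    ext x y
    rw [Matrix.transpose_apply, Matrix.neg_apply, Matrix.diagonal_mul, Matrix.diagonal_mul]
    simp only [hh, Matrix.of_apply]
    rw [link_comm, hanti]
  have h2 := det_nonneg_of_antisymm h1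
  have hL2 : Even L := (even_iff_two_dvd.2 (Dvd.dvd.trans ⟨2, rfl⟩ hL))
  have h3 : ∏ x, ε x = 1 := by
    have : ∏ x : Site L, ((-1 : ℤˣ) ^ x.1.val * (-1) ^ x.2.val) = 1 := by
      rw [Fintype.prod_prod_type]
      simp only [Finset.prod_mul_distrib, Finset.prod_const, Finset.card_univ, ZMod.card]
      rw [Finset.prod_pow]
      have e : ∀ u : ℤˣ, u ^ L = 1 := fun u => by
        obtain ⟨k, hk⟩ := hL2
        rw [hk, ← two_mul, pow_mul, Int.units_sq, one_pow]
      simp [e]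
    have h4 := congrArg (fun u : ℤˣ => ((u : ℤ) : ℝ)) this
    simpa [hε] using h4
  rw [Matrix.det_mul, Matrix.det_diagonal, h3, one_mul] at h2
  have h5 : hop σ = h.map (Complex.ofRealHom) := by
    ext x y; simp [hop, hh]
  rw [h5, ← RingHom.mapMatrix_apply, ← RingHom.map_det]
  simpa using h2

/-! ### Traces over the Fock space in terms of the hopping spectrum -/

theorem sum_hopEig (hL : 4 ∣ L) (σ : Config L) : ∑ x, hopEig σ x = 0 := by
  have h := trace_pow_eq_sum (hop_isHermitian σ) 1
  have h4 := four_le_of_four_dvd hL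
  have h0 : (hop σ ^ 1).trace = 0 := by
    rw [pow_one, Matrix.trace]
    refine Finset.sum_eq_zero fun x _ => ?_
    have : link σ x x = 0 := by
      have : Fact (1 < L) := ⟨by omega⟩
      rw [link_eq]
      simp [unitVec, Prod.ext_iff, eq_sub_iff_add_eq]
    simp [hop, this]
  rw [h0] at h
  simp only [pow_one] at h
  have : ((∑ x, hopEig σ x : ℝ) : ℂ) = 0 := by rw [h]; simp [hopEig]
  exact_mod_cast this

/-- `Tr e^{-βH_f}` at `c = β t`. -/
def coshProd (c : ℝ) (σ : Config L) : ℝ := ∏ x, (2 * Real.cosh (c * hopEig σ x / 2))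

/-- `Tr (-1)^N e^{-βH_f}` at `c = β t`. -/
def sinhProd (c : ℝ) (σ : Config L) : ℝ := ∏ x, (2 * Real.sinh (c * hopEig σ x / 2))

theorem prod_exp_half_hopEig (hL : 4 ∣ L) (c : ℝ) (σ : Config L) :
    ∏ x, Real.exp (c * hopEig σ x / 2) = 1 := by
  rw [← Real.exp_sum, ← Finset.sum_div, ← Finset.mul_sum, sum_hopEig hL]
  simp

theorem even_card_site (hL : 4 ∣ L) : Even (Fintype.card (Site L)) := by
  rw [card_site]
  exact (even_iff_two_dvd.2 (Dvd.dvd.trans ⟨2, rfl⟩ hL)).pow_of_ne_zero two_ne_zero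

theorem prod_one_add_exp (hL : 4 ∣ L) (c : ℝ) (σ : Config L) :
    ∏ x, (1 + Real.exp (c * hopEig σ x)) = coshProd c σ := by
  rw [(mul_one (coshProd c σ)).symm.trans (congrArg _ (prod_exp_half_hopEig hL c σ).symm), coshProd, ← Finset.prod_mul_distrib]
  refine Finset.prod_congr rfl fun x _ => ?_
  have e : Real.exp (c * hopEig σ x) =
      Real.exp (c * hopEig σ x / 2) * Real.exp (c * hopEig σ x / 2) := by
    rw [← Real.exp_add]; ring_nf
  have e2 : Real.exp (-(c * hopEig σ x / 2)) * Real.exp (c * hopEig σ x / 2) = 1 := by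
    rw [← Real.exp_add]; simp
  rw [Real.cosh_eq, e]
  linear_combination -e2

theorem prod_one_sub_exp (hL : 4 ∣ L) (c : ℝ) (σ : Config L) :
    ∏ x, (1 - Real.exp (c * hopEig σ x)) = sinhProd c σ := by
  have h1 : sinhProd c σ = ∏ x, (-(2 * Real.sinh (c * hopEig σ x / 2))) := by
    rw [Finset.prod_neg, Finset.card_univ, (even_card_site hL).neg_one_pow, one_mul]; rfl
  rw [h1, (mul_one (∏ x, -(2 * Real.sinh (c * hopEig σ x / 2)))).symm.trans
    (congrArg _ (prod_exp_half_hopEig hL c σ).symm),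
    ← Finset.prod_mul_distrib]
  refine Finset.prod_congr rfl fun x _ => ?_
  have e : Real.exp (c * hopEig σ x) =
      Real.exp (c * hopEig σ x / 2) * Real.exp (c * hopEig σ x / 2) := by
    rw [← Real.exp_add]; ring_nf
  have e2 : Real.exp (-(c * hopEig σ x / 2)) * Real.exp (c * hopEig σ x / 2) = 1 := by
    rw [← Real.exp_add]; simp
  rw [Real.sinh_eq, e]
  linear_combination -e2

theorem coshProd_pos (c : ℝ) (σ : Config L) : 0 < coshProd c σ :=
  Finset.prod_pos fun _ _ => mul_pos two_pos (Real.cosh_pos _)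

theorem sinhProd_le (c : ℝ) (σ : Config L) : sinhProd c σ ≤ coshProd c σ := by
  refine (le_abs_self _).trans ?_
  unfold sinhProd coshProd
  rw [Finset.abs_prod]
  refine Finset.prod_le_prod (fun _ _ => abs_nonneg _) fun x _ => ?_
  rw [abs_mul, abs_two]
  refine mul_le_mul_of_nonneg_left ?_ two_pos.le
  rw [← sq_le_sq₀ (abs_nonneg _) (Real.cosh_pos _).le, sq_abs, Real.cosh_sq]
  linarith

theorem det_hop (σ : Config L) : (hop σ).det = ((∏ x, hopEig σ x : ℝ) : ℂ) := by
  rw [(hop_isHermitian σ).det_eq_prod_eigenvalues]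
  push_cast
  rfl

theorem sinhProd_nonneg (hL : 4 ∣ L) {c : ℝ} (hc : 0 ≤ c) (σ : Config L) : 0 ≤ sinhProd c σ := by
  have h := det_hop_nonneg hL σ
  rw [det_hop, Complex.ofReal_re] at h
  have hr : ∀ u : ℝ, ∃ r : ℝ, 0 ≤ r ∧ 2 * Real.sinh (c * u / 2) = u * r := by
    intro u
    rcases lt_trichotomy u 0 with h | h | h
    · refine ⟨2 * Real.sinh (c * u / 2) / u, div_nonneg_of_nonpos ?_ h.le, by field_simp [h.ne]⟩
      have : Real.sinh (c * u / 2) ≤ 0 := Real.sinh_nonpos_iff.2 (by nlinarith)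
      linarith
    · exact ⟨0, le_rfl, by simp [h]⟩
    · refine ⟨2 * Real.sinh (c * u / 2) / u, div_nonneg ?_ h.le, by field_simp [h.ne']⟩
      have : 0 ≤ Real.sinh (c * u / 2) := Real.sinh_nonneg_iff.2 (by positivity)
      linarith
  choose r hr0 hr using hr
  unfold sinhProd
  simp only [hr, Finset.prod_mul_distrib]
  exact mul_nonneg h (Finset.prod_nonneg fun _ _ => hr0 _)

/-- `Tr (1 + (-1)^N) e^{-βH_f}` at `c = β t`. -/
def evenTrace (c : ℝ) (σ : Config L) : ℝ := coshProd c σ + sinhProd c σ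

theorem coshProd_le_evenTrace (hL : 4 ∣ L) {c : ℝ} (hc : 0 ≤ c) (σ : Config L) :
    coshProd c σ ≤ evenTrace c σ := le_add_of_nonneg_right (sinhProd_nonneg hL hc σ)

theorem evenTrace_le (c : ℝ) (σ : Config L) : evenTrace c σ ≤ 2 * coshProd c σ := by
  unfold evenTrace; linarith [sinhProd_le c σ]

theorem trace_one_add_parity_mul_exp (hL : 4 ∣ L) (t β : ℝ) (σ : Config L) :
    ((1 + parity L) * NormedSpace.exp (((-β : ℝ) : ℂ) • fermiHam t σ)).trace =
      (evenTrace (β * t) σ : ℂ) := by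
  rw [Matrix.add_mul, Matrix.one_mul, Matrix.trace_add, trace_exp_fermiHam,
    trace_parity_mul_exp_fermiHam, prod_one_add_exp hL, prod_one_sub_exp hL, evenTrace]
  push_cast
  rfl

theorem exp_bgHam (t β : ℝ) (σ : Config L) : NormedSpace.exp (((-β : ℝ) : ℂ) • bgHam t σ) =
    ((Real.exp (β * (2 * monopoles σ - (L : ℝ) ^ 2)) : ℝ) : ℂ) •
      NormedSpace.exp (((-β : ℝ) : ℂ) • fermiHam t σ) := by
  have hsum : ∑ x : Site L, ((flux σ x : ℤ) : ℂ) = 2 * monopoles σ - (L : ℂ) ^ 2 := by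
    exact_mod_cast congrArg (fun k : ℤ => (k : ℂ)) (sum_flux σ)
  rw [bgHam, hsum, smul_add, smul_smul, Matrix.exp_add_of_commute]
  · have : (((-β : ℝ) : ℂ) * -(2 * monopoles σ - (L : ℂ) ^ 2)) • (1 : FermiOp L) =
        Matrix.diagonal fun _ => ((β * (2 * monopoles σ - (L : ℝ) ^ 2) : ℝ) : ℂ) := by
      rw [← Matrix.diagonal_one, ← Matrix.diagonal_smul]
      congr 1; ext i; simp; ring
    rw [this, Matrix.exp_diagonal]
    have e : (NormedSpace.exp fun _ : Occ L => ((β * (2 * monopoles σ - (L : ℝ) ^ 2) : ℝ) : ℂ)) =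
        fun _ => ((Real.exp (β * (2 * monopoles σ - (L : ℝ) ^ 2)) : ℝ) : ℂ) := by
      ext i
      rw [Pi.coe_exp, ← Complex.exp_eq_exp_ℂ, Complex.ofReal_exp]
    rw [e, ← Matrix.smul_one_eq_diagonal, Matrix.smul_mul, Matrix.one_mul]
  · exact (Commute.one_left _).smul_left _

theorem trace_one_add_parity_mul_exp_bgHam (hL : 4 ∣ L) (t β : ℝ) (σ : Config L) :
    ((1 + parity L) * NormedSpace.exp (((-β : ℝ) : ℂ) • bgHam t σ)).trace =
      ((Real.exp (β * (2 * monopoles σ - (L : ℝ) ^ 2)) * evenTrace (β * t) σ : ℝ) : ℂ) := by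
  rw [exp_bgHam, Matrix.mul_smul, Matrix.trace_smul, trace_one_add_parity_mul_exp hL, smul_eq_mul]
  push_cast
  rfl

/-! ### The Euler product of the hyperbolic cosine -/

theorem tendsto_euler_sinh_prod (y : ℝ) :
    Tendsto (fun N : ℕ => Real.pi * y * ∏ j ∈ Finset.range N, (1 + y ^ 2 / ((j : ℝ) + 1) ^ 2)) atTop
      (𝓝 (Real.sinh (Real.pi * y))) := by
  have h := (Complex.continuous_im.tendsto _).comp (Complex.tendsto_euler_sin_prod (y * Complex.I))
  have e : (Complex.sin (Real.pi * (y * Complex.I))).im = Real.sinh (Real.pi * y) := by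
    rw [← mul_assoc, Complex.sin_mul_I, ← Complex.ofReal_mul, ← Complex.ofReal_sinh,
      Complex.im_ofReal_mul, Complex.I_im, mul_one]
  rw [e] at h
  refine h.congr fun N => ?_
  have e2 : (∏ j ∈ Finset.range N, ((1 : ℂ) - (y * Complex.I) ^ 2 / ((j : ℂ) + 1) ^ 2)) =
      ((∏ j ∈ Finset.range N, (1 + y ^ 2 / ((j : ℝ) + 1) ^ 2) : ℝ) : ℂ) := by
    push_cast
    refine Finset.prod_congr rfl fun j _ => ?_
    rw [mul_pow, Complex.I_sq]; ring
  rw [Function.comp_apply, e2]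
  generalize (∏ j ∈ Finset.range N, (1 + y ^ 2 / ((j : ℝ) + 1) ^ 2)) = P
  rw [show (Real.pi : ℂ) * (y * Complex.I) * (P : ℂ) = ((Real.pi * y * P : ℝ) : ℂ) * Complex.I by
    push_cast; ring]
  simp

theorem prod_range_two_mul (f : ℕ → ℝ) (N : ℕ) : ∏ j ∈ Finset.range (2 * N), f j =
    (∏ k ∈ Finset.range N, f (2 * k)) * ∏ k ∈ Finset.range N, f (2 * k + 1) := by
  induction N with
  | zero => simp
  | succ N ih =>
    rw [show 2 * (N + 1) = 2 * N + 1 + 1 by ring, Finset.prod_range_succ, Finset.prod_range_succ, ih,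
      Finset.prod_range_succ, Finset.prod_range_succ]
    ring

theorem tendsto_euler_cosh_prod (u : ℝ) :
    Tendsto (fun N : ℕ => ∏ k ∈ Finset.range N, (1 + (2 * u / ((2 * k + 1) * Real.pi)) ^ 2)) atTop
      (𝓝 (Real.cosh u)) := by
  by_cases hu : u = 0
  · simp [hu]
  have hpi := Real.pi_pos.ne'
  set y := u / Real.pi with hy
  have hy0 : y ≠ 0 := div_ne_zero hu hpi
  have huy : Real.pi * y = u := by rw [hy]; field_simp
  have h1 := (tendsto_euler_sinh_prod (2 * y)).comp
    (tendsto_id.const_mul_atTop' (two_pos : (0 : ℕ) < 2))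
  have h2 := (tendsto_euler_sinh_prod y).const_mul 2
  have hs : (2 : ℝ) * Real.sinh (Real.pi * y) ≠ 0 := by
    rw [huy]; exact mul_ne_zero two_ne_zero (Real.sinh_ne_zero.2 hu)
  have h3 := h1.div h2 hs
  have e : Real.sinh (Real.pi * (2 * y)) / (2 * Real.sinh (Real.pi * y)) = Real.cosh u := by
    rw [div_eq_iff hs, show Real.pi * (2 * y) = 2 * (Real.pi * y) by ring, Real.sinh_two_mul, huy]
    ring
  rw [e] at h3
  refine h3.congr fun N => ?_
  simp only [Function.comp_apply, id_eq, Pi.div_apply]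
  rw [prod_range_two_mul]
  have e1 : ∏ k ∈ Finset.range N, (1 + (2 * y) ^ 2 / (((2 * k + 1 : ℕ) : ℝ) + 1) ^ 2) =
      ∏ k ∈ Finset.range N, (1 + y ^ 2 / ((k : ℝ) + 1) ^ 2) := by
    refine Finset.prod_congr rfl fun k _ => ?_
    push_cast
    rw [show (2 * (k : ℝ) + 1 + 1) = 2 * (k + 1) by ring]
    field_simp
  have e2 : ∏ k ∈ Finset.range N, (1 + (2 * y) ^ 2 / (((2 * k : ℕ) : ℝ) + 1) ^ 2) =
      ∏ k ∈ Finset.range N, (1 + (2 * u / ((2 * k + 1) * Real.pi)) ^ 2) := by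
    refine Finset.prod_congr rfl fun k _ => ?_
    push_cast
    rw [← huy]
    congr 1
    field_simp
  rw [e1, e2]
  have hP : ∏ k ∈ Finset.range N, (1 + y ^ 2 / ((k : ℝ) + 1) ^ 2) ≠ 0 :=
    Finset.prod_ne_zero_iff.2 fun k _ => by positivity
  field_simp

/-- Comparison of products of hyperbolic cosines by the frequencies `(2k+1)π/c`. -/
theorem prod_cosh_le {ι : Type*} [Fintype ι] {u v : ι → ℝ} {c R : ℝ} (hc : 0 < c) {r : ℕ → ℝ}
    (h : ∀ k : ℕ, ∏ x, (((2 * k + 1) * Real.pi / c) ^ 2 + u x ^ 2) ≤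
      r k * ∏ x, (((2 * k + 1) * Real.pi / c) ^ 2 + v x ^ 2))
    (hR : ∀ᶠ N in atTop, ∏ k ∈ Finset.range N, r k ≤ R) :
    ∏ x, Real.cosh (c * u x / 2) ≤ R * ∏ x, Real.cosh (c * v x / 2) := by
  have key : ∀ (w : ι → ℝ), Tendsto (fun N : ℕ => ∏ k ∈ Finset.range N,
      ∏ x, (1 + (2 * (c * w x / 2) / ((2 * k + 1) * Real.pi)) ^ 2)) atTop
      (𝓝 (∏ x, Real.cosh (c * w x / 2))) := by
    intro w
    have := tendsto_finsetProd (Finset.univ : Finset ι)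
      fun x _ => tendsto_euler_cosh_prod (c * w x / 2)
    refine this.congr fun N => ?_
    exact Finset.prod_comm
  have hpi := Real.pi_pos
  have conv : ∀ (w : ι → ℝ) (k : ℕ), ∏ x, (((2 * k + 1) * Real.pi / c) ^ 2 + w x ^ 2) =
      (∏ _x : ι, ((2 * k + 1) * Real.pi / c) ^ 2) *
        ∏ x, (1 + (2 * (c * w x / 2) / ((2 * k + 1) * Real.pi)) ^ 2) := by
    intro w k
    rw [← Finset.prod_mul_distrib]
    refine Finset.prod_congr rfl fun x _ => ?_
    field_simp
  refine le_of_tendsto_of_tendsto (key u) ((key v).const_mul R) ?_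
  filter_upwards [hR] with N hN
  have hpos : ∀ (w : ι → ℝ) (k : ℕ),
      0 < ∏ x, (1 + (2 * (c * w x / 2) / ((2 * k + 1) * Real.pi)) ^ 2) :=
    fun w k => Finset.prod_pos fun _ _ => by positivity
  calc _ ≤ ∏ k ∈ Finset.range N, (r k *
        ∏ x, (1 + (2 * (c * v x / 2) / ((2 * k + 1) * Real.pi)) ^ 2)) := by
        refine Finset.prod_le_prod (fun k _ => (hpos u k).le) fun k _ => ?_
        have := h k
        rw [conv u, conv v, mul_left_comm] at this
        exact le_of_mul_le_mul_left this (Finset.prod_pos fun _ _ => by positivity)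
    _ ≤ _ := by
        rw [Finset.prod_mul_distrib]
        exact mul_le_mul_of_nonneg_right hN (Finset.prod_nonneg fun k _ => (hpos v k).le)

theorem sum_abs_le_of_prod_cosh_le {ι : Type*} [Fintype ι] {u v : ι → ℝ}
    (h : ∀ c : ℝ, 0 < c → ∏ x, Real.cosh (c * u x / 2) ≤ ∏ x, Real.cosh (c * v x / 2)) :
    ∑ x, |u x| ≤ ∑ x, |v x| := by
  have hlow : ∀ a : ℝ, Real.exp |a| ≤ 2 * Real.cosh a := by
    intro a
    rw [← Real.cosh_abs, Real.cosh_eq]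
    have := Real.exp_pos (-|a|)
    linarith
  have hup : ∀ a : ℝ, Real.cosh a ≤ Real.exp |a| := by
    intro a
    rw [← Real.cosh_abs, Real.cosh_eq]
    have : Real.exp (-|a|) ≤ Real.exp |a| := Real.exp_le_exp.2 (by linarith [abs_nonneg a])
    linarith
  have habs : ∀ c : ℝ, 0 < c → ∀ a : ℝ, |c * a / 2| = c / 2 * |a| := by
    intro c hc a
    rw [show c * a / 2 = c / 2 * a by ring, abs_mul, abs_of_pos (half_pos hc)]
  have hall : ∀ c : ℝ, 0 < c → c / 2 * (∑ x, |u x| - ∑ x, |v x|) ≤ Fintype.card ι := by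
    intro c hc
    have h1 : Real.exp (c / 2 * ∑ x, |u x|) ≤
        Real.exp (Fintype.card ι + c / 2 * ∑ x, |v x|) := by
      calc _ = ∏ x, Real.exp |c * u x / 2| := by
            rw [← Real.exp_sum, Finset.mul_sum]; simp only [habs c hc]
        _ ≤ ∏ x, (2 * Real.cosh (c * u x / 2)) :=
            Finset.prod_le_prod (fun _ _ => (Real.exp_pos _).le) fun x _ => hlow _
        _ = 2 ^ Fintype.card ι * ∏ x, Real.cosh (c * u x / 2) := by
            rw [Finset.prod_mul_distrib]; simp
        _ ≤ 2 ^ Fintype.card ι * ∏ x, Real.exp |c * v x / 2| := by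
            refine mul_le_mul_of_nonneg_left ((h c hc).trans ?_) (by positivity)
            exact Finset.prod_le_prod (fun _ _ => (Real.cosh_pos _).le) fun x _ => hup _
        _ ≤ Real.exp 1 ^ Fintype.card ι * ∏ x, Real.exp |c * v x / 2| := by
            gcongr
            linarith [Real.add_one_le_exp (1 : ℝ)]
        _ = _ := by
            rw [← Real.exp_nat_mul, mul_one, ← Real.exp_sum, ← Real.exp_add, Finset.mul_sum]
            simp only [habs c hc]
    have := Real.exp_le_exp.1 h1
    linarith
  by_contra hlt
  push Not at hlt
  set δ := ∑ x, |u x| - ∑ x, |v x| with hδ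
  have hδ0 : 0 < δ := by linarith
  have := hall (2 * (Fintype.card ι + 1) / δ) (by positivity)
  rw [show 2 * ((Fintype.card ι : ℝ) + 1) / δ / 2 * δ = Fintype.card ι + 1 by field_simp] at this
  linarith

theorem sum_sqrt_le_of_prod_le {ι : Type*} [Fintype ι] {y z : ι → ℝ} (hy : ∀ x, 0 ≤ y x)
    (hz : ∀ x, 0 ≤ z x) (h : ∀ s : ℝ, 0 < s → ∏ x, (s ^ 2 + y x) ≤ ∏ x, (s ^ 2 + z x)) :
    ∑ x, √(y x) ≤ ∑ x, √(z x) := by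
  have := sum_abs_le_of_prod_cosh_le (u := fun x => √(y x)) (v := fun x => √(z x)) fun c hc => by
    have := prod_cosh_le (u := fun x => √(y x)) (v := fun x => √(z x)) (R := 1) (r := fun _ => 1) hc
      (fun k => by
        simp only [Real.sq_sqrt (hy _), Real.sq_sqrt (hz _), one_mul]
        exact h _ (by have := Real.pi_pos; positivity))
      (by simp)
    simpa using this
  simpa only [abs_of_nonneg (Real.sqrt_nonneg _)] using this

/-! ### Energy of the `π` flux -/

theorem coshProd_le_of_isPiFlux (hL : 4 ∣ L) {σ₀ : Config L} (h₀ : IsPiFlux σ₀ (-1) (-1)) {c : ℝ}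
    (hc : 0 < c) (τ : Config L) : coshProd c τ ≤ coshProd c σ₀ := by
  have := prod_cosh_le (u := hopEig τ) (v := hopEig σ₀) (R := 1) (r := fun _ => 1) hc
    (fun k => by
      rw [one_mul, ← hopDet_sq, ← hopDet_sq]
      have hs : 0 < (2 * (k : ℝ) + 1) * Real.pi / c := by have := Real.pi_pos; positivity
      have h1 := hopDet_pos hs.ne' τ
      exact pow_le_pow_left₀ h1.le (hopDet_le_of_isPiFlux hL h₀ hs.ne' τ) 2)
    (by simp)
  unfold coshProd
  rw [Finset.prod_mul_distrib, Finset.prod_mul_distrib]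
  rw [one_mul] at this
  exact mul_le_mul_of_nonneg_left this (Finset.prod_nonneg fun _ _ => two_pos.le)

theorem sum_abs_hopEig_le (hL : 4 ∣ L) {σ₀ : Config L} (h₀ : IsPiFlux σ₀ (-1) (-1))
    (τ : Config L) : ∑ x, |hopEig τ x| ≤ ∑ x, |hopEig σ₀ x| := by
  refine sum_abs_le_of_prod_cosh_le fun c hc => ?_
  have := coshProd_le_of_isPiFlux hL h₀ hc τ
  unfold coshProd at this
  rw [Finset.prod_mul_distrib, Finset.prod_mul_distrib] at this
  exact le_of_mul_le_mul_left this (Finset.prod_pos fun _ _ => two_pos)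

theorem coshProd_le_exp_monopoles (hL : 4 ∣ L) (hL8 : 8 ≤ L) {σ₀ : Config L}
    (h₀ : IsPiFlux σ₀ (-1) (-1)) {c : ℝ} (hc : 0 < c) (τ : Config L) :
    coshProd c τ ≤ Real.exp (-(monopoles τ * (10 * c - 2) / 128 ^ 4)) * coshProd c σ₀ := by
  have hpi := Real.pi_pos
  set q : ℝ := Real.exp (-(monopoles τ / 128 ^ 4)) with hq
  have hq1 : q ≤ 1 := Real.exp_le_one_iff.2 (by
    have : (0 : ℝ) ≤ monopoles τ / 128 ^ 4 := by positivity
    linarith)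
  set k₀ := ⌈32 * c / Real.pi⌉₊
  set k₁ := ⌊64 * c / Real.pi + 1 / 2⌋₊
  set r : ℕ → ℝ := fun k => if k ∈ Finset.Ico k₀ k₁ then q else 1 with hr
  have hdet : ∀ k : ℕ, hopDet ((2 * k + 1) * Real.pi / c) τ ^ 2 ≤
      r k * hopDet ((2 * k + 1) * Real.pi / c) σ₀ ^ 2 := by
    intro k
    have hs : 0 < (2 * (k : ℝ) + 1) * Real.pi / c := by positivity
    have h1 := hopDet_pos hs.ne' τ
    have h2 := hopDet_pos hs.ne' σ₀
    simp only [hr]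
    split_ifs with hk
    · rw [Finset.mem_Ico] at hk
      have hk0 : 32 * c / Real.pi ≤ k := (Nat.le_ceil _).trans (Nat.cast_le.2 hk.1)
      have hk1 : (k : ℝ) + 1 ≤ 64 * c / Real.pi + 1 / 2 := by
        have : ((k + 1 : ℕ) : ℝ) ≤ 64 * c / Real.pi + 1 / 2 :=
          (Nat.cast_le.2 hk.2).trans (Nat.floor_le (by positivity))
        simpa using this
      rw [div_le_iff₀ hpi] at hk0
      have hk1' : (k : ℝ) + 1 / 2 ≤ 64 * c / Real.pi := by linarith
      rw [le_div_iff₀ hpi] at hk1'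
      have h64 : 64 ≤ (2 * (k : ℝ) + 1) * Real.pi / c := by rw [le_div_iff₀ hc]; nlinarith
      have h128 : (2 * (k : ℝ) + 1) * Real.pi / c ≤ 128 := by rw [div_le_iff₀ hc]; nlinarith
      have := log_hopDet_add_monopoles_le hL hL8 h64 h128 h₀.1
        (fun τ => hopDet_le_of_isPiFlux hL h₀ hs.ne' τ) τ
      rw [← Real.log_le_log_iff (by positivity) (by positivity), Real.log_mul (Real.exp_pos _).ne'
        (by positivity), Real.log_pow, Real.log_pow, Real.log_exp]
      push_cast
      have e : (monopoles τ : ℝ) / 128 ^ 4 = 2 * (1 / (2 * 128 ^ 4) * monopoles τ) := by ring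
      rw [e]
      linarith
    · rw [one_mul]
      exact pow_le_pow_left₀ h1.le (hopDet_le_of_isPiFlux hL h₀ hs.ne' τ) 2
  have hR : ∀ᶠ N in atTop, ∏ k ∈ Finset.range N, r k ≤
      Real.exp (-(monopoles τ * (10 * c - 2) / 128 ^ 4)) := by
    filter_upwards [eventually_ge_atTop k₁] with N hN
    have h1 : ∏ k ∈ Finset.range N, r k = q ^ (k₁ - k₀) := by
      rw [hr, Finset.prod_ite, Finset.prod_const_one, mul_one, Finset.prod_const]
      congr 1
      rw [Finset.filter_mem_eq_inter, Finset.inter_eq_right.2, Nat.card_Ico]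
      intro k hk
      rw [Finset.mem_Ico] at hk
      exact Finset.mem_range.2 (hk.2.trans_le hN)
    rw [h1, hq, ← Real.exp_nat_mul]
    refine Real.exp_le_exp.2 ?_
    have hcard : 10 * c - 2 ≤ ((k₁ - k₀ : ℕ) : ℝ) := by
      have h2 : (k₁ : ℝ) ≤ ((k₁ - k₀ : ℕ) : ℝ) + k₀ := by
        have : k₁ ≤ (k₁ - k₀) + k₀ := by omega
        exact_mod_cast this
      have h3 : 64 * c / Real.pi + 1 / 2 < k₁ + 1 := Nat.lt_floor_add_one _
      have h4 : (k₀ : ℝ) < 32 * c / Real.pi + 1 := Nat.ceil_lt_add_one (by positivity)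
      have h5 : 10 * c ≤ 32 * c / Real.pi := by
        rw [le_div_iff₀ hpi]
        nlinarith [Real.pi_lt_d2]
      have h6 : 64 * c / Real.pi = 32 * c / Real.pi + 32 * c / Real.pi := by ring
      linarith
    have hm : (0 : ℝ) ≤ monopoles τ / 128 ^ 4 := by positivity
    rw [show (monopoles τ : ℝ) * (10 * c - 2) / 128 ^ 4 = (10 * c - 2) * (monopoles τ / 128 ^ 4) by ring]
    have := mul_le_mul_of_nonneg_right hcard hm
    linarith
  have := prod_cosh_le (u := hopEig τ) (v := hopEig σ₀) hc
    (fun k => by rw [← hopDet_sq, ← hopDet_sq]; exact hdet k) hR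
  unfold coshProd
  rw [Finset.prod_mul_distrib, Finset.prod_mul_distrib, mul_left_comm]
  exact mul_le_mul_of_nonneg_left this (Finset.prod_nonneg fun _ _ => two_pos.le)

/-! ### Gauge transformations on the total space -/

/-- The sign by which the gauge transformation `g` acts on the Fock basis vector `T`. -/
def gaugeSign (g : Site L → ℤˣ) (T : Occ L) : ℂ := ((∏ y ∈ T, g y : ℤˣ) : ℤ)

/-- The gauge transformation `g` on the total space. -/
def gaugeOp (g : Site L → ℤˣ) : TotalOp L := fun p q =>
  if p.1 = q.1 ∧ p.2 = gaugeTransform g q.2 then gaugeSign g q.1 else 0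

theorem gaugeSign_mul (g g' : Site L → ℤˣ) (T : Occ L) :
    gaugeSign (g * g') T = gaugeSign g T * gaugeSign g' T := by
  simp [gaugeSign, Finset.prod_mul_distrib]

theorem gaugeSign_mul_self (g : Site L → ℤˣ) (T : Occ L) : gaugeSign g T * gaugeSign g T = 1 := by
  unfold gaugeSign
  exact_mod_cast units_coe_mul_self _

theorem mul_gaugeOp_apply (M : TotalOp L) (g : Site L → ℤˣ) (p q : Occ L × Config L) :
    (M * gaugeOp g) p q = M p (q.1, gaugeTransform g q.2) * gaugeSign g q.1 := by
  rw [Matrix.mul_apply, Finset.sum_eq_single (q.1, gaugeTransform g q.2)]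
  · simp [gaugeOp]
  · intro r _ hr
    have : ¬ (r.1 = q.1 ∧ r.2 = gaugeTransform g q.2) := fun h => hr (Prod.ext h.1 h.2)
    simp [gaugeOp, this]
  · simp

theorem gaugeOp_mul (g g' : Site L → ℤˣ) : gaugeOp g * gaugeOp g' = gaugeOp (g * g') := by
  ext p q
  rw [mul_gaugeOp_apply]
  simp only [gaugeOp, gaugeTransform_gaugeTransform, gaugeSign_mul]
  split_ifs <;> simp

theorem gaugeTransform_one (σ : Config L) : gaugeTransform 1 σ = σ := by
  ext b; simp [gaugeTransform]

theorem gaugeOp_one : gaugeOp (1 : Site L → ℤˣ) = 1 := by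
  ext p q
  simp [gaugeOp, gaugeTransform_one, Matrix.one_apply, Prod.ext_iff, gaugeSign]

/-- Multiplication of the gauge field by `δ`. -/
def mulOp (δ : Config L) : GaugeOp L := fun σ τ => if σ = δ * τ then 1 else 0

theorem mulOp_mul (δ δ' : Config L) : mulOp δ * mulOp δ' = mulOp (δ * δ') := by
  ext σ τ
  rw [Matrix.mul_apply, Finset.sum_eq_single (δ' * τ)]
  · simp [mulOp, mul_assoc]
  · intro r _ hr; simp [mulOp, hr]
  · simp

theorem pauliX_eq (b : Bond L) : pauliX b = mulOp (Pi.mulSingle b (-1)) := by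
  ext σ τ
  have : Function.update τ b (-τ b) = Pi.mulSingle b (-1) * τ := by
    ext c
    by_cases h : c = b
    · subst h; simp
    · simp [h]
  rw [pauliX, this, mulOp]

theorem starOp_eq (x : Site L) : starOp x = mulOp (gaugeTransform (Pi.mulSingle x (-1)) 1) := by
  unfold starOp
  simp only [pauliX_eq, mulOp_mul]
  congr 1
  funext ⟨y, μ⟩
  have h : ∀ e : Site L, (y = x - e) = (y + e = x) := fun e => by rw [eq_sub_iff_add_eq]
  fin_cases μ <;> simp [gaugeTransform, Pi.mulSingle_apply, h]

theorem charge_eq (x : Site L) : charge x = gaugeOp (Pi.mulSingle x (-1)) := by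
  unfold charge ofGauge ofFermi
  rw [← Matrix.mul_kronecker_mul, Matrix.one_mul, Matrix.mul_one, starOp_eq]
  ext p q
  rw [Matrix.kronecker_apply, siteParity, Matrix.diagonal_apply, mulOp, ← gaugeTransform_eq_mul,
    gaugeOp, gaugeSign]
  have e : ∏ y ∈ q.1, (Pi.mulSingle x (-1) : Site L → ℤˣ) y = if x ∈ q.1 then -1 else 1 := by
    simp [Pi.mulSingle_apply]
  rw [e]
  by_cases h1 : p.1 = q.1 <;> by_cases h2 : p.2 = gaugeTransform (Pi.mulSingle x (-1)) q.2 <;>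
    by_cases h3 : x ∈ q.1 <;> simp [h1, h2, h3]

/-- The gauge transformation that flips the sites in `A`. -/
def flipOn (A : Finset (Site L)) : Site L → ℤˣ := fun x => if x ∈ A then -1 else 1

theorem flipOn_empty : flipOn (∅ : Finset (Site L)) = 1 := by ext; simp [flipOn]

theorem mulSingle_mul_flipOn {x : Site L} {A : Finset (Site L)} (h : x ∉ A) :
    Pi.mulSingle x (-1) * flipOn A = flipOn (insert x A) := by
  funext y
  by_cases hy : y = x
  · subst hy; simp [flipOn, h]
  · simp [flipOn, hy]

theorem eq_flipOn (g : Site L → ℤˣ) : g = flipOn (Finset.univ.filter fun x => g x = -1) := by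
  funext x
  rcases Int.units_eq_one_or (g x) with h | h <;> simp [flipOn, h]

theorem list_prod_eq_sum_flipOn (l : List (Site L)) (hl : l.Nodup) :
    (l.map fun x => (2⁻¹ : ℂ) • (1 + charge x)).prod =
      ((2 : ℂ) ^ l.length)⁻¹ • ∑ A ∈ l.toFinset.powerset, gaugeOp (flipOn A) := by
  induction l with
  | nil => simp [flipOn_empty, gaugeOp_one]
  | cons x l ih =>
    have hx : x ∉ l.toFinset := by simpa using (List.nodup_cons.1 hl).1
    rw [List.map_cons, List.prod_cons, ih (List.nodup_cons.1 hl).2, List.toFinset_cons,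
      Finset.sum_powerset_insert hx, Matrix.smul_mul, Matrix.mul_smul, smul_smul, Matrix.add_mul,
      Matrix.one_mul, Finset.mul_sum, List.length_cons, pow_succ, mul_inv, mul_comm (2⁻¹ : ℂ)]
    congr 2
    refine Finset.sum_congr rfl fun A hA => ?_
    rw [charge_eq, gaugeOp_mul, mulSingle_mul_flipOn fun h => hx (Finset.mem_powerset.1 hA h)]

theorem physProj_eq : physProj L =
    ((2 : ℂ) ^ (L ^ 2))⁻¹ • ∑ A : Finset (Site L), gaugeOp (flipOn A) := by
  rw [physProj, list_prod_eq_sum_flipOn _ (Finset.nodup_toList _), Finset.length_toList,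
    Finset.card_univ, card_site, Finset.toList_toFinset, Finset.powerset_univ]

theorem eq_of_forall_add_unitVec {α : Type*} {f : Site L → α}
    (h : ∀ x μ, f (x + unitVec L μ) = f x) (x : Site L) : f x = f 0 := by
  have h0 : ∀ (k : ℕ) (b : ZMod L), f ((k : ZMod L), b) = f (0, b) := by
    intro k b
    induction k with
    | zero => simp
    | succ k ih => rw [← ih, ← h ((k : ZMod L), b) 0]; simp [unitVec_zero]
  have h1 : ∀ (k : ℕ), f (0, (k : ZMod L)) = f 0 := by
    intro k
    induction k with
    | zero => rw [Nat.cast_zero]; rfl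
    | succ k ih => rw [← ih, ← h (0, (k : ZMod L)) 1]; simp [unitVec_one]
  obtain ⟨a, b⟩ := x
  rw [← ZMod.natCast_zmod_val a, h0, ← ZMod.natCast_zmod_val b, h1]

theorem gaugeTransform_flipOn_eq_iff (A : Finset (Site L)) (σ : Config L) :
    σ = gaugeTransform (flipOn A) σ ↔ A = ∅ ∨ A = Finset.univ := by
  constructor
  · intro h
    have h1 : ∀ x μ, flipOn A (x + unitVec L μ) = flipOn A x := by
      intro x μ
      have h2 := congrFun h (x, μ)
      rw [gaugeTransform] at h2
      have h3 : flipOn A x * flipOn A (x + unitVec L μ) = 1 := by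
        have : σ (x, μ) * 1 = σ (x, μ) * (flipOn A x * flipOn A (x + unitVec L μ)) := by
          rw [mul_one]; conv_lhs => rw [h2]
          simp only; ac_rfl
        exact (mul_left_cancel this).symm
      exact ((units_mul_eq_one_iff _ _).1 h3).symm
    have h2 := eq_of_forall_add_unitVec h1
    have h3 : ∀ x, x ∈ A ↔ flipOn A x = -1 := by
      intro x
      unfold flipOn
      split_ifs with h <;> simp [h]
    rcases Int.units_eq_one_or (flipOn A 0) with h4 | h4
    · left; ext x; rw [h3, h2, h4]; simp
    · right; ext x; rw [h3, h2, h4]; simp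
  · rintro (rfl | rfl)
    · rw [flipOn_empty, gaugeTransform_one]
    · ext b; simp [gaugeTransform, flipOn]

theorem trace_physProj_mul (M : Config L → FermiOp L) :
    (physProj L * Matrix.blockDiagonal M).trace =
      ((2 : ℂ) ^ (L ^ 2))⁻¹ * ∑ σ, ((1 + parity L) * M σ).trace := by
  rw [physProj_eq, Matrix.smul_mul, Matrix.trace_smul, smul_eq_mul]
  congr 1
  rw [Matrix.trace_mul_comm, Finset.mul_sum, Matrix.trace_sum]
  have h1 : ∀ A : Finset (Site L), (Matrix.blockDiagonal M * gaugeOp (flipOn A)).trace =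
      if A = ∅ ∨ A = Finset.univ then ∑ σ, ∑ S, M σ S S * gaugeSign (flipOn A) S else 0 := by
    intro A
    rw [Matrix.trace, Fintype.sum_prod_type, Finset.sum_comm]
    simp only [Matrix.diag_apply, mul_gaugeOp_apply, Matrix.blockDiagonal_apply,
      gaugeTransform_flipOn_eq_iff]
    split_ifs <;> simp
  simp only [h1]
  have hne : (∅ : Finset (Site L)) ≠ Finset.univ := (Finset.univ_nonempty).ne_empty.symm
  rw [← Finset.sum_filter, show (Finset.univ.filter fun A : Finset (Site L) =>
    A = ∅ ∨ A = Finset.univ) = {∅, Finset.univ} by ext; simp, Finset.sum_pair hne,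
    ← Finset.sum_add_distrib]
  refine Finset.sum_congr rfl fun σ _ => ?_
  rw [← Finset.sum_add_distrib, Matrix.trace]
  refine Finset.sum_congr rfl fun S _ => ?_
  rw [Matrix.diag_apply, Matrix.add_mul, Matrix.one_mul, Matrix.add_apply, parity,
    Matrix.diagonal_mul]
  simp [gaugeSign, flipOn]
  ring

/-! ### Operators that are diagonal in the gauge field -/

theorem ofFermi_eq (A : FermiOp L) : ofFermi A = Matrix.blockDiagonal fun _ => A := by
  ext p q
  simp [ofFermi, Matrix.blockDiagonal_apply, Matrix.one_apply]

theorem ofGauge_diagonal (d : Config L → ℂ) :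
    ofGauge (Matrix.diagonal d) = Matrix.blockDiagonal fun σ => d σ • (1 : FermiOp L) := by
  ext ⟨S, σ⟩ ⟨T, τ⟩
  simp only [ofGauge, Matrix.kroneckerMap_apply, Matrix.blockDiagonal_apply, Matrix.diagonal_apply,
    Matrix.smul_apply, smul_eq_mul]
  split_ifs <;> ring

theorem evalAt_blockDiagonal (M : Config L → FermiOp L) (σ : Config L) :
    evalAt (Matrix.blockDiagonal M) σ = M σ := by
  ext S T
  simp [evalAt, Matrix.blockDiagonal_apply]

theorem hamiltonian_eq (t : ℝ) : hamiltonian L t = Matrix.blockDiagonal (bgHam t) := by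
  have hp : ∀ x : Site L, plaquette x =
      Matrix.blockDiagonal fun σ => ((flux σ x : ℤ) : ℂ) • (1 : FermiOp L) := by
    intro x
    rw [plaquette, pauliZ, pauliZ, pauliZ, pauliZ, Matrix.diagonal_mul_diagonal,
      Matrix.diagonal_mul_diagonal, Matrix.diagonal_mul_diagonal, ofGauge_diagonal]
    congr 1; ext1 σ
    simp [flux]
  have hh : ∀ (x : Site L) (μ : Fin 2), ofFermi (creat x) * ofGauge (pauliZ (x, μ)) *
      ofFermi (annih (x + unitVec L μ)) = Matrix.blockDiagonal fun σ =>
        ((σ (x, μ) : ℤ) : ℂ) • (creat x * annih (x + unitVec L μ)) := by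
    intro x μ
    rw [pauliZ, ofFermi_eq, ofFermi_eq, ofGauge_diagonal, ← Matrix.blockDiagonal_mul,
      ← Matrix.blockDiagonal_mul]
    congr 1; ext1 σ
    rw [Matrix.mul_smul, Matrix.mul_one, Matrix.smul_mul]
  unfold hamiltonian
  simp only [hp, hh, Matrix.blockDiagonal_conjTranspose, ← Matrix.blockDiagonal_add]
  ext p q
  simp only [Matrix.sub_apply, Matrix.neg_apply, Matrix.sum_apply, Matrix.smul_apply,
    Matrix.blockDiagonal_apply]
  split_ifs with h
  · simp only [bgHam, fermiHam, Matrix.add_apply, Matrix.neg_apply, Matrix.smul_apply,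
      Matrix.sum_apply, Pi.add_apply, Matrix.conjTranspose_smul, star_intCast, smul_eq_mul,
      ← Finset.sum_mul]
    rw [sub_eq_add_neg, neg_mul]
    congr 4
    ext x; congr 1; ext μ; ring
  · simp

/-- `σ ↦ O(σ)` determines a polynomial in the `Z` and the fermionic operators. -/
theorem eq_blockDiagonal_of_mem_adjoin {O : TotalOp L} (h : O ∈ Algebra.adjoin ℂ
      ((Set.range fun b : Bond L => ofGauge (pauliZ b)) ∪
        (Set.range fun x : Site L => ofFermi (creat x)) ∪
        (Set.range fun x : Site L => ofFermi (annih x)))) :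
    O = Matrix.blockDiagonal (evalAt O) := by
  suffices ∃ M, O = Matrix.blockDiagonal M by
    obtain ⟨M, rfl⟩ := this
    congr 1; ext1 σ; rw [evalAt_blockDiagonal]
  induction h using Algebra.adjoin_induction with
  | mem x hx =>
    rcases hx with (⟨b, rfl⟩ | ⟨y, rfl⟩) | ⟨y, rfl⟩
    · exact ⟨_, ofGauge_diagonal _⟩
    · exact ⟨_, ofFermi_eq _⟩
    · exact ⟨_, ofFermi_eq _⟩
  | algebraMap r =>
    refine ⟨fun _ => r • 1, ?_⟩
    rw [Algebra.algebraMap_eq_smul_one]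
    ext p q
    simp only [Matrix.smul_apply, Matrix.one_apply, Matrix.blockDiagonal_apply, Prod.ext_iff]
    split_ifs <;> simp_all
  | add x y _ _ hx hy =>
    obtain ⟨M, rfl⟩ := hx
    obtain ⟨N, rfl⟩ := hy
    exact ⟨_, (Matrix.blockDiagonal_add _ _).symm⟩
  | mul x y _ _ hx hy =>
    obtain ⟨M, rfl⟩ := hx
    obtain ⟨N, rfl⟩ := hy
    exact ⟨_, (Matrix.blockDiagonal_mul _ _).symm⟩

theorem exp_hamiltonian (t β : ℝ) : NormedSpace.exp (((-β : ℝ) : ℂ) • hamiltonian L t) =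
    Matrix.blockDiagonal fun σ => NormedSpace.exp (((-β : ℝ) : ℂ) • bgHam t σ) := by
  rw [hamiltonian_eq, ← Matrix.blockDiagonal_smul, Matrix.exp_blockDiagonal]
  congr 1
  open scoped Matrix.Norms.L2Operator in
  let _ : NormedAlgebra ℚ (FermiOp L) := NormedAlgebra.restrictScalars ℚ ℂ _
  exact Pi.exp_def _

/-! ### Gauge covariance -/

/-- The gauge transformation `g` on the Fock space. -/
def gaugeDiag (g : Site L → ℤˣ) : FermiOp L := Matrix.diagonal (gaugeSign g)

theorem gaugeDiag_mul_self (g : Site L → ℤˣ) : gaugeDiag g * gaugeDiag g = 1 := by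
  rw [gaugeDiag, Matrix.diagonal_mul_diagonal, ← Matrix.diagonal_one]
  congr 1; ext T; exact gaugeSign_mul_self g T

theorem gaugeDiag_conjTranspose (g : Site L → ℤˣ) : (gaugeDiag g).conjTranspose = gaugeDiag g := by
  rw [gaugeDiag, Matrix.diagonal_conjTranspose]
  congr 1; ext T; simp [gaugeSign]

theorem gaugeDiag_annih (g : Site L → ℤˣ) (x : Site L) :
    gaugeDiag g * annih x * gaugeDiag g = ((g x : ℤ) : ℂ) • annih x := by
  ext S T
  rw [gaugeDiag, Matrix.mul_diagonal, Matrix.diagonal_mul, Matrix.smul_apply, annih_apply, smul_eq_mul]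
  split_ifs with h
  · have h1 : gaugeSign g T = ((g x : ℤ) : ℂ) * gaugeSign g S := by
      rw [h.2, gaugeSign, gaugeSign, ← Finset.mul_prod_erase T g h.1]
      push_cast; ring
    rw [h1]
    linear_combination (jwSign x T * ((g x : ℤ) : ℂ)) * gaugeSign_mul_self g S
  · ring

theorem gaugeDiag_creat (g : Site L → ℤˣ) (x : Site L) :
    gaugeDiag g * creat x * gaugeDiag g = ((g x : ℤ) : ℂ) • creat x := by
  have h := congrArg Matrix.conjTranspose (gaugeDiag_annih g x)
  rw [Matrix.conjTranspose_mul, Matrix.conjTranspose_mul, gaugeDiag_conjTranspose,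
    Matrix.conjTranspose_smul, star_intCast, ← Matrix.mul_assoc] at h
  exact h

theorem fermiHam_gaugeTransform (t : ℝ) (g : Site L → ℤˣ) (σ : Config L) :
    fermiHam t (gaugeTransform g σ) = gaugeDiag g * fermiHam t σ * gaugeDiag g := by
  have h : ∀ x y, gaugeDiag g * (creat x * annih y) * gaugeDiag g =
      (((g x : ℤ) : ℂ) * ((g y : ℤ) : ℂ)) • (creat x * annih y) := by
    intro x y
    calc _ = (gaugeDiag g * creat x * gaugeDiag g) * (gaugeDiag g * annih y * gaugeDiag g) := by
          simp only [Matrix.mul_assoc]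
          rw [← Matrix.mul_assoc (gaugeDiag g) (gaugeDiag g), gaugeDiag_mul_self, Matrix.one_mul]
      _ = _ := by
          rw [gaugeDiag_annih, gaugeDiag_creat, Matrix.smul_mul, Matrix.mul_smul, smul_smul]
  simp only [fermiHam_eq_sum_link, Matrix.mul_neg, Matrix.neg_mul, Matrix.mul_smul, Matrix.smul_mul,
    Matrix.mul_sum, Matrix.sum_mul, h, smul_smul]
  congr 2
  refine Finset.sum_congr rfl fun x _ => Finset.sum_congr rfl fun y _ => ?_
  congr 1
  simp only [hop, Matrix.of_apply, link_gaugeTransform]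
  push_cast; ring

theorem exp_fermiHam_gaugeTransform (t : ℝ) (c : ℂ) (g : Site L → ℤˣ) (σ : Config L) :
    NormedSpace.exp (c • fermiHam t (gaugeTransform g σ)) =
      gaugeDiag g * NormedSpace.exp (c • fermiHam t σ) * gaugeDiag g := by
  have hinv : (gaugeDiag g)⁻¹ = gaugeDiag g := Matrix.inv_eq_right_inv (gaugeDiag_mul_self g)
  have h1 := Matrix.exp_conj (gaugeDiag g) (c • fermiHam t σ)
    (IsUnit.of_mul_eq_one _ (gaugeDiag_mul_self g))
  rw [hinv] at h1
  rw [← h1, fermiHam_gaugeTransform, Matrix.mul_smul, Matrix.smul_mul]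

theorem gaugeOp_mul_apply (M : TotalOp L) (g : Site L → ℤˣ) (p q : Occ L × Config L) :
    (gaugeOp g * M) p q = gaugeSign g p.1 * M (p.1, gaugeTransform g p.2) q := by
  have hg : g * g = 1 := by ext x; simp
  rw [Matrix.mul_apply, Finset.sum_eq_single (p.1, gaugeTransform g p.2)]
  · simp [gaugeOp, gaugeTransform_gaugeTransform, hg, gaugeTransform_one]
  · intro r _ hr
    have : ¬ (p.1 = r.1 ∧ p.2 = gaugeTransform g r.2) := by
      rintro ⟨h1, h2⟩
      apply hr
      rw [h1, h2, gaugeTransform_gaugeTransform, hg, gaugeTransform_one]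
    simp [gaugeOp, this]
  · simp

theorem commute_gaugeOp {O : TotalOp L} (h : ∀ x, Commute O (charge x)) (g : Site L → ℤˣ) :
    Commute O (gaugeOp g) := by
  rw [eq_flipOn g]
  generalize (Finset.univ.filter fun x => g x = -1) = A
  induction A using Finset.induction_on with
  | empty => rw [flipOn_empty, gaugeOp_one]; exact Commute.one_right _
  | insert x A hx ih =>
    rw [← mulSingle_mul_flipOn hx, ← gaugeOp_mul, ← charge_eq]
    exact (h x).mul_right ih

theorem evalAt_gaugeTransform {O : TotalOp L} (h : ∀ x, Commute O (charge x)) (g : Site L → ℤˣ)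
    (σ : Config L) :
    evalAt O (gaugeTransform g σ) = gaugeDiag g * evalAt O σ * gaugeDiag g := by
  have hg : g * g = 1 := by ext x; simp
  ext S T
  have h1 := congrFun (congrFun (commute_gaugeOp h g).eq (S, gaugeTransform g σ)) (T, σ)
  rw [mul_gaugeOp_apply, gaugeOp_mul_apply] at h1
  simp only [gaugeTransform_gaugeTransform, hg, gaugeTransform_one] at h1
  rw [gaugeDiag, Matrix.mul_diagonal, Matrix.diagonal_mul]
  simp only [evalAt]
  rw [← h1]
  linear_combination (-O (S, gaugeTransform g σ) (T, gaugeTransform g σ)) * gaugeSign_mul_self g T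

/-- `Tr (1 + (-1)^N) O(σ) e^{-βH_f(σ)}`. -/
def evenInsertion (t β : ℝ) (O : TotalOp L) (σ : Config L) : ℂ :=
  ((1 + parity L) * (evalAt O σ * NormedSpace.exp (((-β : ℝ) : ℂ) • fermiHam t σ))).trace

theorem evenInsertion_gaugeTransform (t β : ℝ) {O : TotalOp L} (h : ∀ x, Commute O (charge x))
    (g : Site L → ℤˣ) (σ : Config L) :
    evenInsertion t β O (gaugeTransform g σ) = evenInsertion t β O σ := by
  have hP : gaugeDiag g * (1 + parity L) * gaugeDiag g = 1 + parity L := by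
    rw [Matrix.mul_add, Matrix.add_mul, Matrix.mul_one, gaugeDiag_mul_self]
    congr 1
    rw [gaugeDiag, parity, Matrix.diagonal_mul_diagonal, Matrix.diagonal_mul_diagonal]
    congr 1; ext S
    linear_combination ((-1) ^ S.card) * gaugeSign_mul_self g S
  unfold evenInsertion
  rw [evalAt_gaugeTransform h, exp_fermiHam_gaugeTransform]
  set G := gaugeDiag g
  set A := evalAt O σ
  set B := NormedSpace.exp (((-β : ℝ) : ℂ) • fermiHam t σ)
  have hGG : G * G = 1 := gaugeDiag_mul_self g
  calc _ = ((1 + parity L) * G * (A * B) * G).trace := by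
        congr 1
        simp only [Matrix.mul_assoc]
        rw [← Matrix.mul_assoc G G, hGG, Matrix.one_mul]
    _ = ((G * (1 + parity L) * G) * (A * B)).trace := by
        rw [Matrix.trace_mul_comm]; simp only [Matrix.mul_assoc]
    _ = _ := by rw [hP]

theorem evenInsertion_one (hL : 4 ∣ L) (t β : ℝ) (σ : Config L) :
    evenInsertion t β 1 σ = (evenTrace (β * t) σ : ℂ) := by
  have : evalAt (1 : TotalOp L) σ = 1 := by
    ext S T; simp [evalAt, Matrix.one_apply]
  rw [evenInsertion, this, Matrix.one_mul, trace_one_add_parity_mul_exp hL]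

theorem evenTrace_gaugeTransform (hL : 4 ∣ L) (c : ℝ) (g : Site L → ℤˣ) (σ : Config L) :
    evenTrace c (gaugeTransform g σ) = evenTrace c σ := by
  have := evenInsertion_gaugeTransform (O := 1) c 1 (fun x => Commute.one_left _) g σ
  rw [evenInsertion_one hL, evenInsertion_one hL, one_mul] at this
  exact_mod_cast this

/-! ### Bounds on expectations -/

theorem norm_trace_conj_le {n m : Type*} [Fintype n] [DecidableEq n] [Fintype m]
    (O : Matrix n n ℂ) (R : Matrix n m ℂ) : ‖(R.conjTranspose * O * R).trace‖ ≤
      ‖Matrix.toEuclideanCLM (n := n) (𝕜 := ℂ) O‖ * (R.conjTranspose * R).trace.re := by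
  set T := Matrix.toEuclideanCLM (n := n) (𝕜 := ℂ) O with hT
  set v : m → EuclideanSpace ℂ n := fun i => WithLp.toLp 2 (fun j => R j i) with hv
  have h1 : ∀ i, (R.conjTranspose * O * R) i i = inner ℂ (v i) (T (v i)) := by
    intro i
    rw [hT, hv, Matrix.toEuclideanCLM_toLp, EuclideanSpace.inner_toLp_toLp, Matrix.mul_assoc,
      Matrix.mul_apply, dotProduct]
    refine Finset.sum_congr rfl fun j _ => ?_
    rw [mul_comm]
    rfl
  have h2 : (R.conjTranspose * R).trace.re = ∑ i, ‖v i‖ ^ 2 := by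
    rw [Matrix.trace, Complex.re_sum]
    refine Finset.sum_congr rfl fun i _ => ?_
    rw [EuclideanSpace.norm_sq_eq, Matrix.diag_apply, Matrix.mul_apply, Complex.re_sum]
    refine Finset.sum_congr rfl fun j _ => ?_
    rw [Matrix.conjTranspose_apply, Complex.star_def, ← Complex.normSq_eq_conj_mul_self,
      Complex.ofReal_re, Complex.normSq_eq_norm_sq]
  rw [h2, Matrix.trace, Finset.mul_sum]
  refine (norm_sum_le _ _).trans (Finset.sum_le_sum fun i _ => ?_)
  rw [Matrix.diag_apply, h1]
  calc _ ≤ ‖v i‖ * ‖T (v i)‖ := norm_inner_le_norm _ _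
    _ ≤ ‖v i‖ * (‖T‖ * ‖v i‖) := by gcongr; exact T.le_opNorm _
    _ = _ := by ring

theorem norm_evenInsertion_le (hL : 4 ∣ L) (t β : ℝ) (O : TotalOp L) (σ : Config L) :
    ‖evenInsertion t β O σ‖ ≤
      ‖Matrix.toEuclideanCLM (n := Occ L) (𝕜 := ℂ) (evalAt O σ)‖ * evenTrace (β * t) σ := by
  set E := NormedSpace.exp (((-β / 2 : ℝ) : ℂ) • fermiHam t σ) with hE
  have hEE : E * E = NormedSpace.exp (((-β : ℝ) : ℂ) • fermiHam t σ) := by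
    rw [hE, ← Matrix.exp_add_of_commute _ _ (Commute.refl _), ← add_smul]
    congr 2; push_cast; ring
  have hEh : E.conjTranspose = E := by
    rw [hE]
    refine Matrix.IsHermitian.exp ?_
    unfold Matrix.IsHermitian
    rw [Matrix.conjTranspose_smul, (fermiHam_isHermitian t σ).eq, Complex.star_def,
      Complex.conj_ofReal]
  set P := parity L with hP
  have hPh : P.conjTranspose = P := by
    rw [hP, parity, Matrix.diagonal_conjTranspose]; congr 1; ext S; simp
  have hPP : P * P = 1 := by
    rw [hP, parity, Matrix.diagonal_mul_diagonal, ← Matrix.diagonal_one]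
    congr 1; ext S; rw [← mul_pow]; norm_num
  have hPE : P * E = E * P := (commute_parity_exp_fermiHam t _ σ).eq
  set R := (1 + P) * E with hR
  have hRh : R.conjTranspose = E * (1 + P) := by
    rw [hR, Matrix.conjTranspose_mul, hEh, Matrix.conjTranspose_add, hPh, Matrix.conjTranspose_one]
  have hc : E * (1 + P) = (1 + P) * E := by rw [Matrix.mul_add, Matrix.add_mul, hPE]; simp
  have h2 : (1 + P) * (1 + P) = (2 : ℂ) • (1 + P) := by
    rw [Matrix.mul_add, Matrix.add_mul, Matrix.add_mul, hPP, two_smul]; simp; abel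
  have hRR : R * R.conjTranspose = (2 : ℂ) • ((1 + P) * (E * E)) := by
    rw [hRh, hc, hR]
    calc (1 + P) * E * ((1 + P) * E) = (1 + P) * (E * (1 + P)) * E := by
          simp only [Matrix.mul_assoc]
      _ = ((1 + P) * (1 + P)) * (E * E) := by rw [hc]; simp only [Matrix.mul_assoc]
      _ = _ := by rw [h2, Matrix.smul_mul]
  have hcEE : (1 + P) * (E * E) = (E * E) * (1 + P) := by
    rw [← Matrix.mul_assoc, ← hc, Matrix.mul_assoc, ← hc, Matrix.mul_assoc]
  have k1 : (R.conjTranspose * evalAt O σ * R).trace = 2 * evenInsertion t β O σ := by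
    rw [Matrix.mul_assoc, Matrix.trace_mul_comm, Matrix.mul_assoc, hRR, Matrix.mul_smul,
      Matrix.trace_smul, smul_eq_mul, evenInsertion, ← hEE, hcEE, ← Matrix.mul_assoc,
      Matrix.trace_mul_comm (evalAt O σ * (E * E))]
  have k2 : (R.conjTranspose * R).trace = 2 * (evenTrace (β * t) σ : ℂ) := by
    rw [Matrix.trace_mul_comm, hRR, Matrix.trace_smul, smul_eq_mul, hEE,
      trace_one_add_parity_mul_exp hL]
  have := norm_trace_conj_le (evalAt O σ) R
  rw [k1, k2, norm_mul, Complex.norm_two] at this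
  have e : (2 * (evenTrace (β * t) σ : ℂ)).re = 2 * evenTrace (β * t) σ := by
    rw [show (2 : ℂ) * (evenTrace (β * t) σ : ℂ) = ((2 * evenTrace (β * t) σ : ℝ) : ℂ) by push_cast; rfl,
      Complex.ofReal_re]
  rw [e] at this
  linarith

/-! ### Partition functions -/

/-- The weight of the gauge field `σ`, without the factor `e^{-βL²}`. -/
def weight (t β : ℝ) (σ : Config L) : ℝ :=
  Real.exp (2 * β * monopoles σ) * evenTrace (β * t) σ

theorem exp_mul_evenTrace (t β : ℝ) (σ : Config L) :
    Real.exp (β * (2 * monopoles σ - (L : ℝ) ^ 2)) * evenTrace (β * t) σ =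
      Real.exp (-(β * (L : ℝ) ^ 2)) * weight t β σ := by
  rw [weight, ← mul_assoc, ← Real.exp_add]
  ring_nf

theorem trace_physProj_mul_exp (hL : 4 ∣ L) (t β : ℝ) :
    (physProj L * NormedSpace.exp (((-β : ℝ) : ℂ) • hamiltonian L t)).trace =
      (((2 ^ (L ^ 2))⁻¹ * Real.exp (-(β * (L : ℝ) ^ 2)) * ∑ σ : Config L, weight t β σ : ℝ) : ℂ) := by
  rw [exp_hamiltonian, trace_physProj_mul]
  simp only [trace_one_add_parity_mul_exp_bgHam hL, exp_mul_evenTrace]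
  push_cast
  simp only [mul_assoc, Finset.mul_sum]

theorem partitionFn_eq (hL : 4 ∣ L) (t β : ℝ) : partitionFn L t β =
    (2 ^ (L ^ 2))⁻¹ * Real.exp (-(β * (L : ℝ) ^ 2)) * ∑ σ : Config L, weight t β σ := by
  rw [partitionFn, trace_physProj_mul_exp hL, Complex.ofReal_re]

theorem gibbs_eq (hL : 4 ∣ L) (t β : ℝ) {O : TotalOp L} (hO : O = Matrix.blockDiagonal (evalAt O)) :
    gibbs t β O = (∑ σ : Config L, (Real.exp (2 * β * monopoles σ) : ℂ) * evenInsertion t β O σ) /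
      ((∑ σ : Config L, weight t β σ : ℝ) : ℂ) := by
  have h1 : (physProj L * O * NormedSpace.exp (((-β : ℝ) : ℂ) • hamiltonian L t)).trace =
      (((2 ^ (L ^ 2))⁻¹ * Real.exp (-(β * (L : ℝ) ^ 2)) : ℝ) : ℂ) *
        ∑ σ : Config L, (Real.exp (2 * β * monopoles σ) : ℂ) * evenInsertion t β O σ := by
    rw [exp_hamiltonian, hO, Matrix.mul_assoc, ← Matrix.blockDiagonal_mul, ← hO, trace_physProj_mul]
    rw [Complex.ofReal_mul, mul_assoc, Finset.mul_sum (a := ((Real.exp _ : ℝ) : ℂ))]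
    congr 1
    · push_cast; rfl
    refine Finset.sum_congr rfl fun σ _ => ?_
    rw [exp_bgHam, Matrix.mul_smul, Matrix.mul_smul, Matrix.trace_smul, smul_eq_mul,
      ← mul_assoc (((Real.exp (-(β * (L : ℝ) ^ 2)) : ℝ) : ℂ)), ← Complex.ofReal_mul, ← Real.exp_add,
      evenInsertion]
    congr 3
    ring_nf
  rw [gibbs, h1, trace_physProj_mul_exp hL, Complex.ofReal_mul _ (∑ σ : Config L, weight t β σ)]
  exact mul_div_mul_left _ _ (Complex.ofReal_ne_zero.2 (by positivity))

theorem monopoles_eq_zero {σ : Config L} {a b : ℤˣ} (h : IsPiFlux σ a b) : monopoles σ = 0 := by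
  simp [monopoles, h.1]

theorem weight_of_isPiFlux (t β : ℝ) {σ : Config L} {a b : ℤˣ} (h : IsPiFlux σ a b) :
    weight t β σ = evenTrace (β * t) σ := by
  simp [weight, monopoles_eq_zero h]

open Classical in
theorem piPartitionFn_eq (hL : 4 ∣ L) (t β : ℝ) (a b : ℤˣ) : piPartitionFn L t β a b =
    (2 ^ (L ^ 2))⁻¹ * Real.exp (-(β * (L : ℝ) ^ 2)) *
      ∑ σ : Config L with IsPiFlux σ a b, weight t β σ := by
  rw [piPartitionFn, Finset.mul_sum]
  refine Finset.sum_congr rfl fun σ _ => ?_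
  rw [trace_one_add_parity_mul_exp_bgHam hL, exp_mul_evenTrace, mul_assoc]
  rw [show ((2 : ℂ) ^ (L ^ 2))⁻¹ = (((2 ^ (L ^ 2))⁻¹ : ℝ) : ℂ) by push_cast; rfl,
    ← Complex.ofReal_mul, Complex.ofReal_re]

theorem isPiFlux_gaugeTransform_eq (hL : 4 ∣ L) {σ τ : Config L} {a b : ℤˣ} (h : IsPiFlux σ a b)
    (h' : IsPiFlux τ a b) : ∃ g, τ = gaugeTransform g σ := by
  have h4 := four_le_of_four_dvd hL
  exact exists_gaugeTransform_of_flux_eq (by omega)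
    (fun x => by rw [h.1, h'.1]) (by rw [h.2.1, h'.2.1]) (by rw [h.2.2, h'.2.2])

theorem piExpect_eq (hL : 4 ∣ L) (t β : ℝ) (s : ℤˣ → ℤˣ → Config L) (O : TotalOp L) :
    piExpect t β s O = (∑ a : ℤˣ, ∑ b : ℤˣ, evenInsertion t β O (s a b)) /
      ((∑ a : ℤˣ, ∑ b : ℤˣ, evenTrace (β * t) (s a b) : ℝ) : ℂ) := by
  have h1 : ∀ σ : Config L, (NormedSpace.exp (((-β : ℝ) : ℂ) • fermiHam t σ) * evalAt O σ *
      (1 + parity L)).trace = evenInsertion t β O σ := by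
    intro σ
    rw [evenInsertion]
    have hc : (1 + parity L) * NormedSpace.exp (((-β : ℝ) : ℂ) • fermiHam t σ) =
        NormedSpace.exp (((-β : ℝ) : ℂ) • fermiHam t σ) * (1 + parity L) := by
      rw [Matrix.mul_add, Matrix.add_mul, (commute_parity_exp_fermiHam t _ σ).eq]; simp
    rw [Matrix.trace_mul_comm, ← Matrix.mul_assoc, hc, Matrix.mul_assoc, Matrix.trace_mul_comm,
      Matrix.mul_assoc]
  have h2 : ∀ σ : Config L, (NormedSpace.exp (((-β : ℝ) : ℂ) • fermiHam t σ) *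
      (1 + parity L)).trace = (evenTrace (β * t) σ : ℂ) := by
    intro σ
    rw [Matrix.trace_mul_comm, trace_one_add_parity_mul_exp hL]
  unfold piExpect
  simp only [h1, h2]
  push_cast
  rfl

/-! ### Sums over even sets of monopoles -/

/-- `∑ ε^{#A}` over the nonempty sets of plaquettes with an even number of elements. -/
def evenSum (L : ℕ) [NeZero L] (ε : ℝ) : ℝ :=
  ∑ A : Finset (Site L) with A.Nonempty ∧ Even A.card, ε ^ A.card

theorem sum_pow_card (ε : ℝ) : ∑ A : Finset (Site L), ε ^ A.card = (1 + ε) ^ (L ^ 2) := by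
  have := Fintype.sum_pow_mul_eq_add_pow (Site L) ε 1
  simp only [one_pow, mul_one] at this
  rw [this, card_site, add_comm]

theorem one_add_evenSum (ε : ℝ) :
    2 * (1 + evenSum L ε) = (1 + ε) ^ (L ^ 2) + (1 - ε) ^ (L ^ 2) := by
  have h1 : 1 + evenSum L ε = ∑ A : Finset (Site L) with Even A.card, ε ^ A.card := by
    have hmem : (∅ : Finset (Site L)) ∉
        Finset.univ.filter fun A : Finset (Site L) => A.Nonempty ∧ Even A.card := by simp
    have h2 : (Finset.univ.filter fun A : Finset (Site L) => Even A.card) =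
        insert ∅ (Finset.univ.filter fun A : Finset (Site L) => A.Nonempty ∧ Even A.card) := by
      ext A
      rcases A.eq_empty_or_nonempty with rfl | h
      · simp
      · simp [h, h.ne_empty]
    rw [h2, Finset.sum_insert hmem, evenSum]
    simp
  rw [h1, ← sum_pow_card, sub_eq_add_neg, ← sum_pow_card, ← Finset.sum_add_distrib, Finset.sum_filter,
    Finset.mul_sum]
  refine Finset.sum_congr rfl fun A _ => ?_
  split_ifs with h
  · rw [h.neg_pow]; ring
  · rw [(Nat.not_even_iff_odd.1 h).neg_pow]; ring

theorem evenSum_nonneg {ε : ℝ} (hε : 0 ≤ ε) : 0 ≤ evenSum L ε :=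
  Finset.sum_nonneg fun _ _ => pow_nonneg hε _

theorem evenSum_le {ε : ℝ} (hε : 0 ≤ ε) : evenSum L ε ≤ (1 + ε) ^ (L ^ 2) - 1 := by
  rw [← sum_pow_card, ← Finset.add_sum_erase _ _ (Finset.mem_univ (∅ : Finset (Site L)))]
  simp only [Finset.card_empty, pow_zero, add_sub_cancel_left]
  refine Finset.sum_le_sum_of_subset_of_nonneg ?_ fun _ _ _ => pow_nonneg hε _
  intro A hA
  have := (Finset.mem_filter.1 hA).2.1.ne_empty
  simpa using this

/-- The set of the plaquettes without `π` flux. -/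
def monopoleSet (σ : Config L) : Finset (Site L) := Finset.univ.filter fun x => flux σ x ≠ -1

theorem card_monopoleSet (σ : Config L) : (monopoleSet σ).card = monopoles σ := by
  rw [monopoleSet, monopoles, Finset.card_filter]

theorem flux_eq_of_monopoleSet {σ : Config L} {A : Finset (Site L)} (h : monopoleSet σ = A)
    (x : Site L) : flux σ x = -flipOn A x := by
  subst h
  rcases Int.units_eq_one_or (flux σ x) with h | h <;> simp [flipOn, monopoleSet, h]

theorem monopoles_eq_zero_iff (σ : Config L) : monopoles σ = 0 ↔ ∀ x, flux σ x = -1 := by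
  rw [← card_monopoleSet, Finset.card_eq_zero, monopoleSet, Finset.filter_eq_empty_iff]
  simp

open Classical in
theorem sum_isPiFlux {M : Type*} [AddCommMonoid M] (f : Config L → M) :
    ∑ a : ℤˣ, ∑ b : ℤˣ, ∑ σ : Config L with IsPiFlux σ a b, f σ =
      ∑ σ : Config L with monopoles σ = 0, f σ := by
  simp only [Finset.sum_filter]
  rw [Finset.sum_congr rfl fun a _ => Finset.sum_comm, Finset.sum_comm]
  refine Finset.sum_congr rfl fun σ _ => ?_
  by_cases h : monopoles σ = 0
  · have h' := (monopoles_eq_zero_iff σ).1 h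
    simp only [IsPiFlux, if_pos h]
    rw [Finset.sum_eq_single (fluxA σ), Finset.sum_eq_single (fluxB σ)]
    · simp [h']
    · intro b _ hb; simp [hb.symm]
    · intro h; exact absurd (Finset.mem_univ _) h
    · intro a _ ha; simp [ha.symm]
    · intro h; exact absurd (Finset.mem_univ _) h
  · rw [if_neg h]
    refine Finset.sum_eq_zero fun a _ => Finset.sum_eq_zero fun b _ => ?_
    rw [if_neg]
    exact fun h' => h ((monopoles_eq_zero_iff σ).2 h'.1)

open Classical in
/-- The number of gauge fields of the `π`-flux phase with antiperiodic fluxes. -/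
def piCount (L : ℕ) [NeZero L] : ℕ := (Finset.univ.filter fun σ : Config L => IsPiFlux σ (-1) (-1)).card

open Classical in
theorem card_isPiFlux (hL : 4 ∣ L) (a b : ℤˣ) :
    (Finset.univ.filter fun σ : Config L => IsPiFlux σ a b).card = piCount L := by
  have h : ∀ a b a' b' : ℤˣ, (Finset.univ.filter fun σ : Config L => IsPiFlux σ a b).card ≤
      (Finset.univ.filter fun σ : Config L => IsPiFlux σ a' b').card := by
    intro a b a' b'
    refine le_trans (Finset.card_le_card ?_) (card_flux_le hL (fun _ => -1) a b a' b')
    intro σ hσ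
    exact Finset.mem_filter.2 ⟨Finset.mem_univ _, (Finset.mem_filter.1 hσ).2⟩
  exact le_antisymm (h _ _ _ _) (h _ _ _ _)

theorem piCount_pos (hL : 4 ∣ L) : 0 < piCount L := by
  classical
  exact Finset.card_pos.2 ⟨twistedField (-1) (-1), by simpa using isPiFlux_twistedField hL _ _⟩

open Classical in
theorem sum_isPiFlux_of_gaugeInvariant (hL : 4 ∣ L) {M : Type*} [AddCommMonoid M] {f : Config L → M}
    (hf : ∀ g σ, f (gaugeTransform g σ) = f σ) {σ₀ : Config L} {a b : ℤˣ} (h : IsPiFlux σ₀ a b) :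
    ∑ σ : Config L with IsPiFlux σ a b, f σ = piCount L • f σ₀ := by
  rw [← card_isPiFlux hL a b, ← Finset.sum_const]
  refine Finset.sum_congr rfl fun σ hσ => ?_
  obtain ⟨g, rfl⟩ := isPiFlux_gaugeTransform_eq hL h (Finset.mem_filter.1 hσ).2
  rw [hf]

theorem sum_monopoles_eq_zero (hL : 4 ∣ L) {M : Type*} [AddCommMonoid M] {f : Config L → M}
    (hf : ∀ g σ, f (gaugeTransform g σ) = f σ) {s : ℤˣ → ℤˣ → Config L}
    (h : ∀ a b, IsPiFlux (s a b) a b) :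
    ∑ σ : Config L with monopoles σ = 0, f σ = piCount L • ∑ a : ℤˣ, ∑ b : ℤˣ, f (s a b) := by
  rw [← sum_isPiFlux, Finset.smul_sum]
  refine Finset.sum_congr rfl fun a _ => ?_
  rw [Finset.smul_sum]
  exact Finset.sum_congr rfl fun b _ => sum_isPiFlux_of_gaugeInvariant hL hf (h a b)

theorem sum_monopoles_ne_zero_le (hL : 4 ∣ L) {f : Config L → ℝ} {ε w : ℝ} (hε : 0 ≤ ε) (hw : 0 ≤ w)
    (h : ∀ σ, monopoles σ ≠ 0 → f σ ≤ ε ^ monopoles σ * w) :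
    ∑ σ : Config L with ¬ monopoles σ = 0, f σ ≤ 4 * (piCount L * w) * evenSum L ε := by
  classical
  set T : Finset (Finset (Site L) × ℤˣ × ℤˣ) :=
    (Finset.univ.filter fun A : Finset (Site L) => A.Nonempty ∧ Even A.card) ×ˢ Finset.univ with hT
  set key : Config L → Finset (Site L) × ℤˣ × ℤˣ := fun σ => (monopoleSet σ, fluxA σ, fluxB σ) with hkey
  have hmaps : ∀ σ ∈ Finset.univ.filter fun σ : Config L => ¬ monopoles σ = 0, key σ ∈ T := by
    intro σ hσ
    have h1 := (Finset.mem_filter.1 hσ).2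
    rw [hT, Finset.mem_product]
    refine ⟨Finset.mem_filter.2 ⟨Finset.mem_univ _, ?_, ?_⟩, Finset.mem_univ _⟩
    · rw [← Finset.card_pos, card_monopoleSet]; exact Nat.pos_of_ne_zero h1
    · rw [card_monopoleSet]; exact even_monopoles hL σ
  rw [← Finset.sum_fiberwise_of_maps_to hmaps]
  have hfib : ∀ k ∈ T, ∑ σ ∈ (Finset.univ.filter fun σ : Config L => ¬ monopoles σ = 0) with key σ = k,
      f σ ≤ piCount L * w * ε ^ k.1.card := by
    rintro ⟨A, a, b⟩ -
    calc _ ≤ ∑ σ ∈ (Finset.univ.filter fun σ : Config L => ¬ monopoles σ = 0) with key σ = (A, a, b),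
          ε ^ A.card * w := by
          refine Finset.sum_le_sum fun σ hσ => ?_
          have h1 := Finset.mem_filter.1 hσ
          have h2 := h σ (Finset.mem_filter.1 h1.1).2
          rwa [← card_monopoleSet, show monopoleSet σ = A from congrArg Prod.fst h1.2] at h2
      _ = (((Finset.univ.filter fun σ : Config L => ¬ monopoles σ = 0).filter
            fun σ => key σ = (A, a, b)).card : ℝ) * (ε ^ A.card * w) := by
          rw [Finset.sum_const, nsmul_eq_mul]
      _ ≤ (piCount L : ℝ) * (ε ^ A.card * w) := by
          refine mul_le_mul_of_nonneg_right (Nat.cast_le.2 ?_) (by positivity)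
          refine le_trans (Finset.card_le_card ?_)
            (card_flux_le hL (fun x => -flipOn A x) a b (-1) (-1))
          intro σ hσ
          have h1 := (Finset.mem_filter.1 hσ).2
          simp only [hkey, Prod.mk.injEq] at h1
          simp only [Finset.mem_filter, Finset.mem_univ, true_and]
          exact ⟨flux_eq_of_monopoleSet h1.1, h1.2.1, h1.2.2⟩
      _ = _ := by ring
  refine (Finset.sum_le_sum hfib).trans (le_of_eq ?_)
  rw [hT, Finset.sum_product, evenSum, Finset.mul_sum]
  refine Finset.sum_congr rfl fun A _ => ?_
  simp only [Finset.sum_const, Finset.card_univ, Fintype.card_prod, Fintype.card_units_int,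
    nsmul_eq_mul]
  push_cast; ring

/-! ### Stability of the `π`-flux phase -/

/-- The gap of a single monopole, in units of the hopping amplitude. -/
def gapConst : ℝ := 5 / 128 ^ 4

/-- The finite temperature and finite volume gap. -/
def gap (t β : ℝ) (L : ℕ) : ℝ := if 8 ≤ L then gapConst * t - 1 / β else -1 - 1 / β

theorem tendsto_gap (t : ℝ) :
    Tendsto (fun p : ℝ × ℕ => gap t p.1 p.2) (atTop ×ˢ atTop) (𝓝 (gapConst * t)) := by
  have h1 : Tendsto (fun p : ℝ × ℕ => gapConst * t - 1 / p.1) (atTop ×ˢ atTop)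
      (𝓝 (gapConst * t - 0)) :=
    tendsto_const_nhds.sub ((tendsto_const_nhds.div_atTop tendsto_id).comp tendsto_fst)
  rw [sub_zero] at h1
  refine h1.congr' ?_
  filter_upwards [tendsto_snd.eventually (eventually_ge_atTop 8)] with p hp
  rw [gap, if_pos hp]

theorem evenTrace_pos (hL : 4 ∣ L) {c : ℝ} (hc : 0 ≤ c) (σ : Config L) : 0 < evenTrace c σ :=
  (coshProd_pos c σ).trans_le (coshProd_le_evenTrace hL hc σ)

theorem weight_le_exp_gap (hL : 4 ∣ L) {t β : ℝ} (hβ : 0 < β) (ht : 1 ≤ gapConst * t) (ht0 : 0 < t)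
    {σ₀ : Config L} (h₀ : IsPiFlux σ₀ (-1) (-1)) {σ : Config L} (hσ : monopoles σ ≠ 0) :
    weight t β σ ≤ Real.exp (-β * (gap t β L - 1)) ^ monopoles σ * evenTrace (β * t) σ₀ := by
  have hc : 0 < β * t := mul_pos hβ ht0
  have hk : 2 ≤ monopoles σ := by
    have := even_monopoles hL σ
    rcases this with ⟨r, hr⟩
    omega
  have hk' : (2 : ℝ) ≤ monopoles σ := by exact_mod_cast hk
  have h2 : (2 : ℝ) ≤ Real.exp (monopoles σ / 2) := by
    have := Real.add_one_le_exp ((monopoles σ : ℝ) / 2)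
    linarith
  obtain ⟨r, hr, hrr⟩ : ∃ r : ℝ, coshProd (β * t) σ ≤ Real.exp r * coshProd (β * t) σ₀ ∧
      2 * β * monopoles σ + monopoles σ / 2 + r ≤ monopoles σ * (-β * (gap t β L - 1)) := by
    unfold gap
    split_ifs with h8
    · refine ⟨_, coshProd_le_exp_monopoles hL h8 h₀ hc σ, ?_⟩
      have e : (monopoles σ : ℝ) * (-β * (gapConst * t - 1 / β - 1)) =
          monopoles σ * (-(β * (gapConst * t)) + 1 + β) := by field_simp; ring
      have e2 : 2 * β * monopoles σ + monopoles σ / 2 +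
          -(monopoles σ * (10 * (β * t) - 2) / 128 ^ 4) =
          monopoles σ * (2 * β + 1 / 2 - 2 * (β * (gapConst * t)) + 2 / 128 ^ 4) := by
        rw [gapConst]; ring
      rw [e, e2]
      refine mul_le_mul_of_nonneg_left ?_ (by positivity)
      have : β * 1 ≤ β * (gapConst * t) := mul_le_mul_of_nonneg_left ht hβ.le
      norm_num
      linarith
    · refine ⟨0, by simpa using coshProd_le_of_isPiFlux hL h₀ hc σ, ?_⟩
      have e : (monopoles σ : ℝ) * (-β * (-1 - 1 / β - 1)) = 2 * β * monopoles σ + monopoles σ := by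
        field_simp; ring
      rw [e]
      linarith
  calc weight t β σ ≤ Real.exp (2 * β * monopoles σ) * (2 * coshProd (β * t) σ) :=
        mul_le_mul_of_nonneg_left (evenTrace_le _ _) (Real.exp_pos _).le
    _ ≤ Real.exp (2 * β * monopoles σ) *
          (Real.exp (monopoles σ / 2) * (Real.exp r * evenTrace (β * t) σ₀)) := by
        gcongr
        · exact (coshProd_pos _ _).le
        · exact hr.trans (mul_le_mul_of_nonneg_left (coshProd_le_evenTrace hL hc.le σ₀)
            (Real.exp_pos _).le)
    _ = Real.exp (2 * β * monopoles σ + monopoles σ / 2 + r) * evenTrace (β * t) σ₀ := by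
        rw [Real.exp_add, Real.exp_add]; ring
    _ ≤ Real.exp (monopoles σ * (-β * (gap t β L - 1))) * evenTrace (β * t) σ₀ :=
        mul_le_mul_of_nonneg_right (Real.exp_le_exp.2 hrr) (evenTrace_pos hL hc.le σ₀).le
    _ = _ := by rw [Real.exp_nat_mul]

theorem monopoles_gaugeTransform (g : Site L → ℤˣ) (σ : Config L) :
    monopoles (gaugeTransform g σ) = monopoles σ := by
  have h : ∀ x, flux (gaugeTransform g 1) x = 1 := by
    intro x
    have e : x + unitVec L 0 + unitVec L 1 = x + unitVec L 1 + unitVec L 0 := by abel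
    simp only [flux, gaugeTransform, Pi.one_apply, mul_one, e]
    have hu : ∀ u v w z : ℤˣ, u * v * (v * w) * (z * w) * (u * z) = 1 := by decide
    exact hu _ _ _ _
  unfold monopoles
  refine Finset.sum_congr rfl fun x _ => ?_
  rw [gaugeTransform_eq_mul, flux_mul, h, one_mul]

theorem weight_gaugeTransform (hL : 4 ∣ L) (t β : ℝ) (g : Site L → ℤˣ) (σ : Config L) :
    weight t β (gaugeTransform g σ) = weight t β σ := by
  rw [weight, weight, monopoles_gaugeTransform, evenTrace_gaugeTransform hL]

theorem weight_pos (hL : 4 ∣ L) {t β : ℝ} (hc : 0 ≤ β * t) (σ : Config L) : 0 < weight t β σ :=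
  mul_pos (Real.exp_pos _) (evenTrace_pos hL hc σ)

theorem sum_weight_monopoles_eq_zero (hL : 4 ∣ L) (t β : ℝ) {s : ℤˣ → ℤˣ → Config L}
    (h : ∀ a b, IsPiFlux (s a b) a b) : ∑ σ : Config L with monopoles σ = 0, weight t β σ =
      piCount L * ∑ a : ℤˣ, ∑ b : ℤˣ, evenTrace (β * t) (s a b) := by
  rw [sum_monopoles_eq_zero hL (weight_gaugeTransform hL t β) h, nsmul_eq_mul]
  simp only [weight_of_isPiFlux t β (h _ _)]

theorem sum_weight_monopoles_eq_zero_pos (hL : 4 ∣ L) {t β : ℝ} (hc : 0 ≤ β * t) :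
    0 < ∑ σ : Config L with monopoles σ = 0, weight t β σ := by
  refine Finset.sum_pos (fun σ _ => weight_pos hL hc σ) ⟨twistedField 1 1, ?_⟩
  simpa using monopoles_eq_zero (isPiFlux_twistedField hL 1 1)

theorem sum_weight_monopoles_ne_zero_le (hL : 4 ∣ L) {t β : ℝ} (hβ : 0 < β) (ht : 1 ≤ gapConst * t)
    (ht0 : 0 < t) : ∑ σ : Config L with ¬ monopoles σ = 0, weight t β σ ≤
      4 * evenSum L (Real.exp (-β * (gap t β L - 1))) *
        ∑ σ : Config L with monopoles σ = 0, weight t β σ := by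
  have hc : 0 ≤ β * t := (mul_pos hβ ht0).le
  have h₀ : IsPiFlux (twistedField (-1) (-1) : Config L) (-1) (-1) := isPiFlux_twistedField hL _ _
  have h1 := sum_monopoles_ne_zero_le hL (Real.exp_pos (-β * (gap t β L - 1))).le
    (evenTrace_pos hL hc (twistedField (-1) (-1))).le
    (fun σ hσ => weight_le_exp_gap hL hβ ht ht0 h₀ hσ)
  refine h1.trans ?_
  rw [sum_weight_monopoles_eq_zero hL t β (s := fun a b => twistedField a b)
    (fun a b => isPiFlux_twistedField hL a b), mul_right_comm]
  have hp : ∀ a b : ℤˣ, 0 ≤ evenTrace (β * t) (twistedField a b : Config L) :=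
    fun a b => (evenTrace_pos hL hc _).le
  have h2 : evenTrace (β * t) (twistedField (-1) (-1) : Config L) ≤
      ∑ a : ℤˣ, ∑ b : ℤˣ, evenTrace (β * t) (twistedField a b : Config L) :=
    (Finset.single_le_sum (f := fun b => evenTrace (β * t) (twistedField (-1) b : Config L))
      (fun b _ => hp (-1) b) (Finset.mem_univ (-1))).trans
      (Finset.single_le_sum (f := fun a => ∑ b : ℤˣ, evenTrace (β * t) (twistedField a b : Config L))
        (fun a _ => Finset.sum_nonneg fun b _ => hp a b) (Finset.mem_univ (-1)))
  have h3 := evenSum_nonneg (L := L) (Real.exp_pos (-β * (gap t β L - 1))).le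
  gcongr

theorem freeEnergy_sub_eq (hL : 4 ∣ L) {t β : ℝ} (hβ : 0 < β) (ht0 : 0 < t) :
    β * (L : ℝ) ^ 2 * (piFreeEnergy L t β - freeEnergy L t β) =
      Real.log ((∑ σ : Config L, weight t β σ) /
        ∑ σ : Config L with monopoles σ = 0, weight t β σ) := by
  have hc : 0 ≤ β * t := (mul_pos hβ ht0).le
  have hL0 : (L : ℝ) ≠ 0 := Nat.cast_ne_zero.2 (NeZero.ne L)
  have hZ0 := sum_weight_monopoles_eq_zero_pos hL hc
  have hZ : 0 < ∑ σ : Config L, weight t β σ :=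
    Finset.sum_pos (fun σ _ => weight_pos hL hc σ) Finset.univ_nonempty
  have hA : 0 < ((2 : ℝ) ^ (L ^ 2))⁻¹ * Real.exp (-(β * (L : ℝ) ^ 2)) := by positivity
  rw [piFreeEnergy, freeEnergy, partitionFn_eq hL]
  simp only [piPartitionFn_eq hL, ← Finset.mul_sum]
  rw [sum_isPiFlux, Real.log_mul hA.ne' hZ0.ne', Real.log_mul hA.ne' hZ.ne', Real.log_div hZ.ne' hZ0.ne']
  field_simp
  ring

theorem freeEnergy_bounds (hL : 4 ∣ L) {t β : ℝ} (hβ : 0 < β) (ht : 1 ≤ gapConst * t) (ht0 : 0 < t) :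
    0 ≤ β * (L : ℝ) ^ 2 * (piFreeEnergy L t β - freeEnergy L t β) ∧
      β * (L : ℝ) ^ 2 * (piFreeEnergy L t β - freeEnergy L t β) ≤
        Real.log ((1 + Real.exp (-β * (gap t β L - 1))) ^ (L ^ 2) +
          (1 - Real.exp (-β * (gap t β L - 1))) ^ (L ^ 2)) + Real.log 2 := by
  have hc : 0 ≤ β * t := (mul_pos hβ ht0).le
  have hZ0 := sum_weight_monopoles_eq_zero_pos hL hc
  have hZ1 := sum_weight_monopoles_ne_zero_le hL hβ ht ht0
  have hZ1' : 0 ≤ ∑ σ : Config L with ¬ monopoles σ = 0, weight t β σ :=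
    Finset.sum_nonneg fun σ _ => (weight_pos hL hc σ).le
  have hF := evenSum_nonneg (L := L) (Real.exp_pos (-β * (gap t β L - 1))).le
  rw [freeEnergy_sub_eq hL hβ ht0, ← one_add_evenSum, ← Finset.sum_filter_add_sum_filter_not
    Finset.univ (fun σ : Config L => monopoles σ = 0), ← Real.log_mul (by positivity) (by norm_num)]
  constructor
  · refine Real.log_nonneg ?_
    rw [le_div_iff₀ hZ0]
    linarith
  · refine Real.log_le_log (by positivity) ?_
    rw [div_le_iff₀ hZ0]
    nlinarith

theorem norm_div_sub_div_le {A₀ A₁ : ℂ} {Z₀ Z₁ M : ℝ} (hZ₀ : 0 < Z₀) (hZ₁ : 0 ≤ Z₁) (h₀ : ‖A₀‖ ≤ M * Z₀)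
    (h₁ : ‖A₁‖ ≤ M * Z₁) :
    ‖(A₀ + A₁) / ((Z₀ + Z₁ : ℝ) : ℂ) - A₀ / (Z₀ : ℂ)‖ ≤ 2 * M * (Z₁ / Z₀) := by
  have hM : 0 ≤ M := by
    by_contra h
    push Not at h
    nlinarith [norm_nonneg A₀]
  have hZ : 0 < Z₀ + Z₁ := by linarith
  have e : (A₀ + A₁) / ((Z₀ + Z₁ : ℝ) : ℂ) - A₀ / (Z₀ : ℂ) =
      (A₁ * (Z₀ : ℂ) - A₀ * (Z₁ : ℂ)) / (((Z₀ + Z₁) * Z₀ : ℝ) : ℂ) := by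
    have h1 : ((Z₀ + Z₁ : ℝ) : ℂ) ≠ 0 := Complex.ofReal_ne_zero.2 hZ.ne'
    have h2 : (Z₀ : ℂ) ≠ 0 := Complex.ofReal_ne_zero.2 hZ₀.ne'
    rw [div_sub_div _ _ h1 h2]
    push_cast
    congr 1; ring
  rw [e, norm_div, Complex.norm_real, Real.norm_of_nonneg (by positivity), div_le_iff₀ (by positivity)]
  calc _ ≤ ‖A₁‖ * Z₀ + ‖A₀‖ * Z₁ := by
        refine (norm_sub_le _ _).trans (le_of_eq ?_)
        rw [norm_mul, norm_mul, Complex.norm_real, Complex.norm_real, Real.norm_of_nonneg hZ₀.le,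
          Real.norm_of_nonneg hZ₁]
    _ ≤ M * Z₁ * Z₀ + M * Z₀ * Z₁ := by gcongr
    _ = 2 * M * (Z₁ / Z₀) * (Z₀ * Z₀) := by field_simp; ring
    _ ≤ _ := by
        refine mul_le_mul_of_nonneg_left ?_ (by positivity)
        nlinarith

theorem norm_gibbs_sub_piExpect_le (hL : 4 ∣ L) {t β : ℝ} (hβ : 0 < β) (ht : 1 ≤ gapConst * t)
    (ht0 : 0 < t) {O : TotalOp L} (hO : IsMagneticGaugeInvariant O) {s : ℤˣ → ℤˣ → Config L}
    (hs : ∀ a b, IsPiFlux (s a b) a b) : ‖gibbs t β O - piExpect t β s O‖ ≤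
      8 * maxNorm O * ((1 + Real.exp (-β * (gap t β L - 1))) ^ (L ^ 2) - 1) := by
  have hc : 0 ≤ β * t := (mul_pos hβ ht0).le
  have hε := (Real.exp_pos (-β * (gap t β L - 1))).le
  have hZ0 := sum_weight_monopoles_eq_zero_pos hL hc
  have hZ1 := sum_weight_monopoles_ne_zero_le hL hβ ht ht0
  have hZ1' : 0 ≤ ∑ σ : Config L with ¬ monopoles σ = 0, weight t β σ :=
    Finset.sum_nonneg fun σ _ => (weight_pos hL hc σ).le
  have hM : ∀ σ, ‖Matrix.toEuclideanCLM (n := Occ L) (𝕜 := ℂ) (evalAt O σ)‖ ≤ maxNorm O := fun σ =>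
    le_ciSup (f := fun σ : Config L => ‖Matrix.toEuclideanCLM (n := Occ L) (𝕜 := ℂ) (evalAt O σ)‖)
      (Set.finite_range _).bddAbove σ
  have hM0 : 0 ≤ maxNorm O := (norm_nonneg _).trans (hM 1)
  have hterm : ∀ σ, ‖(Real.exp (2 * β * monopoles σ) : ℂ) * evenInsertion t β O σ‖ ≤
      maxNorm O * weight t β σ := by
    intro σ
    rw [norm_mul, Complex.norm_real, Real.norm_of_nonneg (Real.exp_pos _).le, weight, mul_left_comm]
    refine mul_le_mul_of_nonneg_left ?_ (Real.exp_pos _).le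
    exact (norm_evenInsertion_le hL t β O σ).trans
      (mul_le_mul_of_nonneg_right (hM σ) (evenTrace_pos hL hc σ).le)
  have hsum : ∀ S : Finset (Config L),
      ‖∑ σ ∈ S, (Real.exp (2 * β * monopoles σ) : ℂ) * evenInsertion t β O σ‖ ≤
        maxNorm O * ∑ σ ∈ S, weight t β σ := by
    intro S
    rw [Finset.mul_sum]
    exact (norm_sum_le _ _).trans (Finset.sum_le_sum fun σ _ => hterm σ)
  have hpi : piExpect t β s O = (∑ σ : Config L with monopoles σ = 0,
      (Real.exp (2 * β * monopoles σ) : ℂ) * evenInsertion t β O σ) /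
        ((∑ σ : Config L with monopoles σ = 0, weight t β σ : ℝ) : ℂ) := by
    rw [sum_weight_monopoles_eq_zero hL t β hs, sum_monopoles_eq_zero hL (fun g σ => by
      rw [monopoles_gaugeTransform, evenInsertion_gaugeTransform t β hO.2]) hs, nsmul_eq_mul,
      piExpect_eq hL, Complex.ofReal_mul, Complex.ofReal_natCast,
      mul_div_mul_left _ _ (Nat.cast_ne_zero.2 (piCount_pos hL).ne')]
    simp [monopoles_eq_zero (hs _ _)]
  rw [gibbs_eq hL t β (eq_blockDiagonal_of_mem_adjoin hO.1), hpi,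
    ← Finset.sum_filter_add_sum_filter_not Finset.univ (fun σ : Config L => monopoles σ = 0),
    ← Finset.sum_filter_add_sum_filter_not Finset.univ (fun σ : Config L => monopoles σ = 0)
      (fun σ => weight t β σ)]
  refine (norm_div_sub_div_le hZ0 hZ1' (hsum _) (hsum _)).trans ?_
  calc _ ≤ 2 * maxNorm O * (4 * evenSum L (Real.exp (-β * (gap t β L - 1)))) := by
        refine mul_le_mul_of_nonneg_left ?_ (by positivity)
        rwa [div_le_iff₀ hZ0]
    _ = 8 * maxNorm O * evenSum L (Real.exp (-β * (gap t β L - 1))) := by ring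
    _ ≤ _ := mul_le_mul_of_nonneg_left (evenSum_le hε) (by positivity)

/-! ### Ground state energies -/

theorem le_of_forall_exp_le {a b C : ℝ}
    (h : ∀ β : ℝ, 0 < β → Real.exp (β * a) ≤ C * Real.exp (β * b)) : a ≤ b := by
  by_contra hab
  push Not at hab
  have hC : 0 < C := by
    have := (Real.exp_pos _).trans_le (h 1 one_pos)
    exact (pos_iff_pos_of_mul_pos this).2 (Real.exp_pos _)
  have hδ : 0 < a - b := sub_pos.2 hab
  have h1 := h (C / (a - b)) (by positivity)
  have h2 : Real.exp (C / (a - b) * a) = Real.exp C * Real.exp (C / (a - b) * b) := by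
    rw [← Real.exp_add]; congr 1; field_simp; ring
  rw [h2] at h1
  have h3 := le_of_mul_le_mul_right h1 (Real.exp_pos _)
  linarith [Real.add_one_le_exp C]

/-- The trace norm of the hopping matrix. -/
def hopNorm (σ : Config L) : ℝ := ∑ x, |hopEig σ x|

theorem exp_le_coshProd {c : ℝ} (hc : 0 ≤ c) (σ : Config L) :
    Real.exp (c / 2 * hopNorm σ) ≤ coshProd c σ := by
  rw [hopNorm, Finset.mul_sum, Real.exp_sum]
  refine Finset.prod_le_prod (fun _ _ => (Real.exp_pos _).le) fun x _ => ?_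
  rw [← Real.cosh_abs, Real.cosh_eq, show |c * hopEig σ x / 2| = c / 2 * |hopEig σ x| by
    rw [show c * hopEig σ x / 2 = c / 2 * hopEig σ x by ring, abs_mul, abs_of_nonneg (by positivity)]]
  have := Real.exp_pos (-(c / 2 * |hopEig σ x|))
  linarith

theorem coshProd_le_exp {c : ℝ} (hc : 0 ≤ c) (σ : Config L) :
    coshProd c σ ≤ 2 ^ (L ^ 2) * Real.exp (c / 2 * hopNorm σ) := by
  rw [hopNorm, Finset.mul_sum, Real.exp_sum, coshProd, Finset.prod_mul_distrib, Finset.prod_const,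
    Finset.card_univ, card_site]
  refine mul_le_mul_of_nonneg_left ?_ (by positivity)
  refine Finset.prod_le_prod (fun _ _ => (Real.cosh_pos _).le) fun x _ => ?_
  rw [← Real.cosh_abs, Real.cosh_eq, show |c * hopEig σ x / 2| = c / 2 * |hopEig σ x| by
    rw [show c * hopEig σ x / 2 = c / 2 * hopEig σ x by ring, abs_mul, abs_of_nonneg (by positivity)]]
  have h0 : 0 ≤ c / 2 * |hopEig σ x| := by positivity
  have : Real.exp (-(c / 2 * |hopEig σ x|)) ≤ Real.exp (c / 2 * |hopEig σ x|) :=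
    Real.exp_le_exp.2 (by linarith)
  linarith

theorem hopNorm_gaugeTransform (hL : 4 ∣ L) (g : Site L → ℤˣ) (σ : Config L) :
    hopNorm (gaugeTransform g σ) = hopNorm σ := by
  have key : ∀ σ τ : Config L, (∀ c, evenTrace c σ = evenTrace c τ) → hopNorm σ ≤ hopNorm τ := by
    intro σ τ h
    have := le_of_forall_exp_le (a := hopNorm σ / 2) (b := hopNorm τ / 2) (C := 2 * 2 ^ (L ^ 2))
      fun β hβ => by
        have h1 := (exp_le_coshProd hβ.le σ).trans (coshProd_le_evenTrace hL hβ.le σ)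
        have h2 := (evenTrace_le β τ).trans
          (mul_le_mul_of_nonneg_left (coshProd_le_exp hβ.le τ) two_pos.le)
        rw [h β] at h1
        rw [show β * (hopNorm σ / 2) = β / 2 * hopNorm σ by ring,
          show β * (hopNorm τ / 2) = β / 2 * hopNorm τ by ring, mul_assoc]
        exact h1.trans h2
    linarith
  exact le_antisymm (key _ _ fun c => evenTrace_gaugeTransform hL c g σ)
    (key _ _ fun c => (evenTrace_gaugeTransform hL c g σ).symm)

theorem trace_exp_hermitian {n : Type*} [Fintype n] [DecidableEq n] {H : Matrix n n ℂ}
    (hH : H.IsHermitian) (β : ℝ) : (NormedSpace.exp (((-β : ℝ) : ℂ) • H)).trace =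
      ((∑ i, Real.exp (-β * hH.eigenvalues i) : ℝ) : ℂ) := by
  obtain ⟨U, hU', hU, hs⟩ := exists_unitary_diagonalization hH
  rw [exp_smul_hermitian hU hs, Matrix.trace_mul_comm, ← Matrix.mul_assoc, hU', Matrix.one_mul,
    Matrix.trace_diagonal]
  push_cast
  rfl

/-- The lowest eigenvalue of a free fermionic Hamiltonian. -/
theorem isLeast_spectrum_fermiHam (hL : 4 ∣ L) {t : ℝ} (ht : 0 < t) (σ : Config L) :
    IsLeast {x : ℝ | (x : ℂ) ∈ spectrum ℂ (fermiHam t σ)} (-(t / 2 * hopNorm σ)) := by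
  have hH := fermiHam_isHermitian t σ
  have hspec : {x : ℝ | (x : ℂ) ∈ spectrum ℂ (fermiHam t σ)} = Set.range hH.eigenvalues := by
    ext x
    rw [Set.mem_ofPred_eq, hH.spectrum_eq_image_range]
    constructor
    · rintro ⟨y, hy, hxy⟩
      have : y = x := Complex.ofReal_injective hxy
      exact this ▸ hy
    · intro h; exact ⟨x, h, rfl⟩
  have htr : ∀ β : ℝ, ∑ i, Real.exp (-β * hH.eigenvalues i) = coshProd (β * t) σ := by
    intro β
    have h1 := trace_exp_hermitian hH β
    rw [trace_exp_fermiHam, prod_one_add_exp hL] at h1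
    exact_mod_cast h1.symm
  obtain ⟨i₀, hi₀⟩ := Finite.exists_min hH.eigenvalues
  rw [hspec]
  have hmin : hH.eigenvalues i₀ = -(t / 2 * hopNorm σ) := by
    apply le_antisymm
    · have := le_of_forall_exp_le (a := t / 2 * hopNorm σ) (b := -hH.eigenvalues i₀)
        (C := Fintype.card (Occ L)) fun β hβ => by
          calc _ = Real.exp (β * t / 2 * hopNorm σ) := by congr 1; ring
            _ ≤ coshProd (β * t) σ := exp_le_coshProd (mul_pos hβ ht).le σ
            _ = ∑ i, Real.exp (-β * hH.eigenvalues i) := (htr β).symm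
            _ ≤ ∑ _i : Occ L, Real.exp (β * -hH.eigenvalues i₀) := by
              refine Finset.sum_le_sum fun i _ => Real.exp_le_exp.2 ?_
              have := mul_le_mul_of_nonneg_left (hi₀ i) hβ.le
              linarith
            _ = _ := by rw [Finset.sum_const, Finset.card_univ, nsmul_eq_mul]
      linarith
    · have := le_of_forall_exp_le (a := -hH.eigenvalues i₀) (b := t / 2 * hopNorm σ)
        (C := 2 ^ (L ^ 2)) fun β hβ => by
          calc _ = Real.exp (-β * hH.eigenvalues i₀) := by congr 1; ring
            _ ≤ ∑ i, Real.exp (-β * hH.eigenvalues i) :=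
              Finset.single_le_sum (f := fun i => Real.exp (-β * hH.eigenvalues i))
                (fun i _ => (Real.exp_pos _).le) (Finset.mem_univ i₀)
            _ = coshProd (β * t) σ := htr β
            _ ≤ _ := (coshProd_le_exp (mul_pos hβ ht).le σ).trans (le_of_eq (by congr 2; ring))
      linarith
  rw [← hmin]
  exact ⟨⟨i₀, rfl⟩, by rintro _ ⟨i, rfl⟩; exact hi₀ i⟩

theorem tendsto_neg_log_div {f : ℝ → ℝ} {a C D : ℝ} (hC : 0 < C)
    (h1 : ∀ β, 0 < β → C * Real.exp (β * a) ≤ f β) (h2 : ∀ β, 0 < β → f β ≤ D * Real.exp (β * a)) :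
    Tendsto (fun β : ℝ => -(1 / β) * Real.log (f β)) atTop (𝓝 (-a)) := by
  have hD : 0 < D := by
    have h3 := (mul_pos hC (Real.exp_pos (1 * a))).trans_le ((h1 1 one_pos).trans (h2 1 one_pos))
    exact (pos_iff_pos_of_mul_pos h3).2 (Real.exp_pos _)
  have hlim : ∀ K : ℝ, Tendsto (fun β : ℝ => -a - K / β) atTop (𝓝 (-a)) := by
    intro K
    have : Tendsto (fun β : ℝ => -a - K / β) atTop (𝓝 (-a - 0)) :=
      tendsto_const_nhds.sub (tendsto_const_nhds.div_atTop tendsto_id)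
    rwa [sub_zero] at this
  refine tendsto_of_tendsto_of_tendsto_of_le_of_le' (hlim (Real.log D)) (hlim (Real.log C)) ?_ ?_
  · filter_upwards [eventually_gt_atTop 0] with β hβ
    have hf : 0 < f β := (mul_pos hC (Real.exp_pos _)).trans_le (h1 β hβ)
    have := Real.log_le_log hf (h2 β hβ)
    rw [Real.log_mul hD.ne' (Real.exp_pos _).ne', Real.log_exp] at this
    rw [show -a - Real.log D / β = -(1 / β) * (Real.log D + β * a) by field_simp; ring]
    have hb : 0 < 1 / β := by positivity
    nlinarith
  · filter_upwards [eventually_gt_atTop 0] with β hβ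
    have := Real.log_le_log (mul_pos hC (Real.exp_pos _)) (h1 β hβ)
    rw [Real.log_mul hC.ne' (Real.exp_pos _).ne', Real.log_exp] at this
    rw [show -a - Real.log C / β = -(1 / β) * (Real.log C + β * a) by field_simp; ring]
    have hb : 0 < 1 / β := by positivity
    nlinarith

theorem tendsto_piPartitionFn (hL : 4 ∣ L) {t : ℝ} (ht : 0 < t) {σ : Config L} {a b : ℤˣ}
    (h : IsPiFlux σ a b) :
    Tendsto (fun β : ℝ => -(1 / β) * Real.log (piPartitionFn L t β a b)) atTop
      (𝓝 ((L : ℝ) ^ 2 - t / 2 * hopNorm σ)) := by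
  have hp : (0 : ℝ) < piCount L := Nat.cast_pos.2 (piCount_pos hL)
  have hZ : ∀ β, piPartitionFn L t β a b = (2 ^ (L ^ 2))⁻¹ * piCount L *
      (Real.exp (-(β * (L : ℝ) ^ 2)) * evenTrace (β * t) σ) := by
    intro β
    rw [piPartitionFn_eq hL, sum_isPiFlux_of_gaugeInvariant hL (weight_gaugeTransform hL t β) h,
      nsmul_eq_mul, weight_of_isPiFlux t β h]
    ring
  have he : ∀ β : ℝ, Real.exp (β * (-(L : ℝ) ^ 2 + t / 2 * hopNorm σ)) =
      Real.exp (-(β * (L : ℝ) ^ 2)) * Real.exp (β * t / 2 * hopNorm σ) := by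
    intro β; rw [← Real.exp_add]; congr 1; ring
  have := tendsto_neg_log_div (f := fun β => piPartitionFn L t β a b)
    (a := -(L : ℝ) ^ 2 + t / 2 * hopNorm σ) (C := (2 ^ (L ^ 2))⁻¹ * piCount L)
    (D := (2 ^ (L ^ 2))⁻¹ * piCount L * (2 * 2 ^ (L ^ 2))) (by positivity)
    (fun β hβ => by
      rw [hZ, he]
      have := (exp_le_coshProd (mul_pos hβ ht).le σ).trans
        (coshProd_le_evenTrace hL (mul_pos hβ ht).le σ)
      gcongr)
    (fun β hβ => by
      rw [hZ, he, mul_assoc (_ * _) (2 * _), mul_left_comm (2 * _)]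
      have := (evenTrace_le (β * t) σ).trans
        (mul_le_mul_of_nonneg_left (coshProd_le_exp (mul_pos hβ ht).le σ) two_pos.le)
      rw [← mul_assoc] at this
      gcongr)
  rwa [neg_add, neg_neg, ← sub_eq_add_neg] at this

/-! ### Twisted periodic chains -/

/-- The momentum shift of the boundary condition `a`. -/
def twist (a : ℤˣ) : ℝ := if a = 1 then 0 else 1 / 2

/-- The momenta of a chain with boundary condition `a`. -/
def momentum (L : ℕ) (a : ℤˣ) (j : ℕ) : ℝ := 2 * Real.pi * (j + twist a) / L

/-- The hopping strength at `x`. -/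
def twistedBond (a : ℤˣ) (x : ZMod L) : ℤˣ := if x.val + 1 = L then a else 1

/-- The hopping matrix of a chain with boundary condition `a`. -/
def chain (a : ℤˣ) : Matrix (ZMod L) (ZMod L) ℂ := Matrix.of fun x y =>
  (if y = x + 1 then ((twistedBond a x : ℤ) : ℂ) else 0) +
    (if x = y + 1 then ((twistedBond a y : ℤ) : ℂ) else 0)

/-- Plane waves. -/
def wave (a : ℤˣ) : Matrix (ZMod L) (ZMod L) ℂ := Matrix.of fun x j =>
  Complex.exp (x.val * (momentum L a j.val * Complex.I))

theorem exp_twist (a : ℤˣ) : Complex.exp (2 * Real.pi * twist a * Complex.I) = ((a : ℤ) : ℂ) := by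
  rcases Int.units_eq_one_or a with rfl | rfl
  · simp [twist]
  · rw [twist, if_neg (by decide)]
    rw [show (2 * Real.pi * ((1 / 2 : ℝ) : ℂ) * Complex.I) = Real.pi * Complex.I by push_cast; ring,
      Complex.exp_pi_mul_I]
    simp

theorem exp_momentum_mul (a : ℤˣ) (j : ℕ) :
    Complex.exp (L * (momentum L a j * Complex.I)) = ((a : ℤ) : ℂ) := by
  have hL : (L : ℂ) ≠ 0 := Nat.cast_ne_zero.2 (NeZero.ne L)
  have : (L : ℂ) * (momentum L a j * Complex.I) =
      j * (2 * Real.pi * Complex.I) + 2 * Real.pi * twist a * Complex.I := by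
    rw [momentum]; push_cast; field_simp
  rw [this, Complex.exp_add, Complex.exp_nat_mul, Complex.exp_two_pi_mul_I, one_pow, one_mul, exp_twist]

theorem twistedBond_mul_wave (hL : 2 ≤ L) (a : ℤˣ) (x j : ZMod L) :
    ((twistedBond a x : ℤ) : ℂ) * wave a (x + 1) j =
      Complex.exp (momentum L a j.val * Complex.I) * wave a x j := by
  simp only [wave, Matrix.of_apply]
  rw [← Complex.exp_add]
  have h := (zmod_eq_add_one_iff hL x (x + 1)).1 rfl
  have hx := x.val_lt
  rcases h with h | h
  · have h1 : x.val + 1 ≠ L := by have := (x + 1).val_lt; omega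
    rw [twistedBond, if_neg h1, h]
    push_cast
    rw [one_mul]
    congr 1; ring
  · rw [twistedBond, if_pos (by omega), h.2, ← exp_momentum_mul (L := L) a j.val, ← Complex.exp_add]
    congr 1
    have : (L : ℂ) = x.val + 1 := by
      have : L = x.val + 1 := by omega
      exact_mod_cast congrArg (fun k : ℕ => (k : ℂ)) this
    rw [this]; push_cast; ring

theorem chain_mul_wave (hL : 2 ≤ L) (a : ℤˣ) : chain a * wave a = wave a *
    Matrix.diagonal fun j : ZMod L => ((2 * Real.cos (momentum L a j.val) : ℝ) : ℂ) := by
  ext x j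
  have hc : ∀ y : ZMod L, ((twistedBond a y : ℤ) : ℂ) * ((twistedBond a y : ℤ) : ℂ) = 1 := fun y => by
    exact_mod_cast units_coe_mul_self (twistedBond a y)
  have e : ∀ y : ZMod L, (x = y + 1) = (y = x - 1) := fun y => by
    rw [eq_sub_iff_add_eq]; exact propext eq_comm
  rw [Matrix.mul_diagonal, Matrix.mul_apply]
  simp only [chain, Matrix.of_apply, add_mul, ite_mul, zero_mul, Finset.sum_add_distrib, e,
    Finset.sum_ite_eq', Finset.mem_univ, if_true]
  have h1 := twistedBond_mul_wave hL a x j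
  have h2 := twistedBond_mul_wave hL a (x - 1) j
  rw [sub_add_cancel] at h2
  have h3 : Complex.exp (-(momentum L a j.val * Complex.I)) *
      Complex.exp (momentum L a j.val * Complex.I) = 1 := by
    rw [← Complex.exp_add, neg_add_cancel, Complex.exp_zero]
  rw [h1, Complex.ofReal_mul, Complex.ofReal_cos, Complex.cos]
  push_cast
  rw [neg_mul]
  set E := Complex.exp (momentum L a j.val * Complex.I)
  set F := Complex.exp (-(momentum L a j.val * Complex.I))
  set c := ((twistedBond a (x - 1) : ℤ) : ℂ)
  linear_combination (-c * wave a (x - 1) j) * h3 - (F * c) * h2 + (F * wave a x j) * hc (x - 1)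

theorem wave_conjTranspose_mul (a : ℤˣ) :
    (wave a).conjTranspose * wave a = (L : ℂ) • (1 : Matrix (ZMod L) (ZMod L) ℂ) := by
  have hL : (L : ℂ) ≠ 0 := Nat.cast_ne_zero.2 (NeZero.ne L)
  ext j l
  rw [Matrix.mul_apply, Matrix.smul_apply, Matrix.one_apply, smul_eq_mul]
  have h : ∀ x : ZMod L, (wave a).conjTranspose j x * wave a x l = ZMod.stdAddChar (x * (l - j)) := by
    intro x
    have e : x * (l - j) = (((x.val : ℤ) * ((l.val : ℤ) - j.val) : ℤ) : ZMod L) := by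
      push_cast; simp
    rw [e, ZMod.stdAddChar_coe, Matrix.conjTranspose_apply]
    simp only [wave, Matrix.of_apply, Complex.star_def]
    rw [← Complex.exp_conj, ← Complex.exp_add]
    congr 1
    simp only [map_mul, Complex.conj_I, Complex.conj_ofReal, map_natCast, momentum]
    push_cast
    field_simp
    ring
  simp only [h]
  rw [AddChar.sum_mulShift _ (ZMod.isPrimitive_stdAddChar L), ZMod.card]
  by_cases hjl : j = l
  · subst hjl; simp
  · rw [if_neg (sub_ne_zero.2 (Ne.symm hjl)), if_neg hjl]; simp

theorem det_wave_ne_zero (a : ℤˣ) : (wave a : Matrix (ZMod L) (ZMod L) ℂ).det ≠ 0 := by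
  intro h
  have h1 := congrArg Matrix.det (wave_conjTranspose_mul (L := L) a)
  rw [Matrix.det_mul, h, mul_zero, Matrix.det_smul, Matrix.det_one, mul_one] at h1
  exact pow_ne_zero _ (Nat.cast_ne_zero.2 (NeZero.ne L)) h1.symm

/-! ### The spectrum of the `π`-flux phases -/

theorem hop_twistedField (hL : 4 ∣ L) (a b : ℤˣ) : hop (twistedField a b : Config L) =
    chain a ⊗ₖ (1 : Matrix (ZMod L) (ZMod L) ℂ) +
      (Matrix.diagonal fun x : ZMod L => (-1 : ℂ) ^ x.val) ⊗ₖ chain b := by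
  have h4 := four_le_of_four_dvd hL
  ext ⟨x₁, x₂⟩ ⟨y₁, y₂⟩
  rw [Matrix.add_apply, Matrix.kroneckerMap_apply, Matrix.kroneckerMap_apply, hop, Matrix.of_apply,
    link, Matrix.one_apply, Matrix.diagonal_apply]
  have t0 : ∀ u v : ZMod L, (twistedField a b : Config L) ((u, v), 0) = twistedBond a u :=
    fun u v => rfl
  have t1 : ∀ u v : ZMod L, (twistedField a b : Config L) ((u, v), 1) =
    (-1) ^ u.val * twistedBond b v := fun u v => rfl
  simp only [chain, Matrix.of_apply, t0, t1, unitVec_zero, unitVec_one, Prod.mk_add_mk, add_zero,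
    Prod.mk.injEq]
  by_cases h1 : x₁ = y₁ <;> by_cases h2 : x₂ = y₂
  · subst h1 h2; simp; split_ifs <;> ring
  · subst h1
    simp [h2, Ne.symm h2, mul_add]
  · subst h2
    simp [h1, Ne.symm h1]
  · simp [h1, h2, Ne.symm h1, Ne.symm h2]

theorem chain_anticomm (hL : 4 ∣ L) (a : ℤˣ) :
    chain a * (Matrix.diagonal fun x : ZMod L => (-1 : ℂ) ^ x.val) +
      (Matrix.diagonal fun x : ZMod L => (-1 : ℂ) ^ x.val) * chain a = 0 := by
  have hs : ∀ x : ZMod L, (-1 : ℂ) ^ (x + 1).val = -(-1) ^ x.val := fun x => by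
    have := congrArg (fun u : ℤˣ => ((u : ℤ) : ℂ)) (neg_one_pow_val_add_one hL x)
    simpa using this
  ext x y
  rw [Matrix.add_apply, Matrix.mul_diagonal, Matrix.diagonal_mul, Matrix.zero_apply]
  by_cases h1 : y = x + 1
  · rw [h1, hs]; ring
  · by_cases h2 : x = y + 1
    · rw [h2, hs]; ring
    · simp [chain, h1, h2]

/-- The square of the dispersion relation. -/
def dispersionSq (L : ℕ) (a b : ℤˣ) (k : ℕ × ℕ) : ℝ :=
  (2 * Real.cos (momentum L a k.1)) ^ 2 + (2 * Real.cos (momentum L b k.2)) ^ 2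

theorem hop_sq_mul_wave (hL : 4 ∣ L) (a b : ℤˣ) :
    hop (twistedField a b : Config L) * hop (twistedField a b : Config L) * (wave a ⊗ₖ wave b) =
      (wave a ⊗ₖ wave b) * Matrix.diagonal fun k : Site L =>
        ((dispersionSq L a b (k.1.val, k.2.val) : ℝ) : ℂ) := by
  have h4 := four_le_of_four_dvd hL
  set D := Matrix.diagonal fun x : ZMod L => (-1 : ℂ) ^ x.val with hD
  have hDD : D * D = 1 := by
    rw [hD, Matrix.diagonal_mul_diagonal, ← Matrix.diagonal_one]
    congr 1; ext x; rw [← mul_pow]; norm_num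
  have hsq : hop (twistedField a b : Config L) * hop (twistedField a b : Config L) =
      (chain a * chain a) ⊗ₖ (1 : Matrix (ZMod L) (ZMod L) ℂ) +
        (1 : Matrix (ZMod L) (ZMod L) ℂ) ⊗ₖ (chain b * chain b) := by
    rw [hop_twistedField hL, Matrix.add_mul, Matrix.mul_add, Matrix.mul_add]
    simp only [← Matrix.mul_kronecker_mul, Matrix.one_mul, Matrix.mul_one]
    rw [← hD, hDD]
    have : (chain a * D) ⊗ₖ chain b + (D * chain a) ⊗ₖ (chain b : Matrix (ZMod L) (ZMod L) ℂ) = 0 := by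
      rw [← Matrix.add_kronecker, hD, chain_anticomm hL, Matrix.zero_kronecker]
    rw [add_assoc, ← add_assoc ((chain a * D) ⊗ₖ chain b), this, zero_add]
  have hch : ∀ c : ℤˣ, chain c * chain c * wave c = wave c * Matrix.diagonal fun j : ZMod L =>
      (((2 * Real.cos (momentum L c j.val)) ^ 2 : ℝ) : ℂ) := by
    intro c
    rw [Matrix.mul_assoc, chain_mul_wave (by omega), ← Matrix.mul_assoc, chain_mul_wave (by omega),
      Matrix.mul_assoc, Matrix.diagonal_mul_diagonal]
    congr 2; ext j; push_cast; ring
  rw [hsq, Matrix.add_mul, ← Matrix.mul_kronecker_mul, ← Matrix.mul_kronecker_mul, Matrix.one_mul,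
    Matrix.one_mul, hch, hch]
  ext ⟨x₁, x₂⟩ ⟨p, q⟩
  simp only [Matrix.add_apply, Matrix.kroneckerMap_apply, Matrix.mul_diagonal, dispersionSq]
  push_cast
  ring

theorem prod_hopEig_twistedField (hL : 4 ∣ L) (a b : ℤˣ) (s : ℝ) :
    ∏ x, (s ^ 2 + hopEig (twistedField a b : Config L) x ^ 2) =
      ∏ k : Site L, (s ^ 2 + dispersionSq L a b (k.1.val, k.2.val)) := by
  set h := hop (twistedField a b : Config L) with hh
  set W := (wave a : Matrix (ZMod L) (ZMod L) ℂ) ⊗ₖ (wave b : Matrix (ZMod L) (ZMod L) ℂ) with hW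
  have hdet : W.det ≠ 0 := by
    rw [hW, Matrix.det_kronecker]
    exact mul_ne_zero (pow_ne_zero _ (det_wave_ne_zero a)) (pow_ne_zero _ (det_wave_ne_zero b))
  have h1 : (((s : ℂ) * Complex.I) • (1 : Matrix (Site L) (Site L) ℂ) + h) *
      ((-((s : ℂ) * Complex.I)) • (1 : Matrix (Site L) (Site L) ℂ) + h) * W =
      W * Matrix.diagonal fun k : Site L =>
        ((s ^ 2 + dispersionSq L a b (k.1.val, k.2.val) : ℝ) : ℂ) := by
    have e : (((s : ℂ) * Complex.I) • (1 : Matrix (Site L) (Site L) ℂ) + h) *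
        ((-((s : ℂ) * Complex.I)) • (1 : Matrix (Site L) (Site L) ℂ) + h) =
        ((s : ℂ) ^ 2) • 1 + h * h := by
      rw [Matrix.add_mul, Matrix.mul_add, Matrix.mul_add]
      simp only [Matrix.smul_mul, Matrix.mul_smul, Matrix.one_mul, Matrix.mul_one, smul_smul]
      rw [show -((s : ℂ) * Complex.I) * ((s : ℂ) * Complex.I) = (s : ℂ) ^ 2 by
        linear_combination (-(s : ℂ) ^ 2) * Complex.I_sq]
      rw [neg_smul]; abel
    rw [e, Matrix.add_mul, hop_sq_mul_wave hL, Matrix.smul_mul, Matrix.one_mul]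
    ext x k
    simp only [Matrix.add_apply, Matrix.smul_apply, Matrix.mul_diagonal, smul_eq_mul]
    push_cast; ring
  have h2 := congrArg Matrix.det h1
  rw [Matrix.det_mul, Matrix.det_mul, Matrix.det_mul, mul_comm _ W.det] at h2
  have h3 := mul_left_cancel₀ hdet h2
  rw [det_smul_one_add_eq_prod (hop_isHermitian _), det_smul_one_add_eq_prod (hop_isHermitian _),
    Matrix.det_diagonal, ← Finset.prod_mul_distrib] at h3
  have h4 : ((∏ x, (s ^ 2 + hopEig (twistedField a b : Config L) x ^ 2) : ℝ) : ℂ) =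
      ((∏ k : Site L, (s ^ 2 + dispersionSq L a b (k.1.val, k.2.val)) : ℝ) : ℂ) := by
    push_cast at h3 ⊢
    rw [← h3]
    refine Finset.prod_congr rfl fun x _ => ?_
    change _ = (s * Complex.I + (hopEig (twistedField a b : Config L) x : ℂ)) *
      (-(s * Complex.I) + (hopEig (twistedField a b : Config L) x : ℂ))
    linear_combination ((s : ℂ) ^ 2) * Complex.I_sq
  exact_mod_cast h4

theorem dispersionSq_nonneg (L : ℕ) (a b : ℤˣ) (k : ℕ × ℕ) : 0 ≤ dispersionSq L a b k :=
  add_nonneg (sq_nonneg _) (sq_nonneg _)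

theorem hopNorm_twistedField (hL : 4 ∣ L) (a b : ℤˣ) : hopNorm (twistedField a b : Config L) =
    ∑ p : ZMod L, ∑ q : ZMod L, √(dispersionSq L a b (p.val, q.val)) := by
  rw [← Fintype.sum_prod_type' (f := fun p q : ZMod L => √(dispersionSq L a b (p.val, q.val)))]
  have h1 : hopNorm (twistedField a b : Config L) =
      ∑ x, √(hopEig (twistedField a b : Config L) x ^ 2) := by
    simp only [Real.sqrt_sq_eq_abs, hopNorm]
  rw [h1]
  apply le_antisymm
  · exact sum_sqrt_le_of_prod_le (fun _ => sq_nonneg _) (fun k : Site L => dispersionSq_nonneg L a b _)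
      fun s _ => (prod_hopEig_twistedField hL a b s).le
  · exact sum_sqrt_le_of_prod_le (fun k : Site L => dispersionSq_nonneg L a b _) (fun _ => sq_nonneg _)
      fun s _ => (prod_hopEig_twistedField hL a b s).ge

/-! ### Dependence of the ground state energy on the boundary conditions -/

theorem prod_zmod_val {M : Type*} [CommMonoid M] (f : ℕ → M) :
    ∏ j : ZMod L, f j.val = ∏ k ∈ Finset.range L, f k :=
  Finset.prod_nbij' (fun j => j.val) (fun k => (k : ZMod L))
    (fun j _ => Finset.mem_range.2 j.val_lt) (fun _ _ => Finset.mem_univ _)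
    (fun j _ => ZMod.natCast_zmod_val j)
    (fun _ hk => ZMod.val_natCast_of_lt (Finset.mem_range.1 hk)) (fun _ _ => rfl)

theorem sum_zmod_val (f : ℕ → ℝ) : ∑ j : ZMod L, f j.val = ∑ k ∈ Finset.range L, f k :=
  Finset.sum_nbij' (fun j => j.val) (fun k => (k : ZMod L))
    (fun j _ => Finset.mem_range.2 j.val_lt) (fun _ _ => Finset.mem_univ _)
    (fun j _ => ZMod.natCast_zmod_val j)
    (fun _ hk => ZMod.val_natCast_of_lt (Finset.mem_range.1 hk)) (fun _ _ => rfl)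

theorem prod_sub_exp_momentum (a : ℤˣ) (z : ℂ) :
    ∏ i ∈ Finset.range L, (z - Complex.exp (momentum L a i * Complex.I)) = z ^ L - ((a : ℤ) : ℂ) := by
  have hL : (L : ℂ) ≠ 0 := Nat.cast_ne_zero.2 (NeZero.ne L)
  have h := X_pow_sub_C_eq_prod (Complex.isPrimitiveRoot_exp L (NeZero.ne L)) (NeZero.pos L)
    (α := Complex.exp (momentum L a 0 * Complex.I)) (a := ((a : ℤ) : ℂ))
    (by rw [← Complex.exp_nat_mul, exp_momentum_mul])
  have h2 := congrArg (Polynomial.eval z) h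
  rw [Polynomial.eval_prod] at h2
  simp only [Polynomial.eval_sub, Polynomial.eval_pow, Polynomial.eval_X, Polynomial.eval_C] at h2
  rw [h2]
  refine Finset.prod_congr rfl fun i _ => ?_
  rw [← Complex.exp_nat_mul, ← Complex.exp_add, momentum, momentum]
  congr 2
  push_cast
  field_simp
  ring

theorem normSq_factor (k u : ℝ) : 4 * Real.sinh u ^ 2 + (2 * Real.cos k) ^ 2 =
    Complex.normSq (-(Complex.I * Real.exp u) - Complex.exp (k * Complex.I)) *
      Complex.normSq (Complex.I * Real.exp (-u) - Complex.exp (k * Complex.I)) := by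
  have h1 : Real.exp u * Real.exp (-u) = 1 := by rw [← Real.exp_add]; simp
  rw [Complex.exp_mul_I, ← Complex.ofReal_cos, ← Complex.ofReal_sin, Real.sinh_eq]
  have h2 := Real.sin_sq_add_cos_sq k
  set E := Real.exp u
  set F := Real.exp (-u)
  set c := Real.cos k
  set s := Real.sin k
  rw [show -(Complex.I * (E : ℂ)) - ((c : ℂ) + s * Complex.I) =
      ((-c : ℝ) : ℂ) + ((-E - s : ℝ) : ℂ) * Complex.I by push_cast; ring,
    show Complex.I * (F : ℂ) - ((c : ℂ) + s * Complex.I) =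
      ((-c : ℝ) : ℂ) + ((F - s : ℝ) : ℂ) * Complex.I by push_cast; ring,
    Complex.normSq_add_mul_I, Complex.normSq_add_mul_I]
  have e1 : (-c) ^ 2 + (-E - s) ^ 2 = 1 + E ^ 2 + 2 * E * s := by linear_combination h2
  have e2 : (-c) ^ 2 + (F - s) ^ 2 = 1 + F ^ 2 - 2 * F * s := by linear_combination h2
  rw [e1, e2]
  linear_combination (-(E * F + 3) + 2 * E * s - 2 * F * s + 4 * s ^ 2) * h1 + 4 * h2

theorem prod_sinh_add_cos (hL : 4 ∣ L) (a : ℤˣ) (u : ℝ) :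
    ∏ i ∈ Finset.range L, (4 * Real.sinh u ^ 2 + (2 * Real.cos (momentum L a i)) ^ 2) =
      (2 * Real.cosh (L * u) - 2 * ((a : ℤ) : ℝ)) ^ 2 := by
  simp only [normSq_factor, Finset.prod_mul_distrib]
  rw [← map_prod, ← map_prod, prod_sub_exp_momentum, prod_sub_exp_momentum]
  have hI : Complex.I ^ L = 1 := by
    obtain ⟨q, rfl⟩ := hL
    rw [pow_mul, Complex.I_pow_four, one_pow]
  have hev : Even L := even_iff_two_dvd.2 (Dvd.dvd.trans ⟨2, rfl⟩ hL)
  rw [hev.neg_pow, mul_pow, mul_pow, hI, one_mul, one_mul, ← Complex.ofReal_pow, ← Complex.ofReal_pow,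
    ← Real.exp_nat_mul, ← Real.exp_nat_mul, mul_neg]
  rw [show (((a : ℤ) : ℂ)) = (((a : ℤ) : ℝ) : ℂ) by push_cast; rfl, ← Complex.ofReal_sub,
    ← Complex.ofReal_sub, Complex.normSq_ofReal, Complex.normSq_ofReal, Real.cosh_eq]
  have h1 : Real.exp (L * u) * Real.exp (-(L * u)) = 1 := by rw [← Real.exp_add]; simp
  have h2 : ((a : ℤ) : ℝ) * ((a : ℤ) : ℝ) = 1 := by exact_mod_cast units_coe_mul_self a
  set E := Real.exp (L * u)
  set F := Real.exp (-(L * u))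
  set A := ((a : ℤ) : ℝ)
  have e : (E - A) * (F - A) = 2 - A * (E + F) := by linear_combination h1 + h2
  calc _ = ((E - A) * (F - A)) ^ 2 := by ring
    _ = (2 - A * (E + F)) ^ 2 := by rw [e]
    _ = _ := by linear_combination ((E + F) ^ 2 - 4) * h2

theorem mul_sinh_le_sinh_mul {u : ℝ} (hu : 0 ≤ u) (m : ℕ) : m * Real.sinh u ≤ Real.sinh (m * u) := by
  induction m with
  | zero => simp
  | succ m ih =>
    rw [Nat.cast_succ, add_mul, one_mul, add_mul, one_mul, Real.sinh_add]
    have h1 := Real.one_le_cosh u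
    have h2 := Real.one_le_cosh (m * u)
    have h3 := Real.sinh_nonneg_iff.2 hu
    have h4 : 0 ≤ Real.sinh (m * u) := Real.sinh_nonneg_iff.2 (by positivity)
    nlinarith

theorem prod_antiperiodic_le (hL : 4 ∣ L) {σ : ℝ} (hσ : 0 < σ) :
    (∏ i ∈ Finset.range L, (σ + (2 * Real.cos (momentum L (-1) i)) ^ 2)) * σ ^ 2 ≤
      (∏ i ∈ Finset.range L, (σ + (2 * Real.cos (momentum L 1 i)) ^ 2)) *
        (σ + 16 / (L : ℝ) ^ 2) ^ 2 := by
  obtain ⟨u, hu, rfl⟩ : ∃ u : ℝ, 0 ≤ u ∧ σ = 4 * Real.sinh u ^ 2 := by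
    refine ⟨Real.arsinh (√σ / 2), Real.arsinh_nonneg_iff.2 (by positivity), ?_⟩
    rw [Real.sinh_arsinh, div_pow, Real.sq_sqrt hσ.le]; ring
  rw [prod_sinh_add_cos hL, prod_sinh_add_cos hL, ← mul_pow, ← mul_pow]
  obtain ⟨q, rfl⟩ := hL
  have hq : (0 : ℝ) < q := Nat.cast_pos.2 (Nat.pos_of_ne_zero fun h => NeZero.ne (4 * q) (by simp [h]))
  have h1 := mul_sinh_le_sinh_mul hu (2 * q)
  have hc : Real.cosh (((4 * q : ℕ) : ℝ) * u) = 2 * Real.sinh (((2 * q : ℕ) : ℝ) * u) ^ 2 + 1 := by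
    rw [show ((4 * q : ℕ) : ℝ) * u = 2 * (((2 * q : ℕ) : ℝ) * u) by push_cast; ring, Real.cosh_two_mul,
      Real.cosh_sq]; ring
  rw [hc]
  have h2 : 0 ≤ Real.sinh u := Real.sinh_nonneg_iff.2 hu
  set S := Real.sinh (((2 * q : ℕ) : ℝ) * u)
  set r := Real.sinh u
  have h3 : (2 * q * r) ^ 2 ≤ S ^ 2 := pow_le_pow_left₀ (by positivity) (by push_cast at h1; exact h1) 2
  refine pow_le_pow_left₀ ?_ ?_ 2
  · simp; positivity
  · have e : (16 : ℝ) / ((4 * q : ℕ) : ℝ) ^ 2 = 1 / (q : ℝ) ^ 2 := by push_cast; field_simp; norm_num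
    rw [e]
    have h4 : 4 * r ^ 2 ≤ S ^ 2 * (1 / (q : ℝ) ^ 2) := by
      rw [mul_one_div, le_div_iff₀ (by positivity)]; linarith
    simp
    simp at h4
    nlinarith

/-- The sum of the square roots over the momenta of a chain. -/
def chainSum (L : ℕ) [NeZero L] (a : ℤˣ) (y : ℝ) : ℝ :=
  ∑ j : ZMod L, √(y + (2 * Real.cos (momentum L a j.val)) ^ 2)

theorem chainSum_antiperiodic_le (hL : 4 ∣ L) {y : ℝ} (hy : 0 ≤ y) :
    chainSum L (-1) y + 2 * √y ≤ chainSum L 1 y + 2 * √(y + 16 / (L : ℝ) ^ 2) := by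
  have hL0 : (0 : ℝ) < (L : ℝ) := Nat.cast_pos.2 (NeZero.pos L)
  have := sum_sqrt_le_of_prod_le (ι := ZMod L ⊕ Fin 2)
    (y := Sum.elim (fun j => y + (2 * Real.cos (momentum L (-1) j.val)) ^ 2) fun _ => y)
    (z := Sum.elim (fun j => y + (2 * Real.cos (momentum L 1 j.val)) ^ 2)
      fun _ => y + 16 / (L : ℝ) ^ 2)
    (by rintro (j | i) <;> simp <;> positivity) (by rintro (j | i) <;> simp <;> positivity)
    (fun s hs => by
      simp only [Fintype.prod_sum_type, Sum.elim_inl, Sum.elim_inr, Finset.prod_const, Finset.card_univ,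
        Fintype.card_fin, ← add_assoc]
      rw [prod_zmod_val (fun j => s ^ 2 + y + (2 * Real.cos (momentum L (-1) j)) ^ 2),
        prod_zmod_val (fun j => s ^ 2 + y + (2 * Real.cos (momentum L 1 j)) ^ 2)]
      exact prod_antiperiodic_le hL (by positivity))
  simpa [chainSum, Fintype.sum_sum_type] using this

/-- The error in the comparison of the boundary conditions. -/
def chainError (L : ℕ) [NeZero L] (a : ℤˣ) : ℝ :=
  ∑ j : ZMod L, (√((2 * Real.cos (momentum L a j.val)) ^ 2 + 16 / (L : ℝ) ^ 2) -
    √((2 * Real.cos (momentum L a j.val)) ^ 2))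

theorem hopNorm_eq_chainSum_left (hL : 4 ∣ L) (a b : ℤˣ) :
    hopNorm (twistedField a b : Config L) =
      ∑ q : ZMod L, chainSum L a ((2 * Real.cos (momentum L b q.val)) ^ 2) := by
  rw [hopNorm_twistedField hL, Finset.sum_comm]
  simp only [chainSum, dispersionSq, add_comm]

theorem hopNorm_eq_chainSum_right (hL : 4 ∣ L) (a b : ℤˣ) :
    hopNorm (twistedField a b : Config L) =
      ∑ p : ZMod L, chainSum L b ((2 * Real.cos (momentum L a p.val)) ^ 2) := by
  rw [hopNorm_twistedField hL]
  simp only [chainSum, dispersionSq]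

theorem sum_chainSum_antiperiodic_le (hL : 4 ∣ L) (a : ℤˣ) :
    ∑ q : ZMod L, chainSum L (-1) ((2 * Real.cos (momentum L a q.val)) ^ 2) ≤
      ∑ q : ZMod L, chainSum L 1 ((2 * Real.cos (momentum L a q.val)) ^ 2) + 2 * chainError L a := by
  rw [chainError, Finset.mul_sum, ← Finset.sum_add_distrib]
  refine Finset.sum_le_sum fun q _ => ?_
  have := chainSum_antiperiodic_le hL (sq_nonneg (2 * Real.cos (momentum L a q.val)))
  linarith

theorem sqrt_sub_abs_le {q x : ℝ} {i : ℕ} (hq : 0 < q) (hx : 2 * i / q ≤ |x|) :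
    √(x ^ 2 + (1 / q) ^ 2) - √(x ^ 2) ≤ 1 / q * (1 / (i + 1)) := by
  rw [Real.sqrt_sq_eq_abs, sub_le_iff_le_add, ← sq_abs x]
  refine Real.sqrt_le_iff.2 ⟨by positivity, ?_⟩
  rw [div_le_iff₀ hq] at hx
  have h1 : (1 : ℝ) ≤ 2 * (|x| * q) * (1 / (i + 1)) + (1 / (i + 1)) ^ 2 := by
    rcases Nat.eq_zero_or_pos i with rfl | hi
    · simp; positivity
    · have hi' : (1 : ℝ) ≤ i := by exact_mod_cast hi
      have h2 : (1 : ℝ) ≤ 2 * (|x| * q) * (1 / (i + 1)) := by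
        rw [mul_one_div, le_div_iff₀ (by positivity)]; linarith
      have : (0 : ℝ) ≤ (1 / ((i : ℝ) + 1)) ^ 2 := by positivity
      linarith
  have h3 := mul_le_mul_of_nonneg_left h1 (sq_nonneg (1 / q))
  calc |x| ^ 2 + (1 / q) ^ 2 ≤ |x| ^ 2 +
        (1 / q) ^ 2 * (2 * (|x| * q) * (1 / (i + 1)) + (1 / (i + 1)) ^ 2) := by linarith
    _ = _ := by field_simp; ring

theorem sum_range_four_mul (f : ℕ → ℝ) (q : ℕ) : ∑ k ∈ Finset.range (4 * q), f k =
    ∑ i ∈ Finset.range q, (f i + f (q + i) + f (2 * q + i) + f (3 * q + i)) := by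
  rw [show 4 * q = q + q + q + q by ring, Finset.sum_range_add, Finset.sum_range_add,
    Finset.sum_range_add, ← Finset.sum_add_distrib, ← Finset.sum_add_distrib, ← Finset.sum_add_distrib]
  refine Finset.sum_congr rfl fun i _ => ?_
  rw [show q + q + i = 2 * q + i by ring, show q + q + q + i = 3 * q + i by ring]

theorem chainError_le (hL : 4 ∣ L) (a : ℤˣ) : chainError L a ≤ 16 * (1 + Real.log L) / L := by
  rw [chainError, sum_zmod_val (fun j => √((2 * Real.cos (momentum L a j)) ^ 2 + 16 / (L : ℝ) ^ 2) -
    √((2 * Real.cos (momentum L a j)) ^ 2))]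
  obtain ⟨q, rfl⟩ := hL
  have hq0 : 0 < q := Nat.pos_of_ne_zero fun h => NeZero.ne (4 * q) (by simp [h])
  have hq : (0 : ℝ) < q := Nat.cast_pos.2 hq0
  have hpi := Real.pi_pos
  have hθ0 : 0 ≤ twist a := by unfold twist; split_ifs <;> norm_num
  have hθ1 : twist a ≤ 1 := by unfold twist; split_ifs <;> norm_num
  have e : (16 : ℝ) / ((4 * q : ℕ) : ℝ) ^ 2 = (1 / (q : ℝ)) ^ 2 := by push_cast; field_simp; norm_num
  rw [e, sum_range_four_mul]
  set φ : ℕ → ℝ := fun i => momentum (4 * q) a i with hφ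
  set g : ℝ → ℝ := fun x => √(x ^ 2 + (1 / (q : ℝ)) ^ 2) - √(x ^ 2) with hg
  have hgn : ∀ x, g (-x) = g x := fun x => by simp [hg]
  have hφe : ∀ i, φ i = Real.pi / 2 * ((i + twist a) / q) := by
    intro i; simp only [hφ, momentum]; push_cast; field_simp; ring
  have hadd : ∀ (c i : ℕ), momentum (4 * q) a (c * q + i) = φ i + c * (Real.pi / 2) := by
    intro c i; simp only [hφ, momentum]; push_cast; field_simp; ring
  have hsin : ∀ i ∈ Finset.range q, g (2 * Real.sin (φ i)) ≤ 1 / q * (1 / (i + 1)) := by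
    intro i hi
    have hi' : (i : ℝ) + 1 ≤ q := by exact_mod_cast Finset.mem_range.1 hi
    have h0 : 0 ≤ φ i := by rw [hφe]; positivity
    have h1 : φ i ≤ Real.pi / 2 := by
      rw [hφe]
      refine mul_le_of_le_one_right (by positivity) ?_
      rw [div_le_one hq]; linarith
    have h2 := Real.mul_le_sin h0 h1
    refine sqrt_sub_abs_le hq ((?_ : _ ≤ 2 * Real.sin (φ i)).trans (le_abs_self _))
    have h3 : 2 / Real.pi * φ i = (i + twist a) / q := by rw [hφe]; field_simp
    rw [h3] at h2
    have h4 : (i : ℝ) / q ≤ (i + twist a) / q := by gcongr; linarith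
    rw [mul_div_assoc]; linarith
  have hcos : ∀ i ∈ Finset.range q, g (2 * Real.cos (φ i)) ≤ 1 / q * (1 / ((q - 1 - i : ℕ) + 1)) := by
    intro i hi
    have hi2 := Finset.mem_range.1 hi
    have hi' : (i : ℝ) + 1 ≤ q := by exact_mod_cast hi2
    have h0 : 0 ≤ φ i := by rw [hφe]; positivity
    have h1 : φ i ≤ Real.pi / 2 := by
      rw [hφe]
      refine mul_le_of_le_one_right (by positivity) ?_
      rw [div_le_one hq]; linarith
    have h2 := Real.mul_le_sin (x := Real.pi / 2 - φ i) (by linarith) (by linarith)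
    rw [Real.sin_pi_div_two_sub] at h2
    refine sqrt_sub_abs_le hq ((?_ : _ ≤ 2 * Real.cos (φ i)).trans (le_abs_self _))
    have h3 : 2 / Real.pi * (Real.pi / 2 - φ i) = (q - i - twist a) / q := by
      rw [hφe]; field_simp; ring
    rw [h3] at h2
    have h5 : ((q - 1 - i : ℕ) : ℝ) = q - 1 - i := by
      rw [Nat.sub_sub, Nat.cast_sub (by omega)]; push_cast; ring
    have h4 : ((q - 1 - i : ℕ) : ℝ) / q ≤ (q - i - twist a) / q := by
      rw [h5]; gcongr ?_ / _; linarith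
    rw [mul_div_assoc]; linarith
  have hharm : ∑ i ∈ Finset.range q, 1 / (q : ℝ) * (1 / ((i : ℝ) + 1)) ≤
      1 / q * (1 + Real.log q) := by
    rw [← Finset.mul_sum]
    refine mul_le_mul_of_nonneg_left ?_ (by positivity)
    have h := harmonic_le_one_add_log q
    rw [harmonic] at h
    push_cast at h
    simpa [one_div] using h
  have hrefl : ∑ i ∈ Finset.range q, 1 / (q : ℝ) * (1 / (((q - 1 - i : ℕ) : ℝ) + 1)) =
      ∑ i ∈ Finset.range q, 1 / (q : ℝ) * (1 / ((i : ℝ) + 1)) :=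
    Finset.sum_range_reflect (fun i : ℕ => 1 / (q : ℝ) * (1 / ((i : ℝ) + 1))) q
  have hterm : ∀ i ∈ Finset.range q, g (2 * Real.cos (momentum (4 * q) a i)) +
      g (2 * Real.cos (momentum (4 * q) a (q + i))) +
      g (2 * Real.cos (momentum (4 * q) a (2 * q + i))) +
      g (2 * Real.cos (momentum (4 * q) a (3 * q + i))) ≤
      2 * (1 / q * (1 / (((q - 1 - i : ℕ) : ℝ) + 1))) + 2 * (1 / q * (1 / ((i : ℝ) + 1))) := by
    intro i hi
    have h1 : Real.cos (momentum (4 * q) a (q + i)) = -Real.sin (φ i) := by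
      have := hadd 1 i
      rw [one_mul] at this
      rw [this, Nat.cast_one, one_mul, Real.cos_add_pi_div_two]
    have h2 : Real.cos (momentum (4 * q) a (2 * q + i)) = -Real.cos (φ i) := by
      rw [hadd 2 i, show φ i + (2 : ℕ) * (Real.pi / 2) = φ i + Real.pi by push_cast; ring,
        Real.cos_add_pi]
    have h3 : Real.cos (momentum (4 * q) a (3 * q + i)) = Real.sin (φ i) := by
      rw [hadd 3 i, show φ i + (3 : ℕ) * (Real.pi / 2) = (φ i + Real.pi / 2) + Real.pi by
        push_cast; ring, Real.cos_add_pi, Real.cos_add_pi_div_two, neg_neg]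
    rw [h1, h2, h3, mul_neg, hgn, mul_neg, hgn]
    have := hsin i hi
    have h4 := hcos i hi
    change g (2 * Real.cos (φ i)) + _ + _ + _ ≤ _
    linarith
  refine (Finset.sum_le_sum hterm).trans ?_
  have hA := Finset.mul_sum (Finset.range q)
    (fun i => 1 / (q : ℝ) * (1 / (((q - 1 - i : ℕ) : ℝ) + 1))) 2
  have hB := Finset.mul_sum (Finset.range q) (fun i : ℕ => 1 / (q : ℝ) * (1 / ((i : ℝ) + 1))) 2
  rw [Finset.sum_add_distrib, ← hA, ← hB, hrefl]
  have hlog : Real.log q ≤ Real.log ((4 * q : ℕ) : ℝ) :=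
    Real.log_le_log hq (by push_cast; linarith)
  have h16 : 16 * (1 + Real.log ((4 * q : ℕ) : ℝ)) / ((4 * q : ℕ) : ℝ) =
      4 * (1 / q * (1 + Real.log ((4 * q : ℕ) : ℝ))) := by
    rw [Nat.cast_mul]; push_cast; field_simp; norm_num
  rw [h16]
  have : 1 / (q : ℝ) * (1 + Real.log q) ≤ 1 / q * (1 + Real.log ((4 * q : ℕ) : ℝ)) := by gcongr
  linarith

theorem hopNorm_sub_le (hL : 4 ∣ L) (a b : ℤˣ) :
    hopNorm (twistedField (-1) (-1) : Config L) - hopNorm (twistedField a b : Config L) ≤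
      64 * (1 + Real.log L) / L := by
  have h0 : 0 ≤ 16 * (1 + Real.log L) / (L : ℝ) := by
    have := Real.log_natCast_nonneg L
    positivity
  have h1 := sum_chainSum_antiperiodic_le hL (-1)
  have h2 := sum_chainSum_antiperiodic_le hL 1
  have h3 := chainError_le hL (-1)
  have h4 := chainError_le hL 1
  have h5 : 64 * (1 + Real.log L) / (L : ℝ) = 4 * (16 * (1 + Real.log L) / L) := by ring
  rw [h5]
  rcases Int.units_eq_one_or a with rfl | rfl <;> rcases Int.units_eq_one_or b with rfl | rfl
  · have e1 := hopNorm_eq_chainSum_left hL (-1) (-1)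
    have e2 := hopNorm_eq_chainSum_left hL 1 (-1)
    have e3 := hopNorm_eq_chainSum_right hL 1 (-1)
    have e4 := hopNorm_eq_chainSum_right hL 1 1
    linarith
  · have e1 := hopNorm_eq_chainSum_left hL (-1) (-1)
    have e2 := hopNorm_eq_chainSum_left hL 1 (-1)
    linarith
  · have e1 := hopNorm_eq_chainSum_right hL (-1) (-1)
    have e2 := hopNorm_eq_chainSum_right hL (-1) 1
    linarith
  · linarith

theorem one_add_log_div_le {α : ℝ} (hα : 0 < α) :
    (1 + Real.log L) / (L : ℝ) ≤ (1 + 1 / (3 * α)) / (L : ℝ) ^ (1 - 3 * α) := by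
  have hL1 : (1 : ℝ) ≤ L := Nat.one_le_cast.2 (NeZero.pos L)
  have hL0 : (0 : ℝ) < L := by linarith
  have h1 : Real.log L ≤ (L : ℝ) ^ (3 * α) / (3 * α) := Real.log_le_rpow_div hL0.le (by positivity)
  have h2 : 1 ≤ (L : ℝ) ^ (3 * α) := Real.one_le_rpow hL1 (by positivity)
  rw [Real.rpow_sub hL0, Real.rpow_one, div_div_eq_mul_div]
  gcongr
  calc 1 + Real.log L ≤ (L : ℝ) ^ (3 * α) + (L : ℝ) ^ (3 * α) / (3 * α) := by linarith
    _ = _ := by ring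

end

end Z2Gauge

open Z2Gauge
theorem theorem2p1 :
    ∃ (κ t₀ : ℝ) (K C : ℝ → ℝ), 0 < κ ∧ 0 < t₀ ∧ 1 ≤ κ * t₀ ∧ ∀ t : ℝ, t₀ < t →
      -- free energy and Gibbs state
      (∃ Δ : ℝ → ℕ → ℝ,
        Tendsto (fun p : ℝ × ℕ => Δ p.1 p.2) (atTop ×ˢ atTop) (𝓝 (κ * t)) ∧
        ∀ (β : ℝ) (L : ℕ) [NeZero L], 0 < β → 4 ∣ L →
          0 ≤ β * (L : ℝ) ^ 2 * (piFreeEnergy L t β - freeEnergy L t β) ∧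
          β * (L : ℝ) ^ 2 * (piFreeEnergy L t β - freeEnergy L t β) ≤
            Real.log ((1 + Real.exp (-β * (Δ β L - 1))) ^ (L ^ 2) +
              (1 - Real.exp (-β * (Δ β L - 1))) ^ (L ^ 2)) + Real.log 2 ∧
          ∀ O : TotalOp L, IsMagneticGaugeInvariant O →
            ∀ s : ℤˣ → ℤˣ → Config L, (∀ a b, IsPiFlux (s a b) a b) →
              ‖gibbs t β O - piExpect t β s O‖ ≤
                K (maxNorm O) * ((1 + Real.exp (-β * (Δ β L - 1))) ^ (L ^ 2) - 1)) ∧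
      -- ground state energies of the `π`-flux phases
      ∀ (L : ℕ) [NeZero L], 4 ∣ L →
        ∃ E : ℤˣ → ℤˣ → ℝ,
          (∀ a b, Tendsto (fun β : ℝ => -(1 / β) * Real.log (piPartitionFn L t β a b))
            atTop (𝓝 (E a b))) ∧
          (∀ a b, ∀ σ : Config L, IsPiFlux σ a b →
            IsLeast {x : ℝ | (x : ℂ) ∈ spectrum ℂ (fermiHam t σ)} (E a b - (L : ℝ) ^ 2)) ∧
          (∀ a b, E (-1) (-1) ≤ E a b) ∧
          ∀ α : ℝ, 0 < α → α < 1 / 3 → ∀ a b,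
            |E a b - E (-1) (-1)| ≤ C α * t / (L : ℝ) ^ (1 - 3 * α) := by
  have hκ : 0 < gapConst := by unfold gapConst; norm_num
  refine ⟨gapConst, 1 / gapConst, fun x => 8 * x, fun α => 32 * (1 + 1 / (3 * α)), hκ,
    one_div_pos.2 hκ, (mul_one_div_cancel hκ.ne').ge, fun t ht => ?_⟩
  have ht0 : 0 < t := (one_div_pos.2 hκ).trans ht
  have ht1 : 1 ≤ gapConst * t := by
    rw [div_lt_iff₀ hκ] at ht
    linarith
  refine ⟨⟨gap t, tendsto_gap t, fun β L _ hβ hL => ?_⟩, fun L _ hL => ?_⟩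
  · exact ⟨(freeEnergy_bounds hL hβ ht1 ht0).1, (freeEnergy_bounds hL hβ ht1 ht0).2,
      fun O hO s hs => norm_gibbs_sub_piExpect_le hL hβ ht1 ht0 hO hs⟩
  · have hπ : ∀ a b, IsPiFlux (twistedField a b : Config L) a b := isPiFlux_twistedField hL
    have hle : ∀ a b, hopNorm (twistedField a b : Config L) ≤
        hopNorm (twistedField (-1) (-1) : Config L) := fun a b =>
      sum_abs_hopEig_le hL (hπ (-1) (-1)) _
    refine ⟨fun a b => (L : ℝ) ^ 2 - t / 2 * hopNorm (twistedField a b : Config L),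
      fun a b => tendsto_piPartitionFn hL ht0 (hπ a b), fun a b σ hσ => ?_, fun a b => ?_,
      fun α hα _ a b => ?_⟩
    · obtain ⟨g, rfl⟩ := isPiFlux_gaugeTransform_eq hL (hπ a b) hσ
      have := isLeast_spectrum_fermiHam hL ht0 (gaugeTransform g (twistedField a b))
      rw [hopNorm_gaugeTransform hL] at this
      convert this using 1
      ring
    · have := mul_le_mul_of_nonneg_left (hle a b) (half_pos ht0).le
      linarith
    · have h1 := mul_le_mul_of_nonneg_left (hle a b) (half_pos ht0).le
      have h2 := mul_le_mul_of_nonneg_left (hopNorm_sub_le hL a b) (half_pos ht0).le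
      have h3 := mul_le_mul_of_nonneg_left (one_add_log_div_le (L := L) hα)
        (mul_pos (by norm_num : (0 : ℝ) < 32) ht0).le
      rw [abs_of_nonneg (by linarith)]
      calc _ = t / 2 * (hopNorm (twistedField (-1) (-1) : Config L) -
            hopNorm (twistedField a b : Config L)) := by ring
        _ ≤ t / 2 * (64 * (1 + Real.log L) / L) := h2
        _ = 32 * t * ((1 + Real.log L) / L) := by ring
        _ ≤ _ := h3
        _ = _ := by ring
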